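/- Notation. For a smooth $F:\mathbb R^2\to\mathbb R$, a gradient line of $F$ from $p$ to $q$ (written $p\to q$) is a curve $\gamma:\mathbb R\to\mathbb R^2$ with $\dot\gamma=\nabla F(\gamma)$, $\gamma(t)\to p$ as $t\to-\infty$ and $\gamma(t)\to q$ as $t\to+\infty$. An (unstable) node is a critical point with positive definite Hessian; a saddle is a critical point whose Hessian has a positive and a negative eigenvalue. Let $f(y)=\frac13y_1^3-y_1y_2^2$ be the generating function of the elliptic umbilic, let $\tilde f=f+g$ be a perturbation of it, with $g\in C^\infty(\mathbb R^2)$ and $|\nabla g(y)|=o(|y|^2)$ as $|y|\to\infty$ (for instance $g$ compactly supported or quadratic, small or not), and put $\tilde f_x(y)=\tilde f(y)-x\cdot y$ for $x\in\mathbb R^2$. The caustic $K$ is the set of $x$ for which $\tilde f_x$ has a degenerate critical point. Let $\Omega\subset\mathbb R^2$ (the inside of the caustic) be a non-empty connected open set with $\partial\Omega\subset K$ such that for every $x\in\Omega$ the critical points of $\tilde f_x$ are exactly a node $n(x)$ and three distinct saddles $s_1(x),s_2(x),s_3(x)$, all depending continuously on $x\in\Omega$. The side $l_i$ of the caustic is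 the set of $p\in\partial\Omega$ such that $n(x)$ and $s_i(x)$ tend, as $x\to p$ in $\Omega$, to one and the same fold critical point of $\tilde f_p$ (Hessian of rank one, third derivative non-zero along its kernel). Let $\mathcal B_{ij}$ be the set of $x\in\Omega$ for which $\tilde f_x$ has a gradient line from $s_i(x)$ to $s_j(x)$. The part inside the caustic of a bifurcation line of type $(j,k)$ with extreme on $l_j$ and crossing $l_i$ is a curve $L((0,1))\subset\mathcal B_{jk}$, where $L:[0,1]\to\mathbb R^2$ is continuous, $L(0)\in l_j$ and $L(1)\in l_i$. Proposition. (1) Let $F:\mathbb R^2\to\mathbb R$ be smooth, and let its critical points be exactly a node $n$ and three distinct saddles $s_1,s_2,s_3$. Then $F$ cannot have gradient lines $n\to s_2$, $n\to s_3$, $s_2\to s_1$ and $s_3\to s_1$ all at the same time. (2) Consider two bifurcation lines in configuration (d): $L_1$ is of type $(2,1)$, crosses $l_3$ and has its extreme on $l_2$; $L_2$ is of type $(3,1)$, crosses $l_2$ and has its extreme on $l_3$. Suppose that, as in the diagram, no bifurcation lines of other types pass through these two lines, that is, no point of $L_1((0,1))\cup L_2((0,1))$ lies in a set $\mathcal B_{ij}$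 with $i\ne j$ and $j\neq 1$. Then $L_1$ and $L_2$ do not intersect inside the caustic: $L_1((0,1))\cap L_2((0,1))=\emptyset$. -/

import Mathlib

open Set Filter Topology Asymptotics
open scoped ContDiff

namespace GradientLines

/-- The Euclidean plane. It serves both as the plane of the variable `y` and as the plane of the
parameter `x`. -/
abbrev Plane : Type := EuclideanSpace ℝ (Fin 2)

/-- The generating function of the elliptic umbilic; its gradient is
`(y₁² - y₂², -2 y₁ y₂)`. -/
noncomputable def ellipticUmbilic (y : Plane) : ℝ := (y 0) ^ 3 / 3 - y 0 * (y 1) ^ 2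

/-- The function `f_x (y) = f y - x · y`. -/
noncomputable def phase (f : Plane → ℝ) (x : Plane) : Plane → ℝ := fun y => f y - inner ℝ x y

/-- The Hessian of `F` at `y`, as a bilinear form. -/
noncomputable def hessian (F : Plane → ℝ) (y : Plane) : Plane →L[ℝ] Plane →L[ℝ] ℝ :=
  fderiv ℝ (fderiv ℝ F) y

/-- `γ` is a gradient line of `F` from `p` to `q`: an integral curve of `∇F` that tends to `p` as
`t → -∞` and to `q` as `t → +∞`. -/
def IsGradientLine (F : Plane → ℝ) (γ : ℝ → Plane) (p q : Plane) : Prop :=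
  (∀ t, HasDerivAt γ (gradient F (γ t)) t) ∧ Tendsto γ atBot (𝓝 p) ∧ Tendsto γ atTop (𝓝 q)

/-- There is a gradient line of `F` from `p` to `q`. -/
def Connects (F : Plane → ℝ) (p q : Plane) : Prop := ∃ γ : ℝ → Plane, IsGradientLine F γ p q

/-- A critical point at which the linearization of `∇F` (the Hessian) has two positive
eigenvalues. -/
def IsUnstableNode (F : Plane → ℝ) (y : Plane) : Prop :=
  gradient F y = 0 ∧ ∀ v, v ≠ 0 → 0 < hessian F y v v

/-- A critical point at which the linearization of `∇F` (the Hessian) has a positive and a negative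
eigenvalue. -/
def IsSaddle (F : Plane → ℝ) (y : Plane) : Prop :=
  gradient F y = 0 ∧ (∃ v, 0 < hessian F y v v) ∧ ∃ w, hessian F y w w < 0

/-- The critical points of `F` are exactly an unstable node `n` and three distinct saddles
`s 0`, `s 1`, `s 2`. -/
def HasNodeAndThreeSaddles (F : Plane → ℝ) (n : Plane) (s : Fin 3 → Plane) : Prop :=
  IsUnstableNode F n ∧ (∀ i, IsSaddle F (s i)) ∧ Function.Injective s ∧
    ∀ y, gradient F y = 0 → y = n ∨ ∃ i, y = s i

/-- The caustic: the parameters `x` for which `f_x` has a degenerate critical point. -/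
def caustic (f : Plane → ℝ) : Set Plane :=
  {x | ∃ y, gradient (phase f x) y = 0 ∧ ∃ v, v ≠ 0 ∧ hessian (phase f x) y v = 0}

/-- A fold critical point: the Hessian has rank one, and the third derivative does not vanish along
its kernel. -/
def IsFold (F : Plane → ℝ) (q : Plane) : Prop :=
  gradient F q = 0 ∧ hessian F q ≠ 0 ∧
    ∃ v, v ≠ 0 ∧ hessian F q v = 0 ∧ iteratedFDeriv ℝ 3 F q (fun _ => v) ≠ 0

/-- `Ω` is a domain bounded by the caustic over which `f_x` has exactly four critical points: a node
`n x` and three saddles `s i x`, all depending continuously on `x`. -/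
structure IsInsideCaustic (f : Plane → ℝ) (Ω : Set Plane) (n : Plane → Plane)
    (s : Fin 3 → Plane → Plane) : Prop where
  isOpen : IsOpen Ω
  isConnected : IsConnected Ω
  frontier_subset : frontier Ω ⊆ caustic f
  critical : ∀ x ∈ Ω, HasNodeAndThreeSaddles (phase f x) (n x) (fun i => s i x)
  continuousOn_node : ContinuousOn n Ω
  continuousOn_saddle : ∀ i, ContinuousOn (s i) Ω

/-- The side of the caustic where the `i`-th saddle glues together with the node: the boundary
points of `Ω` at which both tend to one and the same fold critical point. -/
def side (f : Plane → ℝ) (Ω : Set Plane) (n : Plane → Plane) (s : Fin 3 → Plane → Plane)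
    (i : Fin 3) : Set Plane :=
  {p | p ∈ frontier Ω ∧ ∃ q, IsFold (phase f p) q ∧
    Tendsto n (𝓝[Ω] p) (𝓝 q) ∧ Tendsto (s i) (𝓝[Ω] p) (𝓝 q)}

/-- The part inside the caustic of the component of the bifurcation locus of type `(i, j)`: the
parameters for which there is a gradient line from the `i`-th to the `j`-th saddle. -/
def bifurcationSet (f : Plane → ℝ) (Ω : Set Plane) (s : Fin 3 → Plane → Plane)
    (i j : Fin 3) : Set Plane :=
  {x | x ∈ Ω ∧ Connects (phase f x) (s i x) (s j x)}

/-- The part inside the caustic of a bifurcation line of type `(j, k)` that has its extreme on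
the `j`-th side and crosses the `i`-th side: the curve `L u`, `0 < u < 1`. -/
structure IsBifurcationLine (f : Plane → ℝ) (Ω : Set Plane) (n : Plane → Plane)
    (s : Fin 3 → Plane → Plane) (L : ℝ → Plane) (j i k : Fin 3) : Prop where
  continuousOn : ContinuousOn L (Icc 0 1)
  extreme : L 0 ∈ side f Ω n s j
  crossing : L 1 ∈ side f Ω n s i
  mem_bifurcationSet : ∀ u ∈ Ioo (0 : ℝ) 1, L u ∈ bifurcationSet f Ω s j k

end GradientLines

open GradientLines

namespace GradientLines

open scoped NNReal

/-! ### Global flows of Lipschitz vector fields, with a parameter -/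

section Flow

variable {E : Type*} [NormedAddCommGroup E] [NormedSpace ℝ E]

/-! Part (1) is a separation argument (`not_four_gradientLines`). Write `s 0` for the common target
of the two saddle connections. The four lines and their limit points form a compact set `K` that
contains every critical point, and `F ≤ F (s 0)` on `K` with equality only at `s 0`. The two lines
ending at `s 0` arrive on opposite halves of its stable manifold: on the same half they would agree
up to a time shift and have the same source. A short segment through `s 0` in a direction of
positive Hessian, where `F ≥ F (s 0)`, therefore crosses `K` exactly once, while `K` without `s 0`
stays connected through the node. So `K` cuts an endpoint of the segment off from infinity. In the
bounded complementary component of that endpoint `F` has a local maximum, a critical point outside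
`K`, which is absurd. The separation itself is Eilenberg's criterion (`HasLog`): if `log (z - p)`
had continuous branches on `K` for both endpoints `p`, their difference would be a continuous
logarithm of a Möbius function whose argument jumps by `2π` at the crossing
(`not_hasLog_of_crossing`).

Part (2) reduces to (1). A common point of the two lines supplies both connections between saddles;
the connections from the node to `s 1` and `s 2` are carried along the curves from their extremes
(`connects_along`). Near the extreme the node and the saddle have just separated from a fold, and an
energy barrier around the fold forces them to be joined (`eventually_connects_of_fold`). Along the
curve the connection is an open condition (`eventually_connects`), because the repelling basin of
the node is open and stable branches move continuously. It is also closed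
(`connects_of_frequently`): the growth of the gradient bounds the lines, a limit orbit has a
critical point as backward limit, and a limit at another saddle would be a connection excluded by
hypothesis.

Stable manifolds are obtained from an indefinite quadratic form. Near a saddle the gradient is
replaced by a globally Lipschitz field that is monotone for `⟪H d, d⟫`; this form grows along the
difference of two trajectories, which yields existence, uniqueness and continuity of the stable
branches. The parameter `x` only translates the field and drops out of all differences. -/

theorem integralCurve_eqOn_Icc {Y : E → E} {K : ℝ≥0} {S : Set E} (hY : LipschitzOnWith K Y S)
    {a b t₀ : ℝ} (ht₀ : t₀ ∈ Icc a b) {γ δ : ℝ → E}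
    (hγ : ∀ t ∈ Icc a b, HasDerivAt γ (Y (γ t)) t) (hγS : ∀ t ∈ Icc a b, γ t ∈ S)
    (hδ : ∀ t ∈ Icc a b, HasDerivAt δ (Y (δ t)) t) (hδS : ∀ t ∈ Icc a b, δ t ∈ S)
    (h : γ t₀ = δ t₀) : EqOn γ δ (Icc a b) := by
  rw [← Icc_union_Icc_eq_Icc ht₀.1 ht₀.2]
  have h1 : Icc a t₀ ⊆ Icc a b := Icc_subset_Icc_right ht₀.2
  have h2 : Icc t₀ b ⊆ Icc a b := Icc_subset_Icc_left ht₀.1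
  apply EqOn.union
  · exact ODE_solution_unique_of_mem_Icc_left (v := fun _ => Y) (s := fun _ => S)
      (fun _ _ => hY) (fun t ht => (hγ t (h1 ht)).continuousAt.continuousWithinAt)
      (fun t ht => (hγ t (h1 (Ioc_subset_Icc_self ht))).hasDerivWithinAt)
      (fun t ht => hγS t (h1 (Ioc_subset_Icc_self ht)))
      (fun t ht => (hδ t (h1 ht)).continuousAt.continuousWithinAt)
      (fun t ht => (hδ t (h1 (Ioc_subset_Icc_self ht))).hasDerivWithinAt)
      (fun t ht => hδS t (h1 (Ioc_subset_Icc_self ht))) h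
  · exact ODE_solution_unique_of_mem_Icc_right (v := fun _ => Y) (s := fun _ => S)
      (fun _ _ => hY) (fun t ht => (hγ t (h2 ht)).continuousAt.continuousWithinAt)
      (fun t ht => (hγ t (h2 (Ico_subset_Icc_self ht))).hasDerivWithinAt)
      (fun t ht => hγS t (h2 (Ico_subset_Icc_self ht)))
      (fun t ht => (hδ t (h2 ht)).continuousAt.continuousWithinAt)
      (fun t ht => (hδ t (h2 (Ico_subset_Icc_self ht))).hasDerivWithinAt)
      (fun t ht => hδS t (h2 (Ico_subset_Icc_self ht))) h

theorem integralCurve_eqOn_Ioo {Y : E → E} {K : ℝ≥0} (hY : LipschitzWith K Y)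
    {a b t₀ : ℝ} (ht₀ : t₀ ∈ Ioo a b) {γ δ : ℝ → E}
    (hγ : ∀ t ∈ Ioo a b, HasDerivAt γ (Y (γ t)) t)
    (hδ : ∀ t ∈ Ioo a b, HasDerivAt δ (Y (δ t)) t)
    (h : γ t₀ = δ t₀) : EqOn γ δ (Ioo a b) := by
  intro t ht
  have hsub : Icc (min t t₀) (max t t₀) ⊆ Ioo a b := fun u hu =>
    ⟨(lt_min ht.1 ht₀.1).trans_le hu.1, hu.2.trans_lt (max_lt ht.2 ht₀.2)⟩
  exact integralCurve_eqOn_Icc (S := univ) (lipschitzOnWith_univ.2 hY)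
    ⟨min_le_right _ _, le_max_right _ _⟩ (fun u hu => hγ u (hsub hu)) (fun _ _ => mem_univ _)
    (fun u hu => hδ u (hsub hu)) (fun _ _ => mem_univ _) h ⟨min_le_left _ _, le_max_left _ _⟩

theorem HasDerivAt.congr_of_eqOn_Ioo {γ δ : ℝ → E} {Y : E → E} {a b t : ℝ} (ht : t ∈ Ioo a b)
    (h : EqOn δ γ (Ioo a b)) (hγ : HasDerivAt γ (Y (γ t)) t) : HasDerivAt δ (Y (δ t)) t := by
  rw [h ht]
  exact hγ.congr_of_eventuallyEq (h.eventuallyEq_of_mem (Ioo_mem_nhds ht.1 ht.2))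

theorem integralCurve_concat {Y : E → E} {K : ℝ≥0} (hY : LipschitzWith K Y)
    {a b c d t₀ : ℝ} (hac : a ≤ c) (hbd : b ≤ d) (ht₀ : t₀ ∈ Ioo c b) {γ δ : ℝ → E}
    (hγ : ∀ t ∈ Ioo a b, HasDerivAt γ (Y (γ t)) t)
    (hδ : ∀ t ∈ Ioo c d, HasDerivAt δ (Y (δ t)) t)
    (h : γ t₀ = δ t₀) :
    ∃ η : ℝ → E, EqOn η γ (Ioo a b) ∧ ∀ t ∈ Ioo a d, HasDerivAt η (Y (η t)) t := by
  have heq : EqOn γ δ (Ioo c b) := integralCurve_eqOn_Ioo hY ht₀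
    (fun t ht => hγ t ⟨hac.trans_lt ht.1, ht.2⟩) (fun t ht => hδ t ⟨ht.1, ht.2.trans_le hbd⟩) h
  let η : ℝ → E := fun t => if t ≤ t₀ then γ t else δ t
  have h1 : EqOn η γ (Ioo a b) := by
    intro t ht
    by_cases h : t ≤ t₀
    · simp [η, h]
    · simp only [η, h, if_false]
      exact (heq ⟨ht₀.1.trans (not_le.1 h), ht.2⟩).symm
  have h2 : EqOn η δ (Ioo c d) := by
    intro t ht
    by_cases h : t ≤ t₀
    · simp only [η, h, if_true]
      exact heq ⟨ht.1, h.trans_lt ht₀.2⟩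
    · simp [η, h]
  refine ⟨η, h1, fun t ht => ?_⟩
  by_cases h : t < b
  · exact HasDerivAt.congr_of_eqOn_Ioo ⟨ht.1, h⟩ h1 (hγ t ⟨ht.1, h⟩)
  · have : t ∈ Ioo c d := ⟨(ht₀.1.trans ht₀.2).trans_le (not_lt.1 h), ht.2⟩
    exact HasDerivAt.congr_of_eqOn_Ioo this h2 (hδ t this)

/-- On the ball of radius `‖Y y‖` about `y` the field is bounded by `(K + 1) ‖Y y‖`, so
Picard–Lindelöf gives the time `1 / (K + 1)`, the same for every starting point. -/
theorem exists_integralCurve_Ioo [CompleteSpace E] {Y : E → E} {K : ℝ≥0} (hY : LipschitzWith K Y) :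
    ∃ τ > 0, ∀ y, ∃ γ : ℝ → E, γ 0 = y ∧ ∀ t ∈ Ioo (-τ) τ, HasDerivAt γ (Y (γ t)) t := by
  refine ⟨1 / (K + 1), by positivity, fun y => ?_⟩
  have hK : (0 : ℝ) < K + 1 := by positivity
  have hτ : (0 : ℝ) ≤ 1 / (K + 1) := by positivity
  have hpl : IsPicardLindelof (fun _ : ℝ => Y) (tmin := -(1 / (K + 1) : ℝ)) (tmax := 1 / (K + 1))
      ⟨0, by simp only [mem_Icc]; constructor <;> linarith⟩ y ‖Y y‖₊ 0
      (‖Y y‖₊ * (K + 1)) K := by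
    refine ⟨fun _ _ => hY.lipschitzOnWith, fun _ _ => continuousOn_const, ?_, ?_⟩
    · intro _ _ x hx
      have h1 : ‖Y x - Y y‖ ≤ K * ‖x - y‖ := by
        simpa [dist_eq_norm] using hY.dist_le_mul x y
      have h2 : ‖x - y‖ ≤ ‖Y y‖ := by simpa [dist_eq_norm] using hx
      have h3 : ‖Y x‖ ≤ ‖Y x - Y y‖ + ‖Y y‖ := by simpa using norm_add_le (Y x - Y y) (Y y)
      have h4 : (K : ℝ) * ‖x - y‖ ≤ K * ‖Y y‖ := mul_le_mul_of_nonneg_left h2 K.2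
      simp only [NNReal.coe_mul, NNReal.coe_add, NNReal.coe_one, coe_nnnorm]
      nlinarith
    · simp only [sub_zero, zero_sub, neg_neg, max_self]
      simp only [NNReal.coe_mul, NNReal.coe_add, NNReal.coe_one, NNReal.coe_zero, coe_nnnorm]
      rw [mul_assoc, mul_one_div_cancel hK.ne']
      simp
  obtain ⟨γ, h0, hγ⟩ := hpl.exists_eq_forall_mem_Icc_hasDerivWithinAt₀
  exact ⟨γ, h0, fun t ht => (hγ t (Ioo_subset_Icc_self ht)).hasDerivAt (Icc_mem_nhds ht.1 ht.2)⟩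

/-- Since `τ` serves all starting points, the curve can be restarted at the times `τ / 2` and `-(τ /
2)`; uniqueness on the overlaps glues the three pieces. -/
theorem exists_integralCurve_Ioo_enlarge {Y : E → E} {K : ℝ≥0} (hY : LipschitzWith K Y) {τ : ℝ}
    (hτ : 0 < τ)
    (h : ∀ y, ∃ γ : ℝ → E, γ 0 = y ∧ ∀ t ∈ Ioo (-τ) τ, HasDerivAt γ (Y (γ t)) t) (y : E) :
    ∃ γ : ℝ → E, γ 0 = y ∧
      ∀ t ∈ Ioo (-(3 / 2 * τ)) (3 / 2 * τ), HasDerivAt γ (Y (γ t)) t := by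
  obtain ⟨γ, h0, hγ⟩ := h y
  obtain ⟨γr, hr0, hγr⟩ := h (γ (τ / 2))
  obtain ⟨γl, hl0, hγl⟩ := h (γ (-(τ / 2)))
  have shift : ∀ (δ : ℝ → E) (c : ℝ), (∀ t ∈ Ioo (-τ) τ, HasDerivAt δ (Y (δ t)) t) →
      ∀ t ∈ Ioo (c - τ) (c + τ), HasDerivAt (fun t => δ (t - c)) (Y (δ (t - c))) t := by
    intro δ c hδ t ht
    have := (hδ (t - c) ⟨by linarith [ht.1], by linarith [ht.2]⟩).comp_sub_const t c
    simpa using this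
  obtain ⟨η, hη1, hη2⟩ := integralCurve_concat hY (a := -τ) (b := τ) (c := τ / 2 - τ)
    (d := τ / 2 + τ) (t₀ := τ / 2) (by linarith) (by linarith)
    ⟨by linarith, by linarith⟩ hγ (shift γr (τ / 2) hγr) (by simp [hr0])
  obtain ⟨ζ, hζ1, hζ2⟩ := integralCurve_concat hY (a := -(τ / 2) - τ) (b := -(τ / 2) + τ) (c := -τ)
    (d := τ / 2 + τ) (t₀ := -(τ / 2)) (by linarith) (by linarith)
    ⟨by linarith, by linarith⟩ (shift γl (-(τ / 2)) hγl) hη2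
    (by simp only [sub_self, hl0]; exact (hη1 ⟨by linarith, by linarith⟩).symm)
  refine ⟨ζ, ?_, fun t ht => hζ2 t ⟨by linarith [ht.1], by linarith [ht.2]⟩⟩
  have heq : EqOn ζ η (Ioo (-τ) (τ / 2 + τ)) := by
    refine integralCurve_eqOn_Ioo hY (t₀ := -(τ / 2)) ⟨by linarith, by linarith⟩
      (fun t ht => hζ2 t ⟨by linarith [ht.1], ht.2⟩) hη2 ?_
    rw [hζ1 ⟨by linarith, by linarith⟩, hη1 ⟨by linarith, by linarith⟩]
    simp [hl0]
  rw [heq ⟨by linarith, by linarith⟩, hη1 ⟨by linarith, by linarith⟩, h0]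

theorem exists_integralCurve [CompleteSpace E] {Y : E → E} {K : ℝ≥0} (hY : LipschitzWith K Y)
    (y : E) : ∃ γ : ℝ → E, γ 0 = y ∧ ∀ t, HasDerivAt γ (Y (γ t)) t := by
  obtain ⟨τ, hτ, h⟩ := exists_integralCurve_Ioo hY
  have key : ∀ n : ℕ, ∀ y, ∃ γ : ℝ → E, γ 0 = y ∧
      ∀ t ∈ Ioo (-((3 / 2) ^ n * τ)) ((3 / 2) ^ n * τ), HasDerivAt γ (Y (γ t)) t := by
    intro n
    induction n with
    | zero => simpa using h
    | succ n ih =>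
      intro y
      have := exists_integralCurve_Ioo_enlarge hY (by positivity) ih y
      rwa [← mul_assoc, ← pow_succ'] at this
  have hbig : ∀ T : ℝ, ∃ n : ℕ, T < (3 / 2) ^ n * τ := by
    intro T
    obtain ⟨n, hn⟩ := pow_unbounded_of_one_lt (T / τ) (by norm_num : (1 : ℝ) < 3 / 2)
    exact ⟨n, (div_lt_iff₀ hτ).1 hn⟩
  choose γ h0 hγ using fun n => key n y
  choose N hN using hbig
  have agree : ∀ (m n : ℕ) (t : ℝ), |t| < (3 / 2) ^ m * τ → |t| < (3 / 2) ^ n * τ →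
      γ m t = γ n t := by
    intro m n t hm hn
    set b := min ((3 / 2) ^ m * τ) ((3 / 2) ^ n * τ)
    have hb : |t| < b := lt_min hm hn
    have hb0 : 0 < b := (abs_nonneg t).trans_lt hb
    refine integralCurve_eqOn_Ioo hY (a := -b) (b := b) (t₀ := 0) ⟨by linarith, hb0⟩ ?_ ?_
      (by rw [h0, h0]) (abs_lt.1 hb)
    · exact fun u hu => hγ m u ⟨by linarith [hu.1, min_le_left ((3 / 2) ^ m * τ) ((3 / 2) ^ n * τ)],
        hu.2.trans_le (min_le_left _ _)⟩
    · exact fun u hu => hγ n u ⟨by linarith [hu.1, min_le_right ((3 / 2) ^ m * τ) ((3 / 2) ^ n * τ)],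
        hu.2.trans_le (min_le_right _ _)⟩
  -- The value at `t` is read off a curve whose interval is long enough for `|t|`; by `agree` the
  -- choice does not matter, so near `t` a single curve is seen.
  refine ⟨fun t => γ (N |t|) t, by simp [h0], fun t => ?_⟩
  set b := (3 / 2) ^ (N |t|) * τ
  refine HasDerivAt.congr_of_eqOn_Ioo (a := -b) (b := b) (γ := γ (N |t|)) (abs_lt.1 (hN |t|))
    (fun u hu => agree _ _ u (hN _) (abs_lt.2 hu)) (hγ _ t (abs_lt.1 (hN |t|)))

theorem dist_integralCurve_le {Y : E → E} {K : ℝ≥0} (hY : LipschitzWith K Y) {γ δ : ℝ → E}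
    (hγ : ∀ t, HasDerivAt γ (Y (γ t)) t) (hδ : ∀ t, HasDerivAt δ (Y (δ t)) t) (t : ℝ) :
    dist (γ t) (δ t) ≤ dist (γ 0) (δ 0) * Real.exp (K * |t|) := by
  have fwd : ∀ {Z : E → E} (_ : LipschitzWith K Z) {γ δ : ℝ → E}
      (_ : ∀ t, HasDerivAt γ (Z (γ t)) t) (_ : ∀ t, HasDerivAt δ (Z (δ t)) t), ∀ t, 0 ≤ t →
      dist (γ t) (δ t) ≤ dist (γ 0) (δ 0) * Real.exp (K * t) := by
    intro Z hZ γ δ hγ hδ t ht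
    have := dist_le_of_trajectories_ODE (v := fun _ => Z) (a := 0) (b := t) (fun _ => hZ)
      (fun s _ => (hγ s).continuousAt.continuousWithinAt) (fun s _ => (hγ s).hasDerivWithinAt)
      (fun s _ => (hδ s).continuousAt.continuousWithinAt) (fun s _ => (hδ s).hasDerivWithinAt)
      le_rfl t ⟨ht, le_rfl⟩
    simpa using this
  rcases le_total 0 t with ht | ht
  · rw [abs_of_nonneg ht]
    exact fwd hY hγ hδ t ht
  · rw [abs_of_nonpos ht]
    -- Negative times are handled by time reversal, which turns `Y` into `-Y` with the same
    -- Lipschitz constant.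
    have rev : ∀ {γ : ℝ → E}, (∀ t, HasDerivAt γ (Y (γ t)) t) →
        ∀ t, HasDerivAt (fun t => γ (-t)) ((fun y => -Y y) (γ (-t))) t := by
      intro γ hγ t
      simpa [Function.comp_def] using (hγ (-t)).scomp t (hasDerivAt_neg t)
    have hZ : LipschitzWith K (fun y => -Y y) := by
      exact LipschitzWith.neg hY
    simpa using fwd hZ (rev hγ) (rev hδ) (-t) (by linarith)

/-- The flow of the family of vector fields `Y - x`. -/
theorem exists_parametric_flow [CompleteSpace E] {Y : E → E} {K : ℝ≥0} (hY : LipschitzWith K Y) :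
    ∃ Ψ : E → ℝ → E → E, (∀ x y, Ψ x 0 y = y) ∧
      (∀ x y t, HasDerivAt (fun t => Ψ x t y) (Y (Ψ x t y) - x) t) ∧
      ∃ C : ℝ, 0 ≤ C ∧ ∀ x x' y y' t,
        dist (Ψ x t y) (Ψ x' t y') ≤ max (dist x x') (dist y y') * Real.exp (C * |t|) := by
  -- The parameter becomes a frozen coordinate, so dependence on parameter and on initial point are
  -- both dependence on initial data for one Lipschitz field.
  let V : E × E → E × E := fun p => (0, Y p.2 - p.1)
  have hV : LipschitzWith (max 0 (K * 1 + 1)) V :=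
    (LipschitzWith.const (0 : E)).prodMk
      ((hY.comp LipschitzWith.prod_snd).sub LipschitzWith.prod_fst)
  choose Γ h0 hΓ using fun p => exists_integralCurve hV p
  have hfst : ∀ p t, (Γ p t).1 = p.1 := by
    intro p t
    have hd : ∀ t, HasDerivAt (fun t => (Γ p t).1) 0 t := fun t =>
      (hasFDerivAt_fst (𝕜 := ℝ) (p := Γ p t)).comp_hasDerivAt t (hΓ p t)
    have := is_const_of_deriv_eq_zero (fun t => (hd t).differentiableAt) (fun t => (hd t).deriv) t 0
    simpa [h0] using this
  refine ⟨fun x t y => (Γ (x, y) t).2, fun x y => by simp [h0], fun x y t => ?_,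
    ((max 0 (K * 1 + 1) : ℝ≥0) : ℝ), NNReal.coe_nonneg _, fun x x' y y' t => ?_⟩
  · have := (hasFDerivAt_snd (𝕜 := ℝ) (p := Γ (x, y) t)).comp_hasDerivAt t (hΓ (x, y) t)
    simpa [V, hfst, Function.comp_def] using this
  · refine le_trans (le_max_right _ _) ((dist_integralCurve_le hV (hΓ (x, y)) (hΓ (x', y')) t).trans ?_)
    rw [h0, h0, Prod.dist_eq]

end Flow

/-! ### Gradient curves: uniqueness, monotonicity of the function, gluing -/

section Gradient

variable {f F : Plane → ℝ}

theorem inner_gradient_left (f : Plane → ℝ) (y v : Plane) :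
    inner ℝ (gradient f y) v = fderiv ℝ f y v := by
  simp [gradient]

theorem phase_eq (f : Plane → ℝ) (x : Plane) : phase f x = fun y => f y - innerSL ℝ x y := rfl

theorem contDiff_phase (hf : ContDiff ℝ ∞ f) (x : Plane) : ContDiff ℝ ∞ (phase f x) := by
  rw [phase_eq]
  exact hf.sub (innerSL ℝ x).contDiff

theorem fderiv_phase (hf : ContDiff ℝ ∞ f) (x y : Plane) :
    fderiv ℝ (phase f x) y = fderiv ℝ f y - innerSL ℝ x := by
  rw [phase_eq]
  exact ((hf.differentiable (by simp)) y).hasFDerivAt.sub (innerSL ℝ x).hasFDerivAt |>.fderiv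

theorem gradient_phase (hf : ContDiff ℝ ∞ f) (x y : Plane) :
    gradient (phase f x) y = gradient f y - x := by
  refine ext_inner_right ℝ fun v => ?_
  rw [inner_sub_left, inner_gradient_left, inner_gradient_left, fderiv_phase hf]
  simp

theorem hessian_phase (hf : ContDiff ℝ ∞ f) (x y : Plane) :
    hessian (phase f x) y = hessian f y := by
  unfold hessian
  have : fderiv ℝ (phase f x) = fun y => fderiv ℝ f y - innerSL ℝ x :=
    funext fun y => fderiv_phase hf x y
  rw [this, fderiv_sub_const]

theorem contDiff_fderiv_infty (hf : ContDiff ℝ ∞ f) : ContDiff ℝ ∞ (fderiv ℝ f) :=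
  hf.fderiv_right (by simp)

theorem contDiff_gradient (hf : ContDiff ℝ ∞ f) : ContDiff ℝ ∞ (gradient f) :=
  (InnerProductSpace.toDual ℝ Plane).symm.toContinuousLinearEquiv.contDiff.comp
    (contDiff_fderiv_infty hf)

theorem continuous_gradient (hf : ContDiff ℝ ∞ f) : Continuous (gradient f) :=
  (contDiff_gradient hf).continuous

theorem continuous_hessian (hf : ContDiff ℝ ∞ f) : Continuous (hessian f) :=
  ((contDiff_fderiv_infty hf).continuous_fderiv (by simp))

theorem inner_fderiv_gradient (hf : ContDiff ℝ ∞ f) (y v w : Plane) :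
    inner ℝ (fderiv ℝ (gradient f) y v) w = hessian f y v w := by
  have h1 : HasFDerivAt (gradient f) (fderiv ℝ (gradient f) y) y :=
    ((contDiff_gradient hf).differentiable (by simp) y).hasFDerivAt
  have h2 : HasFDerivAt (fderiv ℝ f) (hessian f y) y :=
    ((contDiff_fderiv_infty hf).differentiable (by simp) y).hasFDerivAt
  have h3 : HasFDerivAt (fun y => inner ℝ (gradient f y) w)
      ((innerSL ℝ w).comp (fderiv ℝ (gradient f) y)) y := by
    have := (innerSL ℝ w).hasFDerivAt.comp y h1
    simpa [Function.comp_def, real_inner_comm] using this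
  have h4 : HasFDerivAt (fun y => inner ℝ (gradient f y) w)
      ((ContinuousLinearMap.apply ℝ ℝ w).comp (hessian f y)) y := by
    have := (ContinuousLinearMap.apply ℝ ℝ w).hasFDerivAt.comp y h2
    simpa [Function.comp_def, inner_gradient_left] using this
  have := DFunLike.congr_fun (h3.unique h4) v
  simpa [real_inner_comm] using this

theorem hessian_symm (hf : ContDiff ℝ ∞ f) (y v w : Plane) :
    hessian f y v w = hessian f y w v :=
  (hf.contDiffAt (x := y)).isSymmSndFDerivAt
    (by rw [minSmoothness_of_isRCLikeNormedField]; exact WithTop.coe_le_coe.2 le_top) v w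

theorem exists_lipschitzOnWith_gradient (hf : ContDiff ℝ ∞ f) (c : Plane) (r : ℝ) :
    ∃ K : ℝ≥0, LipschitzOnWith K (gradient f) (Metric.closedBall c r) :=
  ((contDiff_gradient hf).of_le (by simp)).contDiffOn.exists_lipschitzOnWith (n := 1)
    one_ne_zero (convex_closedBall c r) (isCompact_closedBall c r)

/-- The gradient field need not be complete. The extension has a global flow, whose trajectories are
gradient curves as long as they stay in the ball. -/
theorem exists_lipschitz_extension_gradient (hf : ContDiff ℝ ∞ f) (c : Plane) (r : ℝ) :
    ∃ (Y : Plane → Plane) (K : ℝ≥0), LipschitzWith K Y ∧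
      EqOn (gradient f) Y (Metric.closedBall c r) := by
  obtain ⟨K, hK⟩ := exists_lipschitzOnWith_gradient hf c r
  obtain ⟨Y, hY, h⟩ := hK.extend_finite_dimension
  exact ⟨Y, _, hY, h⟩

theorem gradientCurve_eqOn (hF : ContDiff ℝ ∞ F) {a b t₀ : ℝ} (ht₀ : t₀ ∈ Icc a b)
    {γ δ : ℝ → Plane} (hγ : ∀ t ∈ Icc a b, HasDerivAt γ (gradient F (γ t)) t)
    (hδ : ∀ t ∈ Icc a b, HasDerivAt δ (gradient F (δ t)) t) (h : γ t₀ = δ t₀) :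
    EqOn γ δ (Icc a b) := by
  have cpt : ∀ {η : ℝ → Plane}, (∀ t ∈ Icc a b, HasDerivAt η (gradient F (η t)) t) →
      IsCompact (η '' Icc a b) := fun hη =>
    isCompact_Icc.image_of_continuousOn fun t ht => (hη t ht).continuousAt.continuousWithinAt
  obtain ⟨r, hr⟩ := ((cpt hγ).union (cpt hδ)).isBounded.subset_closedBall 0
  obtain ⟨K, hK⟩ := exists_lipschitzOnWith_gradient hF 0 r
  exact integralCurve_eqOn_Icc hK ht₀ hγ (fun t ht => hr (Or.inl (mem_image_of_mem _ ht)))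
    hδ (fun t ht => hr (Or.inr (mem_image_of_mem _ ht))) h

theorem gradientCurve_eq (hF : ContDiff ℝ ∞ F) {t₀ : ℝ}
    {γ δ : ℝ → Plane} (hγ : ∀ t, HasDerivAt γ (gradient F (γ t)) t)
    (hδ : ∀ t, HasDerivAt δ (gradient F (δ t)) t) (h : γ t₀ = δ t₀) : γ = δ :=
  funext fun t => gradientCurve_eqOn hF (a := min t t₀) (b := max t t₀)
    ⟨min_le_right _ _, le_max_right _ _⟩ (fun t _ => hγ t) (fun t _ => hδ t) h
    ⟨min_le_left _ _, le_max_left _ _⟩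

theorem hasDerivAt_along (hF : ContDiff ℝ ∞ F) {γ : ℝ → Plane} {t : ℝ}
    (hγ : HasDerivAt γ (gradient F (γ t)) t) :
    HasDerivAt (fun t => F (γ t)) (‖gradient F (γ t)‖ ^ 2) t := by
  have := (hF.differentiable (by simp) (γ t)).hasFDerivAt.comp_hasDerivAt t hγ
  rwa [← inner_gradient_left, real_inner_self_eq_norm_sq] at this

theorem monotoneOn_along (hF : ContDiff ℝ ∞ F) {γ : ℝ → Plane} {s : Set ℝ} (hs : Convex ℝ s)
    (hγ : ∀ t ∈ s, HasDerivAt γ (gradient F (γ t)) t) : MonotoneOn (fun t => F (γ t)) s := by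
  refine monotoneOn_of_deriv_nonneg hs
    (fun t ht => (hasDerivAt_along hF (hγ t ht)).continuousAt.continuousWithinAt)
    (fun t ht => (hasDerivAt_along hF
      (hγ t (interior_subset ht))).differentiableAt.differentiableWithinAt) fun t ht => ?_
  rw [(hasDerivAt_along hF (hγ t (interior_subset ht))).deriv]
  positivity

theorem gradient_ne_zero_along (hF : ContDiff ℝ ∞ F) {γ : ℝ → Plane}
    (hγ : ∀ t, HasDerivAt γ (gradient F (γ t)) t) {t₀ : ℝ} (h : gradient F (γ t₀) ≠ 0) (t : ℝ) :
    gradient F (γ t) ≠ 0 := by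
  intro h0
  have : γ = fun _ => γ t := gradientCurve_eq hF (t₀ := t) hγ
    (fun s => by rw [h0]; exact hasDerivAt_const s _) rfl
  rw [this] at h
  exact h h0

theorem IsGradientLine.strict (hF : ContDiff ℝ ∞ F) {γ : ℝ → Plane} {p q : Plane}
    (hγ : IsGradientLine F γ p q) {t₀ : ℝ} (h : gradient F (γ t₀) ≠ 0) (t : ℝ) :
    F p < F (γ t) ∧ F (γ t) < F q := by
  obtain ⟨hd, hp, hq⟩ := hγ
  have hmono : StrictMono (fun t => F (γ t)) := by
    refine strictMono_of_deriv_pos fun t => ?_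
    rw [(hasDerivAt_along hF (hd t)).deriv]
    have := gradient_ne_zero_along hF hd h t
    positivity
  have hcont := hF.continuous
  have h1 : Tendsto (fun t => F (γ t)) atBot (𝓝 (F p)) := (hcont.tendsto p).comp hp
  have h2 : Tendsto (fun t => F (γ t)) atTop (𝓝 (F q)) := (hcont.tendsto q).comp hq
  constructor
  · have h3 : F p ≤ F (γ (t - 1)) := le_of_tendsto h1
      ((eventually_le_atBot (t - 1)).mono fun s hs => hmono.monotone hs)
    exact h3.trans_lt (hmono (by linarith))
  · have h3 : F (γ (t + 1)) ≤ F q := ge_of_tendsto h2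
      ((eventually_ge_atTop (t + 1)).mono fun s hs => hmono.monotone hs)
    exact (hmono (by linarith : t < t + 1)).trans_le h3

theorem IsGradientLine.gradient_ne_zero (hF : ContDiff ℝ ∞ F) {γ : ℝ → Plane} {p q : Plane}
    (hγ : IsGradientLine F γ p q) (hpq : p ≠ q) (t : ℝ) : gradient F (γ t) ≠ 0 := by
  intro h0
  have : γ = fun _ => γ t := gradientCurve_eq hF (t₀ := t) hγ.1
    (fun s => by rw [h0]; exact hasDerivAt_const s _) rfl
  have h1 := hγ.2.1
  have h2 := hγ.2.2
  rw [this] at h1 h2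
  exact hpq ((tendsto_nhds_unique h1 tendsto_const_nhds).trans
    (tendsto_nhds_unique tendsto_const_nhds h2))

/-- After a shift of time both lines are the same curve by uniqueness, and a curve has one limit at
`-∞`. -/
theorem IsGradientLine.eq_of_meet (hF : ContDiff ℝ ∞ F) {γ δ : ℝ → Plane} {p q p' q' : Plane}
    (hγ : IsGradientLine F γ p q) (hδ : IsGradientLine F δ p' q') {a b : ℝ} (h : γ a = δ b) :
    p = p' := by
  have hsh : (fun t => γ (t + a)) = fun t => δ (t + b) :=
    gradientCurve_eq hF (t₀ := 0) (fun t => (hγ.1 (t + a)).comp_add_const t a)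
      (fun t => (hδ.1 (t + b)).comp_add_const t b) (by simpa using h)
  have h1 := hγ.2.1.comp (tendsto_atBot_add_const_right atBot a tendsto_id)
  have h2 := hδ.2.1.comp (tendsto_atBot_add_const_right atBot b tendsto_id)
  refine tendsto_nhds_unique h1 ?_
  have : (γ ∘ fun t => id t + a) = δ ∘ fun t => id t + b := hsh
  rw [this]
  exact h2

/-- The gradient curve of `F` through `z` exists for all positive times and tends to `q`. -/
def TendsForward (F : Plane → ℝ) (z q : Plane) : Prop :=
  ∃ γ : ℝ → Plane, γ 0 = z ∧ (∀ t, 0 ≤ t → HasDerivAt γ (gradient F (γ t)) t) ∧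
    Tendsto γ atTop (𝓝 q)

/-- The gradient curve of `F` through `z` exists for all negative times and tends to `p`. -/
def TendsBackward (F : Plane → ℝ) (z p : Plane) : Prop :=
  ∃ γ : ℝ → Plane, γ 0 = z ∧ (∀ t ≤ 0, HasDerivAt γ (gradient F (γ t)) t) ∧
    Tendsto γ atBot (𝓝 p)

/-- At the junction the one-sided derivatives agree because both equal `Y` at the common point. -/
theorem hasDerivAt_glue {E : Type*} [NormedAddCommGroup E] [NormedSpace ℝ E] {Y : E → E}
    {γ δ : ℝ → E} (h0 : γ 0 = δ 0) {a b : ℝ}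
    (ha : a < 0) (hb : 0 < b)
    (hγ : ∀ t, a < t → t ≤ 0 → HasDerivAt γ (Y (γ t)) t)
    (hδ : ∀ t, 0 ≤ t → t < b → HasDerivAt δ (Y (δ t)) t) (t : ℝ) (hat : a < t) (htb : t < b) :
    HasDerivAt (fun t => if t ≤ 0 then γ t else δ t) (Y (if t ≤ 0 then γ t else δ t)) t := by
  rcases lt_trichotomy t 0 with h | rfl | h
  · rw [if_pos h.le]
    refine (hγ t hat h.le).congr_of_eventuallyEq ?_
    filter_upwards [Iio_mem_nhds h] with s hs
    rw [if_pos (le_of_lt hs)]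
  · rw [if_pos le_rfl]
    rw [← hasDerivWithinAt_univ, ← Iic_union_Ici (a := (0 : ℝ))]
    refine HasDerivWithinAt.union ?_ ?_
    · exact (hγ 0 ha le_rfl).hasDerivWithinAt.congr (fun s hs => if_pos hs) (if_pos le_rfl)
    · rw [h0]
      refine (hδ 0 le_rfl hb).hasDerivWithinAt.congr (fun s hs => ?_) (by simpa using h0)
      rcases eq_or_lt_of_le (mem_Ici.1 hs) with rfl | hs'
      · simpa using h0
      · exact if_neg (not_le.2 hs')
  · rw [if_neg (not_le.2 h)]
    refine (hδ t h.le htb).congr_of_eventuallyEq ?_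
    filter_upwards [Ioi_mem_nhds h] with s hs
    rw [if_neg (not_le.2 hs)]

theorem TendsBackward.exists_gradientLine {z p q : Plane} (hp : TendsBackward F z p)
    (hq : TendsForward F z q) : ∃ γ : ℝ → Plane, IsGradientLine F γ p q ∧ γ 0 = z := by
  obtain ⟨γ, hγ0, hγ, hγp⟩ := hp
  obtain ⟨δ, hδ0, hδ, hδq⟩ := hq
  refine ⟨fun t => if t ≤ 0 then γ t else δ t, ⟨fun t => ?_, ?_, ?_⟩, by simp [hγ0]⟩
  · exact hasDerivAt_glue (hγ0.trans hδ0.symm) (a := min (t - 1) (-1)) (b := max (t + 1) 1)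
      (by simp) (by simp) (fun t _ ht => hγ t ht) (fun t ht _ => hδ t ht) t (by simp) (by simp)
  · refine hγp.congr' ?_
    filter_upwards [eventually_le_atBot 0] with t ht
    rw [if_pos ht]
  · refine hδq.congr' ?_
    filter_upwards [eventually_gt_atTop 0] with t ht
    rw [if_neg (not_le.2 ht)]

theorem IsGradientLine.tendsBackward {γ : ℝ → Plane} {p q : Plane} (h : IsGradientLine F γ p q)
    (t : ℝ) : TendsBackward F (γ t) p :=
  ⟨fun s => γ (s + t), by simp, fun s _ => (h.1 (s + t)).comp_add_const s t,
    h.2.1.comp (tendsto_atBot_add_const_right atBot t tendsto_id)⟩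

/-- Backward convergence propagates forward along gradient curves. -/
theorem TendsBackward.along {p : Plane} {δ : ℝ → Plane} {T : ℝ} (hT : T ≤ 0)
    (hδ : ∀ t ∈ Icc T 0, HasDerivAt δ (gradient F (δ t)) t) (hp : TendsBackward F (δ T) p) :
    TendsBackward F (δ 0) p := by
  obtain ⟨γ, hγ0, hγ, hγp⟩ := hp
  rcases hT.eq_or_lt with rfl | hT
  · exact ⟨γ, hγ0, hγ, hγp⟩
  -- The backward orbit of `δ T` is followed by the arc of `δ` from `T` to `0`; shifting time by
  -- `-T` puts the end of the arc at time `0`.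
  let η : ℝ → Plane := fun t => if t ≤ 0 then γ t else δ (t + T)
  refine ⟨fun t => η (t + -T), ?_, fun t ht => ?_, ?_⟩
  · have : ¬ (-T ≤ 0) := by linarith
    simp [η, this]
  · rcases ht.lt_or_eq with ht | rfl
    · have := hasDerivAt_glue (Y := gradient F) (γ := γ) (δ := fun t => δ (t + T))
        (by simpa using hγ0) (a := min (t + -T - 1) (-1)) (b := -T) (by simp) (by linarith)
        (fun s _ hs => hγ s hs) (fun s hs hsb =>
          (hδ (s + T) ⟨by linarith, by linarith⟩).comp_add_const s T) (t + -T)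
        ((min_le_left _ _).trans_lt (by linarith)) (by linarith)
      exact this.comp_add_const t (-T)
    · have h1 : ¬ (-T ≤ 0) := by linarith
      have h2 : η (0 + -T) = δ 0 := by simp [η, h1]
      change HasDerivAt _ (gradient F (η (0 + -T))) 0
      rw [h2]
      refine (hδ 0 ⟨hT.le, le_rfl⟩).congr_of_eventuallyEq ?_
      filter_upwards [Ioi_mem_nhds hT] with s hs
      have h3 : ¬ (s + -T ≤ 0) := by
        have := mem_Ioi.1 hs
        linarith
      simp [η, h3]
  · have : Tendsto η atBot (𝓝 p) := by
      refine hγp.congr' ?_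
      filter_upwards [eventually_le_atBot 0] with t ht
      simp [η, ht]
    exact this.comp (tendsto_atBot_add_const_right atBot (-T) tendsto_id)

end Gradient

/-! ### Fields monotone for an indefinite form, and their stable sets -/

section SaddleField

/-- An orthonormal frame for an indefinite symmetric operator `H`: the form `⟪H d, d⟫` is
`α ^ 2 - β ^ 2` in the coordinates `d = α e + β w`. -/
structure IsFrame (H : Plane →L[ℝ] Plane) (e w : Plane) : Prop where
  symm : ∀ v v', inner ℝ (H v) v' = inner ℝ (H v') v
  pos : inner ℝ (H e) e = 1
  neg : inner ℝ (H w) w = -1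
  orth : inner ℝ (H e) w = 0
  decomp : ∀ d, d = inner ℝ (H e) d • e - inner ℝ (H w) d • w

theorem IsFrame.form_eq {H : Plane →L[ℝ] Plane} {e w : Plane} (h : IsFrame H e w) (d : Plane) :
    inner ℝ (H d) d = inner ℝ (H e) d ^ 2 - inner ℝ (H w) d ^ 2 := by
  have h1 : inner ℝ (H d) d =
      inner ℝ (H d) (inner ℝ (H e) d • e - inner ℝ (H w) d • w) := by rw [← h.decomp d]
  rw [h1, inner_sub_right, inner_smul_right, inner_smul_right, h.symm d e, h.symm d w]
  ring

theorem IsFrame.neg_right {H : Plane →L[ℝ] Plane} {e w : Plane} (h : IsFrame H e w) :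
    IsFrame H e (-w) where
  symm := h.symm
  pos := h.pos
  neg := by simp [h.neg]
  orth := by simp [h.orth]
  decomp d := by simpa using h.decomp d

theorem IsFrame.norm_le {H : Plane →L[ℝ] Plane} {e w : Plane} (h : IsFrame H e w) :
    ∃ M : ℝ, 0 < M ∧ ∀ d, ‖d‖ ≤ M * ‖H d‖ := by
  refine ⟨‖e‖ * ‖e‖ + ‖w‖ * ‖w‖ + 1, by positivity, fun d => ?_⟩
  have h1 : ‖inner ℝ (H e) d • e‖ ≤ ‖H d‖ * ‖e‖ * ‖e‖ := by
    rw [norm_smul, h.symm]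
    exact mul_le_mul_of_nonneg_right (norm_inner_le_norm _ _) (norm_nonneg _)
  have h2 : ‖inner ℝ (H w) d • w‖ ≤ ‖H d‖ * ‖w‖ * ‖w‖ := by
    rw [norm_smul, h.symm]
    exact mul_le_mul_of_nonneg_right (norm_inner_le_norm _ _) (norm_nonneg _)
  calc ‖d‖ = ‖inner ℝ (H e) d • e - inner ℝ (H w) d • w‖ := by rw [← h.decomp d]
    _ ≤ ‖inner ℝ (H e) d • e‖ + ‖inner ℝ (H w) d • w‖ := norm_sub_le _ _
    _ ≤ (‖e‖ * ‖e‖ + ‖w‖ * ‖w‖ + 1) * ‖H d‖ := by nlinarith [norm_nonneg (H d)]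

/-- Gram–Schmidt for the indefinite form, started at `v`. That the first vector is a positive
multiple of the given `v` matters near a fold, where the direction `e` is prescribed. -/
theorem exists_isFrame {H : Plane →L[ℝ] Plane} (hs : ∀ v v', inner ℝ (H v) v' = inner ℝ (H v') v)
    {v w₀ : Plane} (hv : 0 < inner ℝ (H v) v) (hw : inner ℝ (H w₀) w₀ < 0) :
    ∃ a : ℝ, 0 < a ∧ ∃ w, IsFrame H (a • v) w := by
  set p := inner ℝ (H v) v with hp
  set w₁ := w₀ - (inner ℝ (H v) w₀ / p) • v with hw₁
  have h1 : inner ℝ (H v) w₁ = 0 := by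
    rw [hw₁, inner_sub_right, inner_smul_right, ← hp]
    field_simp
    ring
  have h2 : inner ℝ (H w₁) w₁ < 0 := by
    have : inner ℝ (H w₁) w₁ = inner ℝ (H w₀) w₀ - (inner ℝ (H v) w₀) ^ 2 / p := by
      have h3 : inner ℝ (H w₁) w₁ = inner ℝ (H w₁) w₀ := by
        conv_lhs => rw [hw₁, inner_sub_right, inner_smul_right, hs _ v, ← hw₁, h1]
        ring
      rw [h3, hs, hw₁, inner_sub_right, inner_smul_right, hs w₀ v]
      field_simp
    rw [this]
    have : 0 ≤ (inner ℝ (H v) w₀) ^ 2 / p := by positivity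
    linarith
  set m := -inner ℝ (H w₁) w₁ with hm
  have hm0 : 0 < m := by linarith
  set a := (Real.sqrt p)⁻¹
  set b := (Real.sqrt m)⁻¹
  have ha : 0 < a := by positivity
  have hb : 0 < b := by positivity
  have ha2 : a * a * p = 1 := by
    have := Real.mul_self_sqrt hv.le
    have h0 : Real.sqrt p ≠ 0 := by positivity
    simp only [a]
    rw [← mul_inv, this, inv_mul_cancel₀ hv.ne']
  have hb2 : b * b * m = 1 := by
    have := Real.mul_self_sqrt hm0.le
    simp only [b]
    rw [← mul_inv, this, inv_mul_cancel₀ hm0.ne']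
  have pos : inner ℝ (H (a • v)) (a • v) = 1 := by
    rw [map_smul, inner_smul_left, inner_smul_right, ← hp]
    simpa [mul_assoc] using ha2
  have neg : inner ℝ (H (b • w₁)) (b • w₁) = -1 := by
    have : inner ℝ (H w₁) w₁ = -m := by rw [hm, neg_neg]
    rw [map_smul, inner_smul_left, inner_smul_right, this]
    simp only [conj_trivial]
    linarith
  have orth : inner ℝ (H (a • v)) (b • w₁) = 0 := by
    rw [map_smul, inner_smul_left, inner_smul_right, h1]
    simp
  refine ⟨a, ha, b • w₁, hs, pos, neg, orth, fun d => ?_⟩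
  generalize a • v = e at pos orth
  generalize b • w₁ = w at neg orth
  have hli : LinearIndependent ℝ ![e, w] := by
    rw [LinearIndependent.pair_iff]
    intro r t hrt
    have h3 : inner ℝ (H e) (r • e + t • w) = 0 := by rw [hrt, inner_zero_right]
    have h4 : inner ℝ (H w) (r • e + t • w) = 0 := by rw [hrt, inner_zero_right]
    rw [inner_add_right, inner_smul_right, inner_smul_right, pos, orth] at h3
    rw [inner_add_right, inner_smul_right, inner_smul_right, neg, hs, orth] at h4
    constructor <;> linarith
  have hspan : Submodule.span ℝ (range ![e, w]) = ⊤ :=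
    hli.span_eq_top_of_card_eq_finrank' (by simp)
  have hd : d ∈ Submodule.span ℝ (range ![e, w]) := by rw [hspan]; trivial
  rw [Matrix.range_cons, Matrix.range_cons, Matrix.range_empty, union_empty, singleton_union,
    Submodule.mem_span_pair] at hd
  obtain ⟨r, t, rfl⟩ := hd
  have h5 : inner ℝ (H w) e = 0 := by rw [hs, orth]
  simp only [inner_add_right, inner_smul_right, pos, neg, orth, h5]
  simp

/-- The vector field `Y` is monotone with respect to the form `⟪H d, d⟫`. -/
structure IsSaddleField (H : Plane →L[ℝ] Plane) (Y : Plane → Plane) (c : ℝ) : Prop where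
  pos : 0 < c
  mono : ∀ y y', c * ‖y - y'‖ ^ 2 ≤ inner ℝ (H (y - y')) (Y y - Y y')

/-- Near `s₀` the field is `H` plus a remainder with small Lipschitz constant. Extending only the
remainder keeps it dominated by `H` everywhere, so the linear term `‖H d‖ ^ 2` of the monotonicity
form loses at most half. -/
theorem exists_isSaddleField {G : Plane → Plane} {s₀ e w : Plane} {H : Plane →L[ℝ] Plane}
    (hG : HasStrictFDerivAt G H s₀) (h : IsFrame H e w) :
    ∃ (Y : Plane → Plane) (K : ℝ≥0) (c ρ : ℝ), LipschitzWith K Y ∧ IsSaddleField H Y c ∧ 0 < ρ ∧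
      EqOn G Y (Metric.closedBall s₀ ρ) := by
  obtain ⟨M, hM, hHM⟩ := h.norm_le
  set L := lipschitzExtensionConstant Plane with hL
  have hL0 : 0 < L := lipschitzExtensionConstant_pos _
  -- Extension multiplies the Lipschitz constant by `L`, and `‖d‖ ≤ M ‖H d‖`; this `ε` leaves the
  -- extended remainder with constant `1 / (2 M)`.
  let ε : ℝ≥0 := ⟨1 / (2 * M * L), by positivity⟩
  have hε0 : 0 < ε := by
    change (0 : ℝ) < 1 / (2 * M * L)
    positivity
  obtain ⟨S, hS, hap⟩ := hG.approximates_deriv_on_nhds (c := ε) (Or.inr hε0)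
  obtain ⟨ρ, hρ, hball⟩ := Metric.nhds_basis_closedBall.mem_iff.1 hS
  obtain ⟨u, hu, heq⟩ := (hap.mono_set hball).lipschitzOnWith.extend_finite_dimension
  have huM : ∀ y y', ‖u y - u y'‖ ≤ 1 / (2 * M) * ‖y - y'‖ := by
    intro y y'
    have := hu.dist_le_mul y y'
    rw [dist_eq_norm, dist_eq_norm] at this
    refine this.trans (le_of_eq ?_)
    congr 1
    change (L : ℝ) * (1 / (2 * M * L)) = 1 / (2 * M)
    have : (L : ℝ) ≠ 0 := by positivity
    field_simp
  refine ⟨fun y => H y + u y, _, 1 / (2 * M ^ 2), ρ, H.lipschitz.add hu, ⟨by positivity, ?_⟩, hρ,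
    fun y hy => ?_⟩
  · intro y y'
    set d := y - y'
    have h1 : H y + u y - (H y' + u y') = H d + (u y - u y') := by
      simp only [d, map_sub]
      abel
    rw [h1, inner_add_right, real_inner_self_eq_norm_sq]
    have h2 : |inner ℝ (H d) (u y - u y')| ≤ ‖H d‖ * (1 / (2 * M) * ‖d‖) :=
      (abs_real_inner_le_norm _ _).trans
        (mul_le_mul_of_nonneg_left (huM y y') (norm_nonneg _))
    have h3 : ‖H d‖ * (1 / (2 * M) * ‖d‖) ≤ 1 / 2 * ‖H d‖ ^ 2 := by
      have : 1 / (2 * M) * ‖d‖ ≤ 1 / (2 * M) * (M * ‖H d‖) :=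
        mul_le_mul_of_nonneg_left (hHM d) (by positivity)
      have h4 : 1 / (2 * M) * (M * ‖H d‖) = 1 / 2 * ‖H d‖ := by field_simp
      nlinarith [norm_nonneg (H d)]
    have h5 : 1 / (2 * M ^ 2) * ‖d‖ ^ 2 ≤ 1 / 2 * ‖H d‖ ^ 2 := by
      have : ‖d‖ ^ 2 ≤ (M * ‖H d‖) ^ 2 := pow_le_pow_left₀ (norm_nonneg _) (hHM d) 2
      calc 1 / (2 * M ^ 2) * ‖d‖ ^ 2 ≤ 1 / (2 * M ^ 2) * (M * ‖H d‖) ^ 2 := by gcongr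
        _ = 1 / 2 * ‖H d‖ ^ 2 := by field_simp
    linarith [neg_abs_le (inner ℝ (H d) (u y - u y'))]
  · have := heq hy
    simp only [Pi.sub_apply] at this
    simp [← this]

variable {H : Plane →L[ℝ] Plane} {Y : Plane → Plane} {c : ℝ} {e w x s : Plane}

theorem hasDerivAt_form (hs : ∀ v v', inner ℝ (H v) v' = inner ℝ (H v') v) {d : ℝ → Plane}
    {d' : Plane} {t : ℝ} (hd : HasDerivAt d d' t) :
    HasDerivAt (fun t => inner ℝ (H (d t)) (d t)) (2 * inner ℝ (H (d t)) d') t := by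
  have h1 := (H.hasFDerivAt.comp_hasDerivAt t hd).inner ℝ hd
  refine h1.congr_deriv ?_
  rw [hs d' (d t)]
  simp only [Function.comp_apply]
  ring

/-- The derivative of the form is `2 ⟪H d, Y γ - Y δ⟫`; the translation by `x` cancels, so one field
serves all parameters. -/
theorem IsSaddleField.monotoneOn_form (hY : IsSaddleField H Y c)
    (hs : ∀ v v', inner ℝ (H v) v' = inner ℝ (H v') v) {γ δ : ℝ → Plane} {S : Set ℝ}
    (hS : Convex ℝ S) (hγ : ∀ t ∈ S, HasDerivAt γ (Y (γ t) - x) t)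
    (hδ : ∀ t ∈ S, HasDerivAt δ (Y (δ t) - x) t) :
    MonotoneOn (fun t => inner ℝ (H (γ t - δ t)) (γ t - δ t)) S := by
  have key : ∀ t ∈ S, HasDerivAt (fun t => inner ℝ (H (γ t - δ t)) (γ t - δ t))
      (2 * inner ℝ (H (γ t - δ t)) (Y (γ t) - Y (δ t))) t := by
    intro t ht
    have := hasDerivAt_form hs ((hγ t ht).sub (hδ t ht))
    simpa using this
  refine monotoneOn_of_deriv_nonneg hS (fun t ht => (key t ht).continuousAt.continuousWithinAt)
    (fun t ht => (key t (interior_subset ht)).differentiableAt.differentiableWithinAt)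
    fun t ht => ?_
  rw [(key t (interior_subset ht)).deriv]
  have := hY.mono (γ t) (δ t)
  have h2 : 0 ≤ c * ‖γ t - δ t‖ ^ 2 := mul_nonneg hY.pos.le (by positivity)
  linarith

/-- The form increases to `0`, hence is at most `0`. Were it `0` at `T`, it would vanish from then
on, while its derivative at `T` is positive for distinct points. -/
theorem IsSaddleField.form_neg (hY : IsSaddleField H Y c)
    (hs : ∀ v v', inner ℝ (H v) v' = inner ℝ (H v') v) {γ δ : ℝ → Plane} {T : ℝ}
    (hγ : ∀ t, T ≤ t → HasDerivAt γ (Y (γ t) - x) t)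
    (hδ : ∀ t, T ≤ t → HasDerivAt δ (Y (δ t) - x) t)
    (hlim : Tendsto (fun t => γ t - δ t) atTop (𝓝 0)) (hne : γ T ≠ δ T) :
    inner ℝ (H (γ T - δ T)) (γ T - δ T) < 0 := by
  set q : ℝ → ℝ := fun t => inner ℝ (H (γ t - δ t)) (γ t - δ t) with hq
  have hmono : MonotoneOn q (Ici T) := hY.monotoneOn_form hs (convex_Ici T) hγ hδ
  have hq0 : Tendsto q atTop (𝓝 0) := by
    have hc : Continuous fun d : Plane => inner ℝ (H d) d := by fun_prop
    have := (hc.tendsto 0).comp hlim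
    simpa [Function.comp_def, hq] using this
  have hle : ∀ t ∈ Ici T, q t ≤ 0 := fun t ht =>
    ge_of_tendsto hq0 ((eventually_ge_atTop t).mono fun u hu =>
      hmono ht (mem_Ici.2 ((mem_Ici.1 ht).trans hu)) hu)
  by_contra hcon
  have hge : 0 ≤ q T := not_lt.1 hcon
  have hconst : ∀ t ∈ Ici T, q t = 0 := fun t ht =>
    le_antisymm (hle t ht) (hge.trans (hmono (mem_Ici.2 le_rfl) ht ht))
  have hd := (hasDerivAt_form hs ((hγ T le_rfl).sub (hδ T le_rfl))).hasDerivWithinAt (s := Ici T)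
  have hd0 : HasDerivWithinAt q 0 (Ici T) T :=
    (hasDerivWithinAt_const T (Ici T) (0 : ℝ)).congr hconst (hconst T (mem_Ici.2 le_rfl))
  have := (uniqueDiffOn_Ici T T (mem_Ici.2 le_rfl)).eq_deriv _ hd hd0
  have h1 := hY.mono (γ T) (δ T)
  have h2 : 0 < c * ‖γ T - δ T‖ ^ 2 := by
    have : 0 < ‖γ T - δ T‖ := norm_pos_iff.2 (sub_ne_zero.2 hne)
    have := hY.pos
    positivity
  simp only [Pi.sub_apply, sub_sub_sub_cancel_right] at this
  linarith

/-- The stable set is a graph over the `w`-axis: points of it with the same `w`-coordinate differ by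
a vector on which the form is nonnegative, and so coincide by `form_neg`. Two trajectories on the
same side of `s` reach a common `w`-level by the intermediate value theorem. -/
theorem IsSaddleField.meet (hY : IsSaddleField H Y c) (hf : IsFrame H e w) {γ δ : ℝ → Plane} {T : ℝ}
    (hγ : ∀ t, T ≤ t → HasDerivAt γ (Y (γ t) - x) t)
    (hδ : ∀ t, T ≤ t → HasDerivAt δ (Y (δ t) - x) t)
    (hγs : Tendsto γ atTop (𝓝 s)) (hδs : Tendsto δ atTop (𝓝 s))
    (hγw : inner ℝ (H w) (γ T - s) < 0) (hδw : inner ℝ (H w) (δ T - s) < 0) :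
    ∃ a ≥ T, ∃ b ≥ T, γ a = δ b := by
  set m := max (inner ℝ (H w) (γ T - s)) (inner ℝ (H w) (δ T - s)) with hm
  have hm0 : m < 0 := max_lt hγw hδw
  have ivt : ∀ {η : ℝ → Plane}, (∀ t, T ≤ t → HasDerivAt η (Y (η t) - x) t) →
      Tendsto η atTop (𝓝 s) → inner ℝ (H w) (η T - s) ≤ m →
      ∃ a ≥ T, inner ℝ (H w) (η a - s) = m := by
    intro η hη hηs hle
    have hc : Continuous fun y : Plane => inner ℝ (H w) (y - s) := by fun_prop
    have hlim : Tendsto (fun t => inner ℝ (H w) (η t - s)) atTop (𝓝 0) := by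
      have := (hc.tendsto s).comp hηs
      simpa [Function.comp_def] using this
    obtain ⟨t, ht, htT⟩ := ((hlim.eventually (lt_mem_nhds hm0)).and (eventually_ge_atTop T)).exists
    have hcont : ContinuousOn (fun t => inner ℝ (H w) (η t - s)) (Icc T t) := fun u hu =>
      (hc.continuousAt.comp (hη u hu.1).continuousAt).continuousWithinAt
    obtain ⟨a, ha, hae⟩ := intermediate_value_Icc htT hcont ⟨hle, ht.le⟩
    exact ⟨a, ha.1, hae⟩
  obtain ⟨a, ha, hae⟩ := ivt hγ hγs (le_max_left _ _)
  obtain ⟨b, hb, hbe⟩ := ivt hδ hδs (le_max_right _ _)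
  refine ⟨a, ha, b, hb, ?_⟩
  by_contra hne
  have h1 := hY.form_neg (x := x) hf.symm (T := 0) (γ := fun t => γ (t + a)) (δ := fun t => δ (t + b))
    (fun t ht => (hγ (t + a) (by linarith)).comp_add_const t a)
    (fun t ht => (hδ (t + b) (by linarith)).comp_add_const t b) (by
      have h1 := hγs.comp (tendsto_atTop_add_const_right atTop a tendsto_id)
      have h2 := hδs.comp (tendsto_atTop_add_const_right atTop b tendsto_id)
      simpa using h1.sub h2) (by simpa using hne)
  simp only [zero_add] at h1
  rw [hf.form_eq] at h1
  have h2 : inner ℝ (H w) (γ a - δ b) = 0 := by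
    have : γ a - δ b = (γ a - s) - (δ b - s) := by abel
    rw [this, inner_sub_right, hae, hbe, sub_self]
  rw [h2] at h1
  nlinarith [sq_nonneg (inner ℝ (H e) (γ a - δ b))]

/-- With `q` the form, `N = ‖γ - s‖ ^ 2 - (K / c) q` is a Lyapunov function: `q` grows at least at
rate `2 c ‖γ - s‖ ^ 2`, which outweighs the Lipschitz growth of the norm. Both `N` and `q` converge,
so the distance does; a positive limit would make the nonpositive `q` grow linearly. The bound is
`‖γ t - s‖ ^ 2 ≤ N t ≤ N 0`. -/
theorem IsSaddleField.tendsto_of_form_nonpos (hY : IsSaddleField H Y c)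
    (hs : ∀ v v', inner ℝ (H v) v' = inner ℝ (H v') v) {K : ℝ≥0} (hK : LipschitzWith K Y)
    (hsx : Y s = x) {γ : ℝ → Plane} (hγ : ∀ t, HasDerivAt γ (Y (γ t) - x) t)
    (hQ : ∀ t, 0 ≤ t → inner ℝ (H (γ t - s)) (γ t - s) ≤ 0) :
    Tendsto γ atTop (𝓝 s) ∧
      ∀ t, 0 ≤ t → ‖γ t - s‖ ^ 2 ≤ (1 + K / c * ‖H‖) * ‖γ 0 - s‖ ^ 2 := by
  have hc := hY.pos
  set q : ℝ → ℝ := fun t => inner ℝ (H (γ t - s)) (γ t - s) with hq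
  set N : ℝ → ℝ := fun t => ‖γ t - s‖ ^ 2 - K / c * q t with hN
  have hqd : ∀ t, HasDerivAt q (2 * inner ℝ (H (γ t - s)) (Y (γ t) - Y s)) t := fun t => by
    rw [hsx]
    exact hasDerivAt_form hs ((hγ t).sub_const s)
  have hqd' : ∀ t, 2 * c * ‖γ t - s‖ ^ 2 ≤ 2 * inner ℝ (H (γ t - s)) (Y (γ t) - Y s) := fun t => by
    have := hY.mono (γ t) s
    linarith
  have hqmono : Monotone q := by
    refine monotone_of_deriv_nonneg (fun t => (hqd t).differentiableAt) fun t => ?_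
    rw [(hqd t).deriv]
    exact le_trans (by positivity) (hqd' t)
  have hq0 : ∀ t, q t ≤ 0 := fun t =>
    (hqmono (le_max_left t 0)).trans (hQ _ (le_max_right t 0))
  have hNd : ∀ t, HasDerivAt N (2 * inner ℝ (γ t - s) (Y (γ t) - Y s) -
      K / c * (2 * inner ℝ (H (γ t - s)) (Y (γ t) - Y s))) t := fun t => by
    have h1 := ((hγ t).sub_const s).norm_sq
    rw [← hsx] at h1
    exact h1.sub ((hqd t).const_mul _)
  have hNanti : Antitone N := by
    refine antitone_of_deriv_nonpos (fun t => (hNd t).differentiableAt) fun t => ?_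
    rw [(hNd t).deriv]
    have h1 : inner ℝ (γ t - s) (Y (γ t) - Y s) ≤ ‖γ t - s‖ * (K * ‖γ t - s‖) := by
      refine (real_inner_le_norm _ _).trans (mul_le_mul_of_nonneg_left ?_ (norm_nonneg _))
      simpa [dist_eq_norm] using hK.dist_le_mul (γ t) s
    have h2 : K / c * (2 * c * ‖γ t - s‖ ^ 2) ≤
        K / c * (2 * inner ℝ (H (γ t - s)) (Y (γ t) - Y s)) :=
      mul_le_mul_of_nonneg_left (hqd' t) (by positivity)
    have h3 : K / c * (2 * c * ‖γ t - s‖ ^ 2) = 2 * (‖γ t - s‖ * (K * ‖γ t - s‖)) := by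
      field_simp
    linarith
  have hN0 : ∀ t, 0 ≤ N t := fun t => by
    have : 0 ≤ K / c * (-q t) := mul_nonneg (by positivity) (by linarith [hq0 t])
    have h2 : 0 ≤ ‖γ t - s‖ ^ 2 := by positivity
    simp only [hN]
    linarith
  have hle : ∀ t, ‖γ t - s‖ ^ 2 ≤ N t := fun t => by
    have : 0 ≤ K / c * (-q t) := mul_nonneg (by positivity) (by linarith [hq0 t])
    simp only [hN]
    linarith
  constructor
  · obtain ⟨l, hl⟩ : ∃ l, Tendsto (fun t => ‖γ t - s‖ ^ 2) atTop (𝓝 l) := by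
      have h1 := tendsto_atTop_ciInf hNanti ⟨0, by rintro _ ⟨t, rfl⟩; exact hN0 t⟩
      have h2 := tendsto_atTop_ciSup hqmono ⟨0, by rintro _ ⟨t, rfl⟩; exact hq0 t⟩
      refine ⟨_, (h1.add (h2.const_mul (K / c))).congr fun t => ?_⟩
      simp only [hN]
      ring
    have hl0 : 0 ≤ l := ge_of_tendsto' hl fun t => by positivity
    rcases hl0.eq_or_lt with rfl | hl0
    · rw [tendsto_iff_norm_sub_tendsto_zero]
      have := (Real.continuous_sqrt.tendsto 0).comp hl
      simpa [Function.comp_def, Real.sqrt_sq (norm_nonneg _)] using this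
    · exfalso
      obtain ⟨T, hT⟩ := eventually_atTop.1 (hl.eventually (lt_mem_nhds (half_lt_self hl0)))
      have hmono : MonotoneOn (fun t => q t - c * l * t) (Ici T) := by
        have hd : ∀ t, HasDerivAt (fun t => q t - c * l * t)
            (2 * inner ℝ (H (γ t - s)) (Y (γ t) - Y s) - c * l) t := fun t => by
          have := (hqd t).sub ((hasDerivAt_id t).const_mul (c * l))
          rw [mul_one] at this
          exact this
        refine monotoneOn_of_deriv_nonneg (convex_Ici T)
          (fun t _ => (hd t).continuousAt.continuousWithinAt)
          (fun t _ => (hd t).differentiableAt.differentiableWithinAt) fun t ht => ?_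
        rw [(hd t).deriv]
        have h1 := hT t (interior_subset ht)
        have h2 := hqd' t
        nlinarith
      set u := T + (1 - q T) / (c * l) with hu
      have hcl : 0 < c * l := by positivity
      have hTu : T ≤ u := by
        have : 0 ≤ (1 - q T) / (c * l) := div_nonneg (by linarith [hq0 T]) hcl.le
        linarith
      have h1 := hmono (mem_Ici.2 le_rfl) (mem_Ici.2 hTu) hTu
      have h2 : c * l * u = c * l * T + (1 - q T) := by
        rw [hu]
        field_simp
      have h3 := hq0 u
      simp only at h1
      linarith
  · intro t ht
    have h1 := (hle t).trans (hNanti ht)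
    have h2 : -q 0 ≤ ‖H‖ * ‖γ 0 - s‖ ^ 2 := by
      have h3 := (neg_le_abs (q 0)).trans (abs_real_inner_le_norm (H (γ 0 - s)) (γ 0 - s))
      have h4 := H.le_opNorm (γ 0 - s)
      nlinarith [norm_nonneg (γ 0 - s)]
    have h3 : K / c * (-q 0) ≤ K / c * (‖H‖ * ‖γ 0 - s‖ ^ 2) :=
      mul_le_mul_of_nonneg_left h2 (by positivity)
    simp only [hN] at h1
    linarith

/-- By `form_neg` against the constant trajectory the form is negative along `γ`, so the
`w`-coordinate never vanishes. -/
theorem IsSaddleField.side (hY : IsSaddleField H Y c) (hf : IsFrame H e w) (hsx : Y s = x)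
    {γ : ℝ → Plane} {T : ℝ} (hγ : ∀ t, T ≤ t → HasDerivAt γ (Y (γ t) - x) t)
    (hγs : Tendsto γ atTop (𝓝 s)) (hne : ∀ t, T ≤ t → γ t ≠ s) :
    (∀ t, T ≤ t → inner ℝ (H w) (γ t - s) < 0) ∨ ∀ t, T ≤ t → 0 < inner ℝ (H w) (γ t - s) := by
  have hne0 : ∀ t, T ≤ t → inner ℝ (H w) (γ t - s) ≠ 0 := fun t ht h0 => by
    have h1 := hY.form_neg (x := x) (δ := fun _ => s) (T := t) hf.symm
      (fun u hu => hγ u (ht.trans hu)) (fun u _ => by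
        rw [hsx, sub_self]
        exact hasDerivAt_const u s) (by simpa using hγs.sub_const s) (hne t ht)
    rw [hf.form_eq, h0] at h1
    nlinarith [sq_nonneg (inner ℝ (H e) (γ t - s))]
  have hcont : ContinuousOn (fun t => inner ℝ (H w) (γ t - s)) (Ici T) := fun u hu => by
    have := (hγ u hu).continuousAt
    exact ContinuousAt.continuousWithinAt (by fun_prop)
  by_contra! hcon
  obtain ⟨⟨a, ha, ha0⟩, b, hb, hb0⟩ := hcon
  obtain ⟨t, ht, ht0⟩ := isPreconnected_Ici.intermediate_value (mem_Ici.2 hb) (mem_Ici.2 ha) hcont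
    ⟨hb0, ha0⟩
  exact hne0 t ht ht0

/-- A point of the transversal through `s + b w` in the direction `e` whose trajectory never leaves
the region where the form is nonpositive. -/
theorem IsSaddleField.exists_stable (hY : IsSaddleField H Y c) (hf : IsFrame H e w)
    (hsx : Y s = x) {Ψ : ℝ → Plane → Plane} (h0 : ∀ y, Ψ 0 y = y)
    (hΨ : ∀ y t, HasDerivAt (fun t => Ψ t y) (Y (Ψ t y) - x) t) (hcont : ∀ t, Continuous (Ψ t))
    {b : ℝ} (hb : 0 < b) :
    ∃ α ∈ Icc (-b) b, ∀ t, 0 ≤ t →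
      inner ℝ (H (Ψ t (s + b • w + α • e) - s)) (Ψ t (s + b • w + α • e) - s) ≤ 0 := by
  by_contra! hcon
  set z : ℝ → Plane := fun α => s + b • w + α • e with hz
  have hzc : Continuous z := by fun_prop
  have hmono : ∀ y, Monotone fun t => inner ℝ (H (Ψ t y - s)) (Ψ t y - s) := fun y => by
    have := hY.monotoneOn_form (x := x) hf.symm (S := univ) convex_univ (γ := fun t => Ψ t y)
      (δ := fun _ => s) (fun t _ => hΨ y t) fun t _ => by
        rw [hsx, sub_self]
        exact hasDerivAt_const t s
    rwa [monotoneOn_univ] at this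
  have hform : ∀ α, inner ℝ (H (z α - s)) (z α - s) = α ^ 2 - b ^ 2 := fun α => by
    have h1 : z α - s = b • w + α • e := by simp [hz, add_assoc]
    have h2 : inner ℝ (H w) e = 0 := by rw [hf.symm, hf.orth]
    rw [h1, hf.form_eq]
    simp only [inner_add_right, inner_smul_right, hf.pos, hf.neg, hf.orth, h2]
    ring
  have hcoord : ∀ α, inner ℝ (H e) (z α - s) = α := fun α => by
    have h1 : z α - s = b • w + α • e := by simp [hz, add_assoc]
    rw [h1]
    simp only [inner_add_right, inner_smul_right, hf.pos, hf.orth]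
    ring
  -- A Ważewski argument. `R` and `L` collect the starting points that enter the positive cone
  -- through its two halves. If every trajectory entered, these open sets would cover the interval,
  -- and some point would lie in both; but a trajectory cannot leave the positive cone, nor change
  -- halves inside it.
  let R : Set ℝ := {α | ∃ t, 0 ≤ t ∧ 0 < inner ℝ (H (Ψ t (z α) - s)) (Ψ t (z α) - s) ∧
    0 < inner ℝ (H e) (Ψ t (z α) - s)}
  let L : Set ℝ := {α | ∃ t, 0 ≤ t ∧ 0 < inner ℝ (H (Ψ t (z α) - s)) (Ψ t (z α) - s) ∧
    inner ℝ (H e) (Ψ t (z α) - s) < 0}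
  have hcR : ∀ t, Continuous fun α => inner ℝ (H (Ψ t (z α) - s)) (Ψ t (z α) - s) := fun t => by
    have := (hcont t).comp hzc
    simp only [Function.comp_def] at this
    fun_prop
  have hcL : ∀ t, Continuous fun α => inner ℝ (H e) (Ψ t (z α) - s) := fun t => by
    have := (hcont t).comp hzc
    simp only [Function.comp_def] at this
    fun_prop
  have hRo : IsOpen R := by
    have : R = ⋃ t, ⋃ (_ : 0 ≤ t), {α | 0 < inner ℝ (H (Ψ t (z α) - s)) (Ψ t (z α) - s)} ∩
        {α | 0 < inner ℝ (H e) (Ψ t (z α) - s)} := by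
      ext α
      simp only [R, mem_iUnion, mem_inter_iff, mem_ofPred_eq, exists_prop]
    rw [this]
    exact isOpen_iUnion fun t => isOpen_iUnion fun _ =>
      (isOpen_lt continuous_const (hcR t)).inter (isOpen_lt continuous_const (hcL t))
  have hLo : IsOpen L := by
    have : L = ⋃ t, ⋃ (_ : 0 ≤ t), {α | 0 < inner ℝ (H (Ψ t (z α) - s)) (Ψ t (z α) - s)} ∩
        {α | inner ℝ (H e) (Ψ t (z α) - s) < 0} := by
      ext α
      simp only [L, mem_iUnion, mem_inter_iff, mem_ofPred_eq, exists_prop]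
    rw [this]
    exact isOpen_iUnion fun t => isOpen_iUnion fun _ =>
      (isOpen_lt continuous_const (hcR t)).inter (isOpen_lt (hcL t) continuous_const)
  have hcover : Icc (-b) b ⊆ R ∪ L := by
    intro α hα
    obtain ⟨t, ht, hpos⟩ := hcon α hα
    have hne : inner ℝ (H e) (Ψ t (z α) - s) ≠ 0 := by
      intro h1
      rw [hf.form_eq, h1] at hpos
      nlinarith [sq_nonneg (inner ℝ (H w) (Ψ t (z α) - s))]
    rcases hne.lt_or_gt with h1 | h1
    · exact Or.inr ⟨t, ht, hpos, h1⟩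
    · exact Or.inl ⟨t, ht, hpos, h1⟩
  -- At `α = ± b` the form is exactly `0` with positive derivative, so the trajectory enters the
  -- positive cone at once, before its `e`-coordinate changes sign.
  have hexit : ∀ {α : ℝ}, α ∈ Icc (-b) b → α ^ 2 = b ^ 2 → ∀ {U : Set ℝ}, IsOpen U → α ∈ U →
      ∃ t, 0 ≤ t ∧ 0 < inner ℝ (H (Ψ t (z α) - s)) (Ψ t (z α) - s) ∧
        inner ℝ (H e) (Ψ t (z α) - s) ∈ U := by
    intro α hα hα2 U hU hαU
    have hd := hasDerivAt_form hf.symm ((hΨ (z α) 0).sub_const s)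
    have hpos : 0 < 2 * inner ℝ (H (Ψ 0 (z α) - s)) (Y (Ψ 0 (z α)) - x) := by
      have h1 := hY.mono (z α) s
      rw [hsx] at h1
      rw [h0]
      have h2 : 0 < ‖z α - s‖ := by
        rw [norm_pos_iff]
        intro h3
        have := hcoord α
        rw [h3, inner_zero_right] at this
        subst this
        nlinarith
      have := hY.pos
      have h3 : 0 < c * ‖z α - s‖ ^ 2 := by positivity
      linarith
    have hev : ∀ᶠ t in 𝓝[>] (0 : ℝ), inner ℝ (H (Ψ 0 (z α) - s)) (Ψ 0 (z α) - s) <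
        inner ℝ (H (Ψ t (z α) - s)) (Ψ t (z α) - s) := by
      have h1 := (hd.tendsto_slope.mono_left
        (nhdsWithin_mono 0 fun t (ht : t ∈ Ioi (0 : ℝ)) => (ne_of_gt ht))).eventually
        (lt_mem_nhds hpos)
      filter_upwards [h1, self_mem_nhdsWithin] with t ht ht0
      rw [slope_def_field, sub_zero] at ht
      have := (div_pos_iff_of_pos_right ht0).1 ht
      linarith
    have hcont0 : ContinuousAt (fun t => inner ℝ (H e) (Ψ t (z α) - s)) 0 := by
      have := (hΨ (z α) 0).continuousAt
      fun_prop
    have hU0 : ∀ᶠ t in 𝓝 (0 : ℝ), inner ℝ (H e) (Ψ t (z α) - s) ∈ U :=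
      hcont0.eventually (hU.mem_nhds (by simpa [h0, hcoord] using hαU))
    obtain ⟨t, ⟨h1, h2⟩, h3⟩ := ((hev.and (hU0.filter_mono nhdsWithin_le_nhds)).and
      (self_mem_nhdsWithin (s := Ioi (0 : ℝ)))).exists
    refine ⟨t, le_of_lt h3, ?_, h2⟩
    rw [h0, hform, hα2, sub_self] at h1
    exact h1
  have hR : (Icc (-b) b ∩ R).Nonempty := by
    obtain ⟨t, h1, h2, h3⟩ := hexit (α := b) ⟨by linarith, le_rfl⟩ rfl isOpen_Ioi (mem_Ioi.2 hb)
    exact ⟨b, ⟨by linarith, le_rfl⟩, t, h1, h2, h3⟩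
  have hL : (Icc (-b) b ∩ L).Nonempty := by
    obtain ⟨t, h1, h2, h3⟩ := hexit (α := -b) ⟨le_rfl, by linarith⟩ (by ring) isOpen_Iio
      (mem_Iio.2 (by linarith : -b < 0))
    exact ⟨-b, ⟨le_rfl, by linarith⟩, t, h1, h2, h3⟩
  obtain ⟨α, -, ⟨t₁, -, hp₁, hc₁⟩, t₂, -, hp₂, hc₂⟩ :=
    isPreconnected_Icc (a := -b) (b := b) R L hRo hLo hcover hR hL
  have hcontα : Continuous fun t => inner ℝ (H e) (Ψ t (z α) - s) := by
    have : Continuous fun t => Ψ t (z α) :=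
      continuous_iff_continuousAt.2 fun t => (hΨ (z α) t).continuousAt
    fun_prop
  have hz0 : (0 : ℝ) ∈ uIcc (inner ℝ (H e) (Ψ t₁ (z α) - s)) (inner ℝ (H e) (Ψ t₂ (z α) - s)) :=
    mem_uIcc.2 (Or.inr ⟨hc₂.le, hc₁.le⟩)
  obtain ⟨t, ht, ht0⟩ := intermediate_value_uIcc hcontα.continuousOn hz0
  have hpt : 0 < inner ℝ (H (Ψ t (z α) - s)) (Ψ t (z α) - s) := by
    rcases mem_uIcc.1 ht with h | h
    · exact hp₁.trans_le (hmono (z α) h.1)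
    · exact hp₂.trans_le (hmono (z α) h.1)
  simp only at ht0
  rw [hf.form_eq, ht0] at hpt
  nlinarith [sq_nonneg (inner ℝ (H w) (Ψ t (z α) - s))]

end SaddleField

/-! ### Separation of the plane by means of branches of the logarithm -/

section Separation

/-- There is a continuous branch of `log (z - p)` on `K`. -/
def HasLog (K : Set ℂ) (p : ℂ) : Prop :=
  ∃ l : ℂ → ℂ, ContinuousOn l K ∧ ∀ z ∈ K, Complex.exp (l z) = z - p

variable {K : Set ℂ}

/-- Write `z - p' = (z - p) (1 + (p - p') / (z - p))`; the second factor lies in the unit disc about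
`1`, where the principal logarithm is continuous. -/
theorem HasLog.of_dist_lt {p p' : ℂ} (h : HasLog K p) (hp : ∀ z ∈ K, ‖p - p'‖ < ‖z - p‖) :
    HasLog K p' := by
  obtain ⟨l, hl, he⟩ := h
  have hne : ∀ z ∈ K, z - p ≠ 0 := fun z hz => by rw [← he z hz]; exact Complex.exp_ne_zero _
  have hslit : ∀ z ∈ K, 1 + (p - p') / (z - p) ∈ Complex.slitPlane := fun z hz => by
    refine Complex.mem_slitPlane_of_norm_lt_one ?_
    rw [norm_div, div_lt_one (norm_pos_iff.2 (hne z hz))]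
    exact hp z hz
  refine ⟨fun z => l z + Complex.log (1 + (p - p') / (z - p)), hl.add (ContinuousOn.clog ?_ hslit),
    fun z hz => ?_⟩
  · exact continuousOn_const.add (continuousOn_const.div (continuousOn_id.sub continuousOn_const) hne)
  · rw [Complex.exp_add, he z hz, Complex.exp_log (Complex.slitPlane_ne_zero (hslit z hz))]
    have := hne z hz
    field_simp
    ring

/-- Far from `K` one uses `z - p = -p (1 - z / p)` and the principal logarithm of the second factor.
-/
theorem hasLog_of_norm_lt {p : ℂ} (hp0 : p ≠ 0) (hp : ∀ z ∈ K, ‖z‖ < ‖p‖) : HasLog K p := by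
  have hslit : ∀ z ∈ K, 1 + (-z / p) ∈ Complex.slitPlane := fun z hz => by
    refine Complex.mem_slitPlane_of_norm_lt_one ?_
    rw [norm_div, norm_neg, div_lt_one (norm_pos_iff.2 hp0)]
    exact hp z hz
  refine ⟨fun z => Complex.log (-p) + Complex.log (1 + (-z / p)),
    continuousOn_const.add (ContinuousOn.clog (by fun_prop) hslit), fun z hz => ?_⟩
  rw [Complex.exp_add, Complex.exp_log (neg_ne_zero.2 hp0),
    Complex.exp_log (Complex.slitPlane_ne_zero (hslit z hz))]
  field_simp
  ring

theorem hasLog_iff_near (hK : IsClosed K) {p : ℂ} (hp : p ∈ Kᶜ) :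
    ∀ᶠ p' in 𝓝 p, p' ∈ Kᶜ ∧ (HasLog K p' ↔ HasLog K p) := by
  obtain ⟨ε, hε, hball⟩ := Metric.isOpen_iff.1 hK.isOpen_compl p hp
  have hd : ∀ z ∈ K, ε ≤ ‖z - p‖ := fun z hz => by
    by_contra h
    exact hball (by simpa [dist_eq_norm] using not_le.1 h) hz
  -- Half the distance to `K` makes the displacement smaller than the distance of either centre from
  -- `K`, so `of_dist_lt` applies in both directions.
  filter_upwards [Metric.ball_mem_nhds p (half_pos hε)] with p' hp'
  have h1 : ‖p - p'‖ < ε / 2 := by rwa [← dist_eq_norm, dist_comm]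
  refine ⟨hball (Metric.ball_subset_ball (by linarith) hp'), fun h => h.of_dist_lt fun z hz => ?_,
    fun h => h.of_dist_lt fun z hz => by linarith [hd z hz]⟩
  have h2 : ‖z - p‖ ≤ ‖z - p'‖ + ‖p - p'‖ := by
    have := norm_sub_le (z - p') (p - p')
    simpa using this
  rw [norm_sub_rev]
  linarith [hd z hz]

/-- Existence of the branch is locally constant in `p` off `K` and holds far away, hence on the
whole of an unbounded connected set. -/
theorem hasLog_of_unbounded (hK : IsCompact K) {C : Set ℂ} (hC : IsPreconnected C) (hCK : C ⊆ Kᶜ)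
    (hub : ¬ Bornology.IsBounded C) {p : ℂ} (hp : p ∈ C) : HasLog K p := by
  obtain ⟨r, hr⟩ := hK.isBounded.exists_norm_le
  obtain ⟨q, hq, hqr⟩ : ∃ q ∈ C, max r 0 < ‖q‖ := by
    by_contra! h
    exact hub (isBounded_iff_forall_norm_le.2 ⟨_, h⟩)
  have hql : HasLog K q := hasLog_of_norm_lt (by
    rintro rfl
    simp at hqr) fun z hz => (hr z hz).trans_lt ((le_max_left _ _).trans_lt hqr)
  by_contra hpl
  have ho : ∀ P : Prop, IsOpen {p | p ∈ Kᶜ ∧ (HasLog K p ↔ P)} := fun P =>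
    isOpen_iff_mem_nhds.2 fun p hp => by
      filter_upwards [hasLog_iff_near hK.isClosed hp.1] with p' hp'
      exact ⟨hp'.1, hp'.2.trans hp.2⟩
  obtain ⟨z, -, hz1, hz2⟩ := hC _ _ (ho True) (ho False)
    (fun z hz => by
      by_cases h : HasLog K z
      · exact Or.inl ⟨hCK hz, by simp [h]⟩
      · exact Or.inr ⟨hCK hz, by simp [h]⟩)
    ⟨q, hq, hCK hq, by simp [hql]⟩ ⟨p, hp, hCK hp, by simp [hpl]⟩
  exact hz2.2.1 (hz1.2.2 trivial)

/-- If no continuous branch of `log (z - p)` exists on `K`, then `p` lies in a bounded component of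
the complement of `K`, where a function that is at most `c` on `K` attains its maximum. -/
theorem exists_isLocalMax_of_not_hasLog (hK : IsCompact K) {p : ℂ} (hp : p ∈ Kᶜ)
    (hlog : ¬ HasLog K p) {h : ℂ → ℝ} (hh : Continuous h) (hhK : ∀ z ∈ K, h z ≤ h p) :
    ∃ m ∈ Kᶜ, IsLocalMax h m := by
  set C := connectedComponentIn Kᶜ p
  have hCo : IsOpen C := hK.isClosed.isOpen_compl.connectedComponentIn
  have hpC : p ∈ C := mem_connectedComponentIn hp
  have hCK : C ⊆ Kᶜ := connectedComponentIn_subset _ _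
  have hC : IsPreconnected C := isPreconnected_connectedComponentIn
  have hb : Bornology.IsBounded C := by
    by_contra hub
    exact hlog (hasLog_of_unbounded hK hC hCK hub hpC)
  have hcpt : IsCompact (closure C) := hb.isCompact_closure
  obtain ⟨m, hm, hmax⟩ := hcpt.exists_isMaxOn ⟨p, subset_closure hpC⟩ hh.continuousOn
  by_cases hmC : m ∈ C
  · exact ⟨m, hCK hmC, (hmax.on_subset subset_closure).isLocalMax (hCo.mem_nhds hmC)⟩
  -- A point of the closure of a component that lies off `K` belongs to the component. So here the
  -- maximum over the closure is attained on `K`, where `h ≤ h p`, and `p` itself is a local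
  -- maximum.
  · have hmK : m ∈ K := by
      by_contra hmK
      refine hmC ((hC.subset_closure (subset_insert m C) (insert_subset hm subset_closure)
        ).subset_connectedComponentIn (mem_insert_of_mem _ hpC) (insert_subset hmK hCK)
        (mem_insert m C))
    refine ⟨p, hp, IsMaxOn.isLocalMax (s := C) (fun z hz => ?_) (hCo.mem_nhds hpC)⟩
    exact (hmax (subset_closure hz)).trans (hhK m hmK)

/-- A compact set that crosses a segment exactly once and remains connected without the crossing
point separates one of the endpoints of the segment from infinity. -/
theorem not_hasLog_of_crossing {a : ℝ} (ha : 0 < a) (h0 : (0 : ℂ) ∈ K)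
    (hconn : IsPreconnected (K \ {0}))
    (hseg : ∀ z ∈ K, z.re = 0 → |z.im| ≤ a → z = 0)
    (hpos : (0 : ℂ) ∈ closure (K ∩ {z | 0 < z.re}))
    (hneg : (0 : ℂ) ∈ closure (K ∩ {z | z.re < 0})) :
    ¬ (HasLog K (a * Complex.I) ∧ HasLog K (-(a * Complex.I))) := by
  rintro ⟨⟨l₁, hl₁, he₁⟩, l₂, hl₂, he₂⟩
  -- The difference of the two branches is a logarithm of `q`. This Möbius map sends the open
  -- segment between the two points onto the negative axis, so on `K` it meets the cut of the
  -- principal argument only at `0`.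
  set q : ℂ → ℂ := fun z => (z - a * Complex.I) / (z + a * Complex.I) with hq
  have hden : ∀ z ∈ K, z + a * Complex.I ≠ 0 := fun z hz => by
    have := he₂ z hz
    rw [sub_neg_eq_add] at this
    rw [← this]
    exact Complex.exp_ne_zero _
  have hexp : ∀ z ∈ K, Complex.exp (l₁ z - l₂ z) = q z := fun z hz => by
    rw [Complex.exp_sub, he₁ z hz, he₂ z hz, sub_neg_eq_add]
  have hqform : ∀ z, z + a * Complex.I ≠ 0 →
      (q z).re = (z.re ^ 2 + z.im ^ 2 - a ^ 2) / Complex.normSq (z + a * Complex.I) ∧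
      (q z).im = -(2 * a * z.re) / Complex.normSq (z + a * Complex.I) := fun z hz => by
    have hN : Complex.normSq (z + a * Complex.I) ≠ 0 := by
      simpa [Complex.normSq_eq_zero] using hz
    simp only [hq, Complex.div_re, Complex.div_im]
    constructor
    · simp
      field_simp
      ring
    · simp
      field_simp
      ring
  have hNpos : ∀ z, z + a * Complex.I ≠ 0 → 0 < Complex.normSq (z + a * Complex.I) :=
    fun z hz => Complex.normSq_pos.2 hz
  have hslit : ∀ z ∈ K \ {0}, q z ∈ Complex.slitPlane := by
    rintro z ⟨hz, hz0⟩
    obtain ⟨h1, h2⟩ := hqform z (hden z hz)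
    have hN := hNpos z (hden z hz)
    rw [Complex.mem_slitPlane_iff, h1, h2]
    by_cases hre : z.re = 0
    · left
      have him : a < |z.im| := by
        by_contra h
        exact hz0 (hseg z hz hre (not_lt.1 h))
      have : a ^ 2 < z.im ^ 2 := by
        rw [← sq_abs z.im]
        exact pow_lt_pow_left₀ him ha.le two_ne_zero
      rw [hre]
      refine div_pos ?_ hN
      linarith
    · right
      refine div_ne_zero (neg_ne_zero.2 ?_) hN.ne'
      positivity
  have hqc : ∀ z ∈ K, ContinuousAt q z := fun z hz =>
    (continuousAt_id.sub continuousAt_const).div (continuousAt_id.add continuousAt_const)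
      (hden z hz)
  -- The two arguments of `q` differ by a multiple of `2π`, hence by a constant on the connected set
  -- `K \ {0}`. As `z` tends to `0` with positive or negative real part, the principal argument
  -- tends to `-π` or `π`, which contradicts continuity of the other argument at `0`.
  set g : ℂ → ℝ := fun z => (l₁ z - l₂ z).im - (q z).arg with hg
  have hlc : ContinuousOn (fun z => (l₁ z - l₂ z).im) K :=
    Complex.continuous_im.comp_continuousOn (hl₁.sub hl₂)
  have hgc : ContinuousOn g (K \ {0}) := (hlc.mono sdiff_subset).sub fun z hz =>
    ((Complex.continuousAt_arg (hslit z hz)).comp (hqc z hz.1)).continuousWithinAt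
  have hgint : ∀ z ∈ K, ∃ n : ℤ, g z = n * (2 * Real.pi) := fun z hz => by
    have hqne : q z ≠ 0 := by rw [← hexp z hz]; exact Complex.exp_ne_zero _
    have h1 : Complex.exp (l₁ z - l₂ z) = Complex.exp (Complex.log (q z)) := by
      rw [hexp z hz, Complex.exp_log hqne]
    obtain ⟨n, hn⟩ := Complex.exp_eq_exp_iff_exists_int.1 h1
    refine ⟨n, ?_⟩
    simp only [hg, hn, Complex.add_im, Complex.log_im]
    simp
  have hconst : ∀ z ∈ K \ {0}, ∀ z' ∈ K \ {0}, g z ≤ g z' := by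
    intro z hz z' hz'
    by_contra hlt
    obtain ⟨n, hn⟩ := hgint z hz.1
    obtain ⟨n', hn'⟩ := hgint z' hz'.1
    rw [not_le, hn, hn'] at hlt
    have hpi := Real.pi_pos
    have hnn : (n' : ℝ) + 1 ≤ n := by
      have : (n' : ℝ) < n := lt_of_mul_lt_mul_right hlt (by positivity)
      exact_mod_cast this
    have hmem : ((n' : ℝ) + 1 / 2) * (2 * Real.pi) ∈ Icc (g z') (g z) := by
      rw [hn, hn']
      constructor <;> nlinarith
    obtain ⟨y, hy, hyv⟩ := hconn.intermediate_value hz' hz hgc hmem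
    obtain ⟨m, hm⟩ := hgint y hy.1
    rw [hyv] at hm
    have h2 : (n' : ℝ) + 1 / 2 = m := mul_right_cancel₀ (by positivity) hm
    have h3 : (2 * n' + 1 : ℤ) = 2 * m := by
      have : (2 * n' + 1 : ℝ) = 2 * m := by linarith
      exact_mod_cast this
    omega
  have hq0 : q 0 = -1 := by
    have : (a : ℂ) * Complex.I ≠ 0 := by simp [ha.ne']
    simp only [hq, zero_sub, zero_add]
    rw [neg_div, div_self this]
  have side : ∀ (S : Set ℂ) (θ : ℝ), 0 ∉ S → (0 : ℂ) ∈ closure (K ∩ S) →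
      Tendsto (fun z => (q z).arg) (𝓝[K ∩ S] 0) (𝓝 θ) →
      ∀ z ∈ K \ {0}, (l₁ 0 - l₂ 0).im - θ = g z := by
    intro S θ hS hcl hlim z hz
    have : (𝓝[K ∩ S] (0 : ℂ)).NeBot := mem_closure_iff_nhdsWithin_neBot.1 hcl
    have h1 : Tendsto g (𝓝[K ∩ S] 0) (𝓝 ((l₁ 0 - l₂ 0).im - θ)) :=
      ((hlc 0 h0).mono_left (nhdsWithin_mono 0 inter_subset_left)).sub hlim
    refine tendsto_nhds_unique h1 (Tendsto.congr' ?_ tendsto_const_nhds)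
    filter_upwards [self_mem_nhdsWithin] with y hy
    have hy0 : y ∈ K \ {0} := ⟨hy.1, fun h => hS (by rw [← mem_singleton_iff.1 h]; exact hy.2)⟩
    exact le_antisymm (hconst z hz y hy0) (hconst y hy0 z hz)
  have hqlim : ∀ S : Set ℂ, Tendsto q (𝓝[K ∩ S] 0) (𝓝 (-1)) := fun S => by
    rw [← hq0]
    exact (hqc 0 h0).mono_left nhdsWithin_le_nhds
  have hP := side {z | 0 < z.re} (-Real.pi) (by simp) hpos (by
    refine (Complex.tendsto_arg_nhdsWithin_im_neg_of_re_neg_of_im_zero (z := -1) (by simp)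
      (by simp)).comp (tendsto_nhdsWithin_iff.2 ⟨hqlim _, ?_⟩)
    filter_upwards [self_mem_nhdsWithin] with z hz
    have h2 := (hqform z (hden z hz.1)).2
    have hN := hNpos z (hden z hz.1)
    have hz2 : 0 < z.re := hz.2
    show (q z).im < 0
    rw [h2]
    refine div_neg_of_neg_of_pos ?_ hN
    have : 0 < 2 * a * z.re := by positivity
    linarith)
  have hN := side {z | z.re < 0} Real.pi (by simp) hneg (by
    have := Complex.continuousWithinAt_arg_of_re_neg_of_im_zero (z := -1) (by simp) (by simp)
    rw [ContinuousWithinAt, Complex.arg_neg_one] at this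
    refine this.comp (tendsto_nhdsWithin_iff.2 ⟨hqlim _, ?_⟩)
    filter_upwards [self_mem_nhdsWithin] with z hz
    have h2 := (hqform z (hden z hz.1)).2
    have hN := hNpos z (hden z hz.1)
    have hz2 : z.re < 0 := hz.2
    show 0 ≤ (q z).im
    rw [h2]
    refine div_nonneg ?_ hN.le
    nlinarith)
  obtain ⟨z, hz⟩ := (closure_nonempty_iff.1 ⟨_, hpos⟩)
  have hz0 : z ∈ K \ {0} := ⟨hz.1, fun h => by
    have h2 : 0 < z.re := hz.2
    rw [mem_singleton_iff.1 h] at h2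
    simp at h2⟩
  have h1 := hP z hz0
  have h2 := hN z hz0
  have := Real.pi_pos
  linarith

end Separation

/-! ### The impossibility of the four gradient lines -/

section FourLines

variable {F : Plane → ℝ}

/-- Both `γ |t|` and `γ (-|t|)` converge as `|t| → ∞`, so each half of the line becomes compact on
adding its limit. -/
theorem IsGradientLine.isCompact {γ : ℝ → Plane} {p q : Plane} (h : IsGradientLine F γ p q) :
    IsCompact (insert p (insert q (range γ))) := by
  have hc : Continuous γ := continuous_iff_continuousAt.2 fun t => (h.1 t).continuousAt
  have h1 := (h.2.2.comp tendsto_norm_cocompact_atTop).isCompact_insert_range_of_cocompact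
    (f := γ ∘ (norm : ℝ → ℝ)) (by fun_prop)
  have h2 := (h.2.1.comp (tendsto_neg_atTop_atBot.comp
    (tendsto_norm_cocompact_atTop (E := ℝ)))).isCompact_insert_range_of_cocompact
    (by fun_prop)
  convert h2.union h1 using 1
  ext y
  simp only [mem_insert_iff, mem_range, mem_union, Function.comp_apply, Real.norm_eq_abs]
  constructor
  · rintro (rfl | rfl | ⟨t, rfl⟩)
    · simp
    · simp
    · rcases le_total 0 t with ht | ht
      · exact Or.inr (Or.inr ⟨t, by rw [abs_of_nonneg ht]⟩)
      · exact Or.inl (Or.inr ⟨t, by rw [abs_of_nonpos ht, neg_neg]⟩)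
  · rintro ((rfl | ⟨t, rfl⟩) | (rfl | ⟨t, rfl⟩))
    · simp
    · exact Or.inr (Or.inr ⟨_, rfl⟩)
    · simp
    · exact Or.inr (Or.inr ⟨_, rfl⟩)

theorem IsGradientLine.isPreconnected_insert {γ : ℝ → Plane} {p q : Plane}
    (h : IsGradientLine F γ p q) : IsPreconnected (insert p (range γ)) := by
  have hc : Continuous γ := continuous_iff_continuousAt.2 fun t => (h.1 t).continuousAt
  refine (isPreconnected_range hc).subset_closure (subset_insert _ _)
    (insert_subset ?_ subset_closure)
  exact mem_closure_of_tendsto h.2.1 (Eventually.of_forall fun t => mem_range_self t)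

theorem IsGradientLine.isPreconnected_insert_insert {γ : ℝ → Plane} {p q : Plane}
    (h : IsGradientLine F γ p q) : IsPreconnected (insert p (insert q (range γ))) := by
  have hc : Continuous γ := continuous_iff_continuousAt.2 fun t => (h.1 t).continuousAt
  refine (isPreconnected_range hc).subset_closure
    ((subset_insert _ _).trans (subset_insert _ _))
    (insert_subset ?_ (insert_subset ?_ subset_closure))
  · exact mem_closure_of_tendsto h.2.1 (Eventually.of_forall fun t => mem_range_self t)
  · exact mem_closure_of_tendsto h.2.2 (Eventually.of_forall fun t => mem_range_self t)

/-- The Hessian as an operator. -/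
noncomputable abbrev hessOp (F : Plane → ℝ) (y : Plane) : Plane →L[ℝ] Plane :=
  fderiv ℝ (gradient F) y

theorem hessOp_symm (hF : ContDiff ℝ ∞ F) (y v v' : Plane) :
    inner ℝ (hessOp F y v) v' = inner ℝ (hessOp F y v') v := by
  rw [inner_fderiv_gradient hF, inner_fderiv_gradient hF, hessian_symm hF]

theorem exists_isSaddleField_gradient (hF : ContDiff ℝ ∞ F) {s₀ e w : Plane}
    (hf : IsFrame (hessOp F s₀) e w) :
    ∃ (Y : Plane → Plane) (K : ℝ≥0) (c ρ : ℝ), LipschitzWith K Y ∧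
      IsSaddleField (hessOp F s₀) Y c ∧ 0 < ρ ∧ EqOn (gradient F) Y (Metric.closedBall s₀ ρ) :=
  exists_isSaddleField
    ((contDiff_gradient hF).contDiffAt.hasStrictFDerivAt (by simp)) hf

theorem hasDerivAt_line (y e : Plane) (α : ℝ) : HasDerivAt (fun α : ℝ => y + α • e) e α := by
  have := ((hasDerivAt_id α).smul_const e).const_add y
  rwa [one_smul] at this

theorem hasDerivAt_comp_line (hF : ContDiff ℝ ∞ F) (y e : Plane) (α : ℝ) :
    HasDerivAt (fun α : ℝ => F (y + α • e)) (inner ℝ (gradient F (y + α • e)) e) α := by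
  rw [inner_gradient_left]
  exact (hF.differentiable (by simp) _).hasFDerivAt.comp_hasDerivAt α (hasDerivAt_line y e α)

theorem hasDerivAt_gradient_line (hF : ContDiff ℝ ∞ F) (y e u : Plane) (α : ℝ) :
    HasDerivAt (fun α : ℝ => inner ℝ (gradient F (y + α • e)) u)
      (hessian F (y + α • e) e u) α := by
  have h1 : HasFDerivAt (gradient F) (hessOp F (y + α • e)) (y + α • e) :=
    ((contDiff_gradient hF).differentiable (by simp) _).hasFDerivAt
  have h2 := (h1.comp_hasDerivAt α (hasDerivAt_line y e α)).inner ℝ (hasDerivAt_const α u)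
  rw [← inner_fderiv_gradient hF]
  simpa using h2

/-- The second derivative test on the line; a saddle is a minimum in any direction of positive
Hessian. -/
theorem isMinOn_segment (hF : ContDiff ℝ ∞ F) {s₀ e : Plane} (h0 : gradient F s₀ = 0)
    (he : 0 < hessian F s₀ e e) : ∃ a > 0, ∀ α : ℝ, |α| ≤ a → F s₀ ≤ F (s₀ + α • e) := by
  have hd : deriv (fun α : ℝ => F (s₀ + α • e)) = fun α => inner ℝ (gradient F (s₀ + α • e)) e :=
    funext fun α => (hasDerivAt_comp_line hF s₀ e α).deriv
  have hmin : IsLocalMin (fun α : ℝ => F (s₀ + α • e)) 0 := by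
    refine isLocalMin_of_deriv_deriv_pos ?_ ?_ (hasDerivAt_comp_line hF s₀ e 0).continuousAt
    · rw [hd, (hasDerivAt_gradient_line hF s₀ e e 0).deriv]
      simpa using he
    · rw [hd]
      simp [h0]
  obtain ⟨a, ha, hball⟩ := Metric.nhds_basis_closedBall.eventually_iff.1 hmin
  exact ⟨a, ha, fun α hα => by simpa using hball (by simpa using hα)⟩

/-- All critical points lie on the closed curve made by the four lines, yet the curve encloses a
local maximum of `F`. -/
theorem not_four_gradientLines (hF : ContDiff ℝ ∞ F) {n : Plane} {s : Fin 3 → Plane}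
    (hs : HasNodeAndThreeSaddles F n s) (h1 : Connects F n (s 1)) (h2 : Connects F n (s 2))
    (h3 : Connects F (s 1) (s 0)) (h4 : Connects F (s 2) (s 0)) : False := by
  obtain ⟨hn, hsad, hinj, hcrit⟩ := hs
  have hns : ∀ i, n ≠ s i := fun i h => by
    obtain ⟨-, -, v, hv⟩ := hsad i
    rw [← h] at hv
    have hv0 : v ≠ 0 := by
      rintro rfl
      simp at hv
    exact absurd (hn.2 v hv0) (not_lt.2 hv.le)
  have hss : ∀ {i j}, i ≠ j → s i ≠ s j := fun h h' => h (hinj h')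
  obtain ⟨γ₁, h1⟩ := h1
  obtain ⟨γ₂, h2⟩ := h2
  obtain ⟨γ₃, h3⟩ := h3
  obtain ⟨γ₄, h4⟩ := h4
  set s₀ := s 0 with hs₀
  have g1 := fun t => h1.strict hF (h1.gradient_ne_zero hF (hns 1) 0) t
  have g2 := fun t => h2.strict hF (h2.gradient_ne_zero hF (hns 2) 0) t
  have g3 := fun t => h3.strict hF (h3.gradient_ne_zero hF (hss (by decide)) 0) t
  have g4 := fun t => h4.strict hF (h4.gradient_ne_zero hF (hss (by decide)) 0) t
  have hF1 : F (s 1) < F s₀ := (g3 0).1.trans (g3 0).2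
  have hF2 : F (s 2) < F s₀ := (g4 0).1.trans (g4 0).2
  have hFn : F n < F s₀ := ((g1 0).1.trans (g1 0).2).trans hF1
  -- The common target `s₀` is left out: the rest is still connected through `n` and lies strictly
  -- below the level `F s₀`.
  set K' : Set Plane := insert n (insert (s 1) (range γ₁)) ∪ insert n (insert (s 2) (range γ₂)) ∪
    insert (s 1) (range γ₃) ∪ insert (s 2) (range γ₄) with hK'
  have hK'F : ∀ y ∈ K', F y < F s₀ := by
    rintro y ((((rfl | rfl | ⟨t, rfl⟩) | (rfl | rfl | ⟨t, rfl⟩)) | (rfl | ⟨t, rfl⟩)) |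
      (rfl | ⟨t, rfl⟩))
    · exact hFn
    · exact hF1
    · exact (g1 t).2.trans hF1
    · exact hFn
    · exact hF2
    · exact (g2 t).2.trans hF2
    · exact hF1
    · exact (g3 t).2
    · exact hF2
    · exact (g4 t).2
  have hs₀K' : s₀ ∉ K' := fun h => lt_irrefl _ (hK'F _ h)
  have hKc : IsCompact (insert s₀ K') := by
    convert ((h1.isCompact.union h2.isCompact).union h3.isCompact).union h4.isCompact using 1
    ext y
    simp only [hK', mem_insert_iff, mem_union]
    tauto
  have hK'conn : IsPreconnected K' := by
    refine ((h1.isPreconnected_insert_insert.union n (by simp) (by simp)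
      h2.isPreconnected_insert_insert).union (s 1) (by simp) (by simp)
      h3.isPreconnected_insert).union (s 2) (by simp) (by simp) h4.isPreconnected_insert
  have hKcrit : ∀ y, gradient F y = 0 → y ∈ insert s₀ K' := fun y hy => by
    rcases hcrit y hy with rfl | ⟨i, rfl⟩
    · simp [hK']
    · fin_cases i <;> simp [hK', hs₀]
  obtain ⟨hg0, ⟨v, hv⟩, w₀, hw₀⟩ := hsad 0
  rw [← hs₀] at hg0 hv hw₀
  obtain ⟨k, hk, w, hf⟩ := exists_isFrame (H := hessOp F s₀) (hessOp_symm hF s₀)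
    (v := v) (w₀ := w₀) (by rwa [inner_fderiv_gradient hF]) (by rwa [inner_fderiv_gradient hF])
  set e := k • v
  set H := hessOp F s₀ with hH
  obtain ⟨a, ha, hmin⟩ := isMinOn_segment hF hg0 (e := e)
    (by rw [← inner_fderiv_gradient hF, hf.pos]; exact one_pos)
  obtain ⟨Y, Kl, c, ρ, hYl, hY, hρ, hYeq⟩ := exists_isSaddleField_gradient hF hf
  have hYs : Y s₀ = 0 := by
    rw [← hYeq (Metric.mem_closedBall_self hρ.le), hg0]
  have tail : ∀ {γ : ℝ → Plane} {p : Plane}, IsGradientLine F γ p s₀ → ∃ T, ∀ t, T ≤ t →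
      HasDerivAt γ (Y (γ t) - 0) t := by
    intro γ p h
    obtain ⟨T, hT⟩ := eventually_atTop.1 (h.2.2.eventually (Metric.closedBall_mem_nhds s₀ hρ))
    refine ⟨T, fun t ht => ?_⟩
    rw [sub_zero, ← hYeq (hT t ht)]
    exact h.1 t
  obtain ⟨T₃, hT₃⟩ := tail h3
  obtain ⟨T₄, hT₄⟩ := tail h4
  set T := max T₃ T₄
  have hd3 : ∀ t, T ≤ t → HasDerivAt γ₃ (Y (γ₃ t) - 0) t :=
    fun t ht => hT₃ t ((le_max_left _ _).trans ht)
  have hd4 : ∀ t, T ≤ t → HasDerivAt γ₄ (Y (γ₄ t) - 0) t :=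
    fun t ht => hT₄ t ((le_max_right _ _).trans ht)
  have hmeet : ∀ {a b : ℝ}, γ₃ a ≠ γ₄ b := fun h =>
    hss (by decide) (h3.eq_of_meet hF h4 h : s 1 = s 2)
  have side3 := hY.side hf hYs hd3 h3.2.2 fun t _ h => lt_irrefl _ (h ▸ (g3 t).2)
  have side4 := hY.side hf hYs hd4 h4.2.2 fun t _ h => lt_irrefl _ (h ▸ (g4 t).2)
  -- the coordinates along the transversal and the segment
  set Φ : Plane → ℂ := fun y => ⟨-inner ℝ (H w) (y - s₀), inner ℝ (H e) (y - s₀)⟩ with hΦ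
  set Θ : ℂ → Plane := fun z => s₀ + (z.re • w + z.im • e) with hΘ
  have hΘΦ : ∀ y, Θ (Φ y) = y := fun y => by
    have := hf.decomp (y - s₀)
    have h2 : (Φ y).re • w + (Φ y).im • e = y - s₀ := by
      conv_rhs => rw [this]
      simp only [hΦ, neg_smul]
      abel
    simp only [hΘ, h2]
    abel
  have hΦΘ : ∀ z, Φ (Θ z) = z := fun z => by
    have h5 : inner ℝ (H w) e = 0 := by rw [hf.symm, hf.orth]
    apply Complex.ext <;>
      simp [hΦ, hΘ, inner_add_right, inner_smul_right, hf.pos, hf.neg, hf.orth, h5]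
  have hΦc : Continuous Φ := by
    have : Φ = fun y => ((-inner ℝ (H w) (y - s₀) : ℝ) : ℂ) +
        ((inner ℝ (H e) (y - s₀) : ℝ) : ℂ) * Complex.I := by
      funext y
      apply Complex.ext <;> simp [hΦ]
    rw [this]
    fun_prop
  have hΘc : Continuous Θ := by fun_prop
  have hΦs : Φ s₀ = 0 := by
    apply Complex.ext <;> simp [hΦ]
  set K : Set ℂ := Φ '' insert s₀ K' with hK
  have hmemK : ∀ z, z ∈ K ↔ Θ z ∈ insert s₀ K' := fun z =>
    ⟨by rintro ⟨y, hy, rfl⟩; rwa [hΘΦ], fun h => ⟨_, h, hΦΘ z⟩⟩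
  have hΘ0 : Θ 0 = s₀ := by simp [hΘ]
  have hKF : ∀ z ∈ K, F (Θ z) ≤ F s₀ := fun z hz => by
    rcases (hmemK z).1 hz with h | h
    · rw [h]
    · exact (hK'F _ h).le
  have hsegF : ∀ z : ℂ, z.re = 0 → |z.im| ≤ a → F s₀ ≤ F (Θ z) := fun z hz hza => by
    have : Θ z = s₀ + z.im • e := by simp [hΘ, hz]
    rw [this]
    exact hmin _ hza
  have hKdiff : K \ {0} = Φ '' K' := by
    ext z
    constructor
    · rintro ⟨⟨y, hy, rfl⟩, hz0⟩
      rcases hy with rfl | hy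
      · exact absurd hΦs hz0
      · exact ⟨y, hy, rfl⟩
    · rintro ⟨y, hy, rfl⟩
      refine ⟨⟨y, Or.inr hy, rfl⟩, fun h => hs₀K' ?_⟩
      have : y = s₀ := by rw [← hΘΦ y, mem_singleton_iff.1 h, hΘ0]
      rwa [← this]
  have hseg : ∀ z ∈ K, z.re = 0 → |z.im| ≤ a → z = 0 := by
    intro z hz hz0 hza
    by_contra hne
    obtain ⟨y, hy, rfl⟩ : z ∈ Φ '' K' := hKdiff ▸ ⟨hz, hne⟩
    have h5 := hsegF _ hz0 hza
    rw [hΘΦ] at h5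
    exact absurd (hK'F y hy) (not_lt.2 h5)
  have hcl : ∀ {γ : ℝ → Plane} {S : Set ℂ}, Tendsto γ atTop (𝓝 s₀) → range γ ⊆ K' →
      (∀ t, T ≤ t → Φ (γ t) ∈ S) → (0 : ℂ) ∈ closure (K ∩ S) := by
    intro γ S hγ hγK hS
    rw [← hΦs]
    refine mem_closure_of_tendsto ((hΦc.tendsto s₀).comp hγ) ?_
    filter_upwards [eventually_ge_atTop T] with t ht
    exact ⟨⟨_, Or.inr (hγK (mem_range_self t)), rfl⟩, hS t ht⟩
  have hr3 : range γ₃ ⊆ K' := fun y hy => Or.inl (Or.inr (Or.inr hy))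
  have hr4 : range γ₄ ⊆ K' := fun y hy => Or.inr (Or.inr hy)
  -- If both lines arrived on the same side of the transversal they would meet, and then `s 1 = s
  -- 2`.
  have hposneg : (0 : ℂ) ∈ closure (K ∩ {z | 0 < z.re}) ∧
      (0 : ℂ) ∈ closure (K ∩ {z | z.re < 0}) := by
    rcases side3 with h3s | h3s <;> rcases side4 with h4s | h4s
    · obtain ⟨a, -, b, -, hab⟩ := hY.meet hf hd3 hd4 h3.2.2 h4.2.2 (h3s T le_rfl) (h4s T le_rfl)
      exact absurd hab hmeet
    · exact ⟨hcl h3.2.2 hr3 fun t ht => by simpa [hΦ] using h3s t ht,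
        hcl h4.2.2 hr4 fun t ht => by simpa [hΦ] using h4s t ht⟩
    · exact ⟨hcl h4.2.2 hr4 fun t ht => by simpa [hΦ] using h4s t ht,
        hcl h3.2.2 hr3 fun t ht => by simpa [hΦ] using h3s t ht⟩
    · obtain ⟨a, -, b, -, hab⟩ := hY.meet hf.neg_right hd3 hd4 h3.2.2 h4.2.2
        (by simpa using h3s T le_rfl) (by simpa using h4s T le_rfl)
      exact absurd hab hmeet
  have hKcpt : IsCompact K := hKc.image hΦc
  -- On the segment `F` is at least its maximum over `K`; without a logarithm at `p` there would be
  -- a local maximum off `K`, but `K` contains all critical points.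
  have hlog : ∀ p : ℂ, p.re = 0 → |p.im| ≤ a → p ≠ 0 → HasLog K p := by
    intro p hp0 hpa hpne
    by_contra hlog
    have hpK : p ∈ Kᶜ := fun h => hpne (hseg p h hp0 hpa)
    obtain ⟨m, hm, hmax⟩ := exists_isLocalMax_of_not_hasLog hKcpt hpK hlog
      (hF.continuous.comp hΘc) fun z hz => (hKF z hz).trans (hsegF p hp0 hpa)
    have hmax' : IsLocalMax F (Θ m) := by
      have h5 : ∀ᶠ y in 𝓝 (Θ m), F (Θ (Φ y)) ≤ F (Θ m) := by
        have h6 : Tendsto Φ (𝓝 (Θ m)) (𝓝 m) := by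
          have := hΦc.tendsto (Θ m)
          rwa [hΦΘ] at this
        exact h6.eventually hmax
      simp only [hΘΦ] at h5
      exact h5
    refine hm ((hmemK m).2 (hKcrit _ ?_))
    simp [gradient, hmax'.fderiv_eq_zero]
  refine not_hasLog_of_crossing (K := K) ha ⟨s₀, Or.inl rfl, hΦs⟩
    (by rw [hKdiff]; exact hK'conn.image _ hΦc.continuousOn) hseg hposneg.1 hposneg.2
    ⟨hlog _ (by simp) (by simp [abs_of_pos ha]) (by simp [ha.ne']),
      hlog _ (by simp) (by simp [abs_of_pos ha]) (by simp [ha.ne'])⟩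

end FourLines

/-! ### Energy estimates and backward limits of gradient curves -/

section Dynamics

variable {F : Plane → ℝ}

/-- Crossing an annulus on which the gradient is bounded below costs energy. -/
theorem annulus_crossing (hF : ContDiff ℝ ∞ F) {γ : ℝ → Plane} {a b : ℝ} (hab : a ≤ b)
    (hγ : ∀ t ∈ Icc a b, HasDerivAt γ (gradient F (γ t)) t) {p : Plane} {r₁ r₂ m : ℝ}
    (hr : r₁ < r₂) (hm : 0 < m) (hb : ‖γ b - p‖ ≤ r₁) (ha : r₂ ≤ ‖γ a - p‖)
    (hgrad : ∀ y, r₁ ≤ ‖y - p‖ → ‖y - p‖ ≤ r₂ → m ≤ ‖gradient F y‖) :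
    m * (r₂ - r₁) ≤ F (γ b) - F (γ a) := by
  have hcγ : ContinuousOn γ (Icc a b) := fun t ht => (hγ t ht).continuousAt.continuousWithinAt
  have hD : ContinuousOn (fun t => ‖γ t - p‖) (Icc a b) := (hcγ.sub continuousOn_const).norm
  -- Here `t₂` is the last time at distance at least `r₂`, and `t₁` below the first later time at
  -- distance at most `r₁`; in between the curve runs in the annulus.
  obtain ⟨t₂, ⟨ht₂, hDt₂⟩, hgr⟩ := (isCompact_Icc.of_isClosed_subset
    (hD.preimage_isClosed_of_isClosed isClosed_Icc (isClosed_Ici (a := r₂)))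
    inter_subset_left).exists_isGreatest ⟨a, ⟨le_rfl, hab⟩, ha⟩
  have hsub : Icc t₂ b ⊆ Icc a b := Icc_subset_Icc_left ht₂.1
  obtain ⟨t₁, ⟨ht₁, hDt₁⟩, hls⟩ := (isCompact_Icc.of_isClosed_subset
    ((hD.mono hsub).preimage_isClosed_of_isClosed isClosed_Icc (isClosed_Iic (a := r₁)))
    inter_subset_left).exists_isLeast ⟨b, ⟨ht₂.2, le_rfl⟩, hb⟩
  have hDt₂' : r₂ ≤ ‖γ t₂ - p‖ := hDt₂
  have hDt₁' : ‖γ t₁ - p‖ ≤ r₁ := hDt₁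
  have heq : ‖γ t₂ - p‖ = r₂ := by
    obtain ⟨u, hu, hue⟩ := intermediate_value_Icc' ht₂.2 (hD.mono hsub)
      (show r₂ ∈ Icc ‖γ b - p‖ ‖γ t₂ - p‖ from ⟨hb.trans hr.le, hDt₂'⟩)
    have hut : u ≤ t₂ := hgr ⟨hsub hu, show r₂ ≤ ‖γ u - p‖ from hue.ge⟩
    rw [← le_antisymm hut hu.1]
    exact hue
  have hmid : ∀ t ∈ Ico t₂ t₁, m ≤ ‖gradient F (γ t)‖ := by
    intro t ht
    have htb : t ∈ Icc t₂ b := ⟨ht.1, ht.2.le.trans ht₁.2⟩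
    refine hgrad _ ?_ ?_
    · by_contra h
      exact absurd (hls ⟨htb, show ‖γ t - p‖ ≤ r₁ from (not_le.1 h).le⟩) (not_le.2 ht.2)
    · rcases ht.1.eq_or_lt with rfl | h
      · exact heq.le
      · by_contra h'
        exact absurd (hgr ⟨hsub htb, show r₂ ≤ ‖γ t - p‖ from (not_le.1 h').le⟩) (not_le.2 h)
  have hsub' : Icc t₂ t₁ ⊆ Icc a b := (Icc_subset_Icc_right ht₁.2).trans hsub
  -- Where the gradient is at least `m`, speed is at most its square over `m`, so the displacement
  -- is bounded by the energy gain over `m`.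
  have hlen := image_norm_le_of_norm_deriv_right_le_deriv_boundary' (a := t₂) (b := t₁)
    (f := fun t => γ t - γ t₂) (f' := fun t => gradient F (γ t))
    (B := fun t => (F (γ t) - F (γ t₂)) / m) (B' := fun t => ‖gradient F (γ t)‖ ^ 2 / m)
    ((hcγ.mono hsub').sub continuousOn_const)
    (fun t ht => ((hγ t (hsub' (Ico_subset_Icc_self ht))).sub_const _).hasDerivWithinAt)
    (by simp)
    (fun t ht => ((hasDerivAt_along hF (hγ t (hsub' ht))).continuousAt.sub
      continuousAt_const).div_const m |>.continuousWithinAt)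
    (fun t ht => (((hasDerivAt_along hF (hγ t (hsub' (Ico_subset_Icc_self ht)))).sub_const
      _).div_const m).hasDerivWithinAt)
    (fun t ht => by
      rw [le_div_iff₀ hm, sq]
      exact mul_le_mul_of_nonneg_left (hmid t ht) (norm_nonneg _))
    (show t₁ ∈ Icc t₂ t₁ from ⟨ht₁.1, le_rfl⟩)
  rw [le_div_iff₀ hm] at hlen
  have h1 : r₂ - r₁ ≤ ‖γ t₁ - γ t₂‖ := by
    have := norm_sub_norm_le (γ t₂ - p) (γ t₁ - p)
    rw [sub_sub_sub_cancel_right, norm_sub_rev (γ t₂) (γ t₁)] at this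
    linarith
  have hmono := monotoneOn_along hF (convex_Icc a b) hγ
  have h2 := hmono (left_mem_Icc.2 hab) ht₂ ht₂.1
  have h3 := hmono (hsub ht₁) (right_mem_Icc.2 hab) ht₁.2
  simp only at h2 h3
  nlinarith

/-- A cluster point `p` exists by compactness. Critical points being isolated, a small annulus about
`p` is free of them, and every crossing costs a fixed energy; since `F` converges along the curve,
crossings stop. The limit is critical, as otherwise `F` would keep dropping by a fixed amount per
unit time. -/
theorem exists_tendsto_atBot (hF : ContDiff ℝ ∞ F) (hfin : {y | gradient F y = 0}.Finite)
    {γ : ℝ → Plane} (hγ : ∀ t ≤ 0, HasDerivAt γ (gradient F (γ t)) t) {K : Set Plane}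
    (hK : IsCompact K) (hγK : ∀ t ≤ 0, γ t ∈ K) :
    ∃ p ∈ K, gradient F p = 0 ∧ Tendsto γ atBot (𝓝 p) := by
  obtain ⟨p, hpK, hp⟩ := hK.exists_mapClusterPt (f := atBot) (u := γ)
    (le_principal_iff.2 (mem_map.2 ((eventually_le_atBot 0).mono hγK)))
  have hmono := monotoneOn_along hF (convex_Iic (0 : ℝ)) hγ
  have hbdd : BddBelow ((fun t => F (γ t)) '' Iic 0) := by
    obtain ⟨M, hM⟩ := (hK.image hF.continuous).bddBelow
    refine ⟨M, ?_⟩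
    rintro _ ⟨t, ht, rfl⟩
    exact hM ⟨_, hγK t ht, rfl⟩
  have hcauchy : ∀ ε > 0, ∃ T ≤ 0, ∀ t ≤ T, F (γ T) - F (γ t) < ε := by
    intro ε hε
    obtain ⟨_, ⟨T, hT, rfl⟩, hlt⟩ := exists_lt_of_csInf_lt
      (⟨_, 0, mem_Iic.2 le_rfl, rfl⟩ : ((fun t => F (γ t)) '' Iic 0).Nonempty)
      (lt_add_of_pos_right (sInf ((fun t => F (γ t)) '' Iic 0)) hε)
    refine ⟨T, hT, fun t ht => ?_⟩
    have := csInf_le hbdd ⟨t, ht.trans hT, rfl⟩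
    simp only at this hlt
    linarith
  have hlim : Tendsto γ atBot (𝓝 p) := by
    rw [Metric.nhds_basis_ball.tendsto_right_iff]
    intro δ hδ
    have hiso : ({y | gradient F y = 0} \ {p})ᶜ ∈ 𝓝 p :=
      (hfin.subset sdiff_subset).isClosed.isOpen_compl.mem_nhds (by simp)
    obtain ⟨δ₁, hδ₁, hball⟩ := Metric.nhds_basis_closedBall.mem_iff.1 hiso
    set r := min δ δ₁ with hr
    have hr0 : 0 < r := lt_min hδ hδ₁
    have hcpt : IsCompact {y : Plane | r / 2 ≤ ‖y - p‖ ∧ ‖y - p‖ ≤ r} := by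
      have hcl : IsClosed ({y : Plane | r / 2 ≤ ‖y - p‖} ∩ {y | ‖y - p‖ ≤ r}) :=
        (isClosed_le (by fun_prop) (by fun_prop)).inter (isClosed_le (by fun_prop) (by fun_prop))
      refine (isCompact_closedBall p r).of_isClosed_subset hcl fun y hy => ?_
      rw [mem_closedBall_iff_norm]
      exact hy.2
    obtain ⟨m, hm, hmle⟩ := hcpt.exists_forall_le' (f := fun y => ‖gradient F y‖) (a := 0)
      (continuous_gradient hF).norm.continuousOn (fun y hy => by
        rw [norm_pos_iff]
        intro h0
        refine hball (mem_closedBall_iff_norm.2 (hy.2.trans (min_le_right _ _)))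
          ⟨h0, fun h => ?_⟩
        have h1 := hy.1
        rw [mem_singleton_iff.1 h, sub_self, norm_zero] at h1
        linarith)
    obtain ⟨T, hT, hosc⟩ := hcauchy (m * (r - r / 2)) (by
      have : 0 < r - r / 2 := by linarith
      positivity)
    obtain ⟨t₀, ht₀, ht₀T⟩ := ((hp.frequently
      (Metric.ball_mem_nhds p (half_pos hr0))).and_eventually (eventually_le_atBot T)).exists
    filter_upwards [eventually_le_atBot t₀] with t ht
    by_contra hfar
    have h1 : r ≤ ‖γ t - p‖ := by
      rw [Metric.mem_ball, dist_eq_norm, not_lt] at hfar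
      exact (min_le_left _ _).trans hfar
    have h2 := annulus_crossing hF ht (fun u hu => hγ u (hu.2.trans (ht₀T.trans hT)))
      (half_lt_self hr0) hm (by
        rw [dist_eq_norm] at ht₀
        exact ht₀.le) h1 fun y hy1 hy2 => hmle y ⟨hy1, hy2⟩
    have h3 := hosc t (ht.trans ht₀T)
    have h4 := hmono (mem_Iic.2 (ht₀T.trans hT)) (mem_Iic.2 hT) ht₀T
    simp only at h4
    linarith
  refine ⟨p, hpK, ?_, hlim⟩
  by_contra hne
  have hpos : 0 < ‖gradient F p‖ ^ 2 := by
    have := norm_pos_iff.2 hne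
    positivity
  have hgl : Tendsto (fun t => ‖gradient F (γ t)‖ ^ 2) atBot (𝓝 (‖gradient F p‖ ^ 2)) :=
    ((((continuous_gradient hF).norm.pow 2).tendsto p).comp hlim)
  obtain ⟨T₁, hT₁⟩ := eventually_atBot.1 (hgl.eventually (lt_mem_nhds (half_lt_self hpos)))
  obtain ⟨T₂, hT₂, hosc⟩ := hcauchy (‖gradient F p‖ ^ 2 / 2) (half_pos hpos)
  set T := min T₁ T₂ with hT
  have hT0 : T ≤ 0 := (min_le_right _ _).trans hT₂
  obtain ⟨u, hu, hue⟩ := exists_hasDerivAt_eq_slope (fun t => F (γ t))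
    (fun t => ‖gradient F (γ t)‖ ^ 2) (a := T - 1) (b := T) (by linarith)
    (fun t ht => (hasDerivAt_along hF (hγ t (ht.2.trans hT0))).continuousAt.continuousWithinAt)
    (fun t ht => hasDerivAt_along hF (hγ t (ht.2.le.trans hT0)))
  have h1 := hT₁ u (hu.2.le.trans (min_le_left _ _))
  have h2 := hosc (T - 1) (by linarith [min_le_right T₁ T₂])
  have h3 := hmono (mem_Iic.2 hT0) (mem_Iic.2 hT₂) (min_le_right _ _)
  rw [sub_sub_cancel, div_one] at hue
  simp only at h1 h3
  linarith

/-- If `F ≥ c` on the boundary of a bounded domain, then gradient curves that start in the domain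
below the level `c` remain in it for all negative times. -/
theorem exists_backward_curve (hF : ContDiff ℝ ∞ F) {O : Set Plane} (hO : IsOpen O)
    (hOb : Bornology.IsBounded O) {c : ℝ} (hfr : ∀ y ∈ frontier O, c ≤ F y) {z : Plane}
    (hz : z ∈ O) (hzc : F z < c) :
    ∃ γ : ℝ → Plane, γ 0 = z ∧ ∀ t ≤ 0, γ t ∈ O ∧ HasDerivAt γ (gradient F (γ t)) t := by
  obtain ⟨R, hR⟩ := hOb.closure.subset_closedBall 0
  obtain ⟨Y, K, hY, hYeq⟩ := exists_lipschitz_extension_gradient hF 0 R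
  obtain ⟨γ, h0, hγ⟩ := exists_integralCurve hY z
  have hc : Continuous γ := continuous_iff_continuousAt.2 fun t => (hγ t).continuousAt
  have hder : ∀ t, γ t ∈ closure O → HasDerivAt γ (gradient F (γ t)) t := fun t ht => by
    rw [hYeq (hR ht)]
    exact hγ t
  have hin : ∀ t ≤ 0, γ t ∈ O := by
    intro t ht
    by_contra hout
    -- At the last time outside, the curve is on the frontier, where `F ≥ c`; but `F` increases from
    -- there to `F z < c`.
    obtain ⟨t₁, ⟨ht₁, hout₁⟩, hgr⟩ := (isCompact_Icc.inter_right
      (hO.isClosed_compl.preimage hc)).exists_isGreatest ⟨t, ⟨le_rfl, ht⟩, hout⟩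
    have ht₁0 : t₁ < 0 := ht₁.2.lt_of_ne (by
      rintro rfl
      exact hout₁ (by rwa [h0]))
    have hlater : ∀ u ∈ Ioc t₁ 0, γ u ∈ O := fun u hu => by
      by_contra h
      exact absurd (hgr ⟨⟨ht₁.1.trans hu.1.le, hu.2⟩, h⟩) (not_le.2 hu.1)
    have hcl : γ t₁ ∈ closure O := by
      refine mem_closure_of_tendsto (b := 𝓝[>] t₁)
        (hc.continuousAt.mono_left nhdsWithin_le_nhds : Tendsto γ _ _) ?_
      filter_upwards [Ioo_mem_nhdsGT ht₁0] with u hu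
      exact hlater u ⟨hu.1, hu.2.le⟩
    have hfr₁ : γ t₁ ∈ frontier O := by
      rw [hO.frontier_eq]
      exact ⟨hcl, hout₁⟩
    have hmono := monotoneOn_along hF (convex_Icc t₁ 0) fun u hu => by
      rcases hu.1.eq_or_lt with rfl | h
      · exact hder _ hcl
      · exact hder _ (subset_closure (hlater u ⟨h, hu.2⟩))
    have h1 := hmono (left_mem_Icc.2 ht₁0.le) (right_mem_Icc.2 ht₁0.le) ht₁0.le
    simp only [h0] at h1
    linarith [hfr _ hfr₁]
  exact ⟨γ, h0, fun t ht => ⟨hin t ht, hder t (subset_closure (hin t ht))⟩⟩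

theorem exists_tendsBackward_of_barrier (hF : ContDiff ℝ ∞ F)
    (hfin : {y | gradient F y = 0}.Finite) {O : Set Plane} (hO : IsOpen O)
    (hOb : Bornology.IsBounded O) {c : ℝ} (hfr : ∀ y ∈ frontier O, c ≤ F y) {z : Plane}
    (hz : z ∈ O) (hzc : F z < c) :
    ∃ p ∈ closure O, gradient F p = 0 ∧ TendsBackward F z p := by
  obtain ⟨γ, h0, hγ⟩ := exists_backward_curve hF hO hOb hfr hz hzc
  obtain ⟨p, hp, hp0, hlim⟩ := exists_tendsto_atBot hF hfin (fun t ht => (hγ t ht).2)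
    hOb.isCompact_closure fun t ht => subset_closure (hγ t ht).1
  exact ⟨p, hp, hp0, γ, h0, fun t ht => (hγ t ht).2, hlim⟩

end Dynamics

/-! ### Stable branches of a saddle and their dependence on it -/

section StableBranch

variable {f : Plane → ℝ}

/-- Every `s` is a zero of the translated field `Y - Y s`, monotone for the same form, so the
construction is uniform in `s`. The chosen starting points are continuous at `s₀` because cluster
values of the coordinate `α` are again stable, and the stable `α` on the transversal is unique by
`form_neg`. -/
theorem IsSaddleField.exists_stable_family {H : Plane →L[ℝ] Plane} {Y : Plane → Plane} {c : ℝ}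
    {e w : Plane} (hY : IsSaddleField H Y c) (hf : IsFrame H e w) {K : ℝ≥0}
    (hK : LipschitzWith K Y) {r : ℝ} (hr : 0 < r) (s₀ : Plane) :
    ∃ z : Plane → Plane, ContinuousAt z s₀ ∧ ∀ s, ∃ γ : ℝ → Plane, γ 0 = z s ∧
      (∀ t, HasDerivAt γ (Y (γ t) - Y s) t) ∧ Tendsto γ atTop (𝓝 s) ∧
      (∀ t, 0 ≤ t → γ t ∈ Metric.closedBall s r) ∧
      ∀ t, 0 ≤ t → inner ℝ (H w) (γ t - s) < 0 := by
  obtain ⟨Ψ, hΨ0, hΨ, C, hC, hΨd⟩ := exists_parametric_flow hK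
  have hΨc : ∀ t, Continuous fun p : Plane × Plane => Ψ p.1 t p.2 := fun t => by
    refine LipschitzWith.continuous (K := ⟨Real.exp (C * |t|), (Real.exp_pos _).le⟩) ?_
    refine LipschitzWith.of_dist_le_mul fun p q => ?_
    rw [mul_comm]
    exact hΨd p.1 q.1 p.2 q.2 t
  have hc := hY.pos
  set A : ℝ := 1 + K / c * ‖H‖ with hA
  have hA1 : 1 ≤ A := by
    have : 0 ≤ K / c * ‖H‖ := by positivity
    linarith
  -- Starting points lie within `b (‖w‖ + ‖e‖ + 1)` of `s`, and the distance grows by a factor at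
  -- most `A`; this `b` keeps the branch in the ball of radius `r`.
  set b : ℝ := r / (A * (‖w‖ + ‖e‖ + 1)) with hb
  have hb0 : 0 < b := by positivity
  choose α hα hQ using fun s => hY.exists_stable hf (s := s) rfl (Ψ := Ψ (Y s)) (hΨ0 _)
    (fun y t => hΨ (Y s) y t) (fun t => (hΨc t).comp (by fun_prop : Continuous fun y => (Y s, y)))
    hb0
  have hlim : ∀ s, _ := fun s => hY.tendsto_of_form_nonpos hf.symm hK (s := s) rfl
    (hΨ (Y s) (s + b • w + α s • e)) (hQ s)
  have hcoord : ∀ (s : Plane) (a : ℝ), inner ℝ (H w) (s + b • w + a • e - s) = -b := fun s a => by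
    have h1 : s + b • w + a • e - s = b • w + a • e := by abel
    have h2 : inner ℝ (H w) e = 0 := by rw [hf.symm, hf.orth]
    rw [h1]
    simp only [inner_add_right, inner_smul_right, hf.neg, h2]
    ring
  refine ⟨fun s => s + b • w + α s • e, ?_, fun s => ⟨fun t => Ψ (Y s) t (s + b • w + α s • e),
    hΨ0 _ _, hΨ _ _, (hlim s).1, fun t ht => ?_, ?_⟩⟩
  · have hαc : Tendsto α (𝓝 s₀) (𝓝 (α s₀)) := by
      refine (isCompact_Icc (a := -b) (b := b)).tendsto_nhds_of_unique_mapClusterPt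
        (Eventually.of_forall hα) fun a _ ha => ?_
      have hstab : ∀ t, 0 ≤ t → inner ℝ (H (Ψ (Y s₀) t (s₀ + b • w + a • e) - s₀))
          (Ψ (Y s₀) t (s₀ + b • w + a • e) - s₀) ≤ 0 := by
        intro t ht
        by_contra hpos
        let q : Plane × ℝ → ℝ := fun p => inner ℝ (H (Ψ (Y p.1) t (p.1 + b • w + p.2 • e) - p.1))
          (Ψ (Y p.1) t (p.1 + b • w + p.2 • e) - p.1)
        have hq : Continuous q := by
          have h1 : Continuous fun p : Plane × ℝ => Ψ (Y p.1) t (p.1 + b • w + p.2 • e) := by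
            have := hK.continuous
            exact (hΨc t).comp (by fun_prop :
              Continuous fun p : Plane × ℝ => (Y p.1, p.1 + b • w + p.2 • e))
          exact (H.continuous.comp (h1.sub continuous_fst)).inner (h1.sub continuous_fst)
        have hev := (hq.tendsto (s₀, a)).eventually (lt_mem_nhds (not_le.1 hpos))
        rw [nhds_prod_eq, eventually_prod_iff] at hev
        obtain ⟨P, hP, P', hP', himp⟩ := hev
        obtain ⟨s, hs1, hs2⟩ := ((ha.frequently hP').and_eventually hP).exists
        exact absurd (hQ s t ht) (not_le.2 (himp hs2 hs1))
      have hlim' := hY.tendsto_of_form_nonpos hf.symm hK (s := s₀) rfl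
        (hΨ (Y s₀) (s₀ + b • w + a • e)) hstab
      by_contra hne
      have h1 := hY.form_neg (x := Y s₀) hf.symm (T := 0)
        (γ := fun t => Ψ (Y s₀) t (s₀ + b • w + a • e))
        (δ := fun t => Ψ (Y s₀) t (s₀ + b • w + α s₀ • e)) (fun t _ => hΨ _ _ t)
        (fun t _ => hΨ _ _ t) (by simpa using hlim'.1.sub (hlim s₀).1) (by
          rw [hΨ0, hΨ0]
          intro h
          have h2 : (a - α s₀) • e = 0 := by
            rw [sub_smul, sub_eq_zero]
            exact add_left_cancel h
          have he : e ≠ 0 := by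
            rintro rfl
            simpa using hf.pos
          rcases smul_eq_zero.1 h2 with h3 | h3
          · exact hne (sub_eq_zero.1 h3)
          · exact he h3)
      rw [hΨ0, hΨ0] at h1
      have h2 : s₀ + b • w + a • e - (s₀ + b • w + α s₀ • e) = (a - α s₀) • e := by
        rw [sub_smul]
        abel
      rw [h2, map_smul, inner_smul_left, inner_smul_right, hf.pos] at h1
      simp only [conj_trivial, mul_one] at h1
      nlinarith [mul_self_nonneg (a - α s₀)]
    exact (continuousAt_id.add continuousAt_const).add
      ((show ContinuousAt α s₀ from hαc).smul continuousAt_const)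
  · rw [mem_closedBall_iff_norm]
    have h1 := (hlim s).2 t ht
    rw [hΨ0] at h1
    have h2 : ‖s + b • w + α s • e - s‖ ≤ b * (‖w‖ + ‖e‖ + 1) := by
      have h3 : s + b • w + α s • e - s = b • w + α s • e := by abel
      have h4 : |α s| ≤ b := abs_le.2 (hα s)
      calc ‖s + b • w + α s • e - s‖ ≤ ‖b • w‖ + ‖α s • e‖ := by rw [h3]; exact norm_add_le _ _
        _ = b * ‖w‖ + |α s| * ‖e‖ := by
          rw [norm_smul, norm_smul, Real.norm_eq_abs, Real.norm_eq_abs, abs_of_pos hb0]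
        _ ≤ b * (‖w‖ + ‖e‖ + 1) := by nlinarith [norm_nonneg e]
    have h3 : A * (b * (‖w‖ + ‖e‖ + 1)) = r := by
      rw [hb]
      field_simp
    refine le_of_sq_le_sq ?_ hr.le
    calc ‖Ψ (Y s) t (s + b • w + α s • e) - s‖ ^ 2
        ≤ A * ‖s + b • w + α s • e - s‖ ^ 2 := h1
      _ ≤ A ^ 2 * (b * (‖w‖ + ‖e‖ + 1)) ^ 2 := by
        have h5 := pow_le_pow_left₀ (norm_nonneg _) h2 2
        have h6 : A ≤ A ^ 2 := by nlinarith
        exact mul_le_mul h6 h5 (by positivity) (by positivity)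
      _ = r ^ 2 := by rw [← mul_pow, h3]
  · have hside := hY.side hf (s := s) rfl (T := 0)
      (fun t _ => hΨ (Y s) (s + b • w + α s • e) t) (hlim s).1 (fun t ht h => by
        have heq := integralCurve_eqOn_Icc (Y := fun y => Y y - Y s) (K := K + 0) (S := univ)
          (lipschitzOnWith_univ.2 (hK.sub (LipschitzWith.const (Y s))))
          (a := 0) (b := t) (t₀ := t) ⟨ht, le_rfl⟩
          (γ := fun t => Ψ (Y s) t (s + b • w + α s • e)) (δ := fun _ => s)
          (fun u _ => hΨ _ _ u) (fun _ _ => mem_univ _)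
          (fun u _ => by rw [sub_self]; exact hasDerivAt_const u s) (fun _ _ => mem_univ _) h
          (show (0 : ℝ) ∈ Icc 0 t from ⟨le_rfl, ht⟩)
        simp only [hΨ0] at heq
        have h1 := hcoord s (α s)
        rw [heq, sub_self, inner_zero_right] at h1
        linarith)
    rcases hside with h | h
    · exact h
    · have := h 0 le_rfl
      rw [hΨ0, hcoord] at this
      linarith

/-- The markers `z σ s` select a point on each half of the stable manifold, with the saddle as
coordinate and `x = gradient f s` recovered from it. By `meet`, a line into `s` must pass through
one of them, so questions about connections become questions about the backward orbit of a marker.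
-/
theorem exists_stable_branches (hf : ContDiff ℝ ∞ f) {s₀ e w : Plane}
    (hfr : IsFrame (hessOp f s₀) e w) :
    ∃ r > 0, ∃ z : Bool → Plane → Plane, (∀ σ, ContinuousAt (z σ) s₀) ∧
      ∀ s ∈ Metric.ball s₀ r,
        (∀ σ, z σ s ≠ s ∧ TendsForward (phase f (gradient f s)) (z σ s) s) ∧
        ∀ (p : Plane) (γ : ℝ → Plane), IsGradientLine (phase f (gradient f s)) γ p s → p ≠ s →
          ∃ σ t, γ t = z σ s := by
  obtain ⟨Y, K, c, ρ, hK, hY, hρ, hYeq⟩ := exists_isSaddleField_gradient hf hfr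
  set H := hessOp f s₀
  obtain ⟨z₁, hz₁, h₁⟩ := hY.exists_stable_family hfr hK (half_pos hρ) s₀
  obtain ⟨z₂, hz₂, h₂⟩ := hY.exists_stable_family hfr.neg_right hK (half_pos hρ) s₀
  refine ⟨ρ / 2, half_pos hρ, fun σ => cond σ z₁ z₂, fun σ => by cases σ <;> assumption,
    fun s hs => ?_⟩
  have hs' : s ∈ Metric.closedBall s₀ ρ :=
    Metric.ball_subset_closedBall (Metric.ball_subset_ball (by linarith) hs)
  have hYs : gradient f s = Y s := hYeq hs'
  have hball : ∀ y ∈ Metric.closedBall s (ρ / 2),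
      gradient (phase f (gradient f s)) y = Y y - Y s := fun y hy => by
    rw [gradient_phase hf, hYs, hYeq]
    rw [Metric.mem_closedBall] at hy ⊢
    rw [Metric.mem_ball] at hs
    linarith [dist_triangle y s s₀]
  have forward : ∀ {w' : Plane} {z : Plane → Plane}, (∃ γ : ℝ → Plane, γ 0 = z s ∧
      (∀ t, HasDerivAt γ (Y (γ t) - Y s) t) ∧ Tendsto γ atTop (𝓝 s) ∧
      (∀ t, 0 ≤ t → γ t ∈ Metric.closedBall s (ρ / 2)) ∧
      ∀ t, 0 ≤ t → inner ℝ (H w') (γ t - s) < 0) →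
      z s ≠ s ∧ TendsForward (phase f (gradient f s)) (z s) s := by
    rintro w' z ⟨γ, h0, hγ, hlim, hin, hside⟩
    refine ⟨fun h => ?_, γ, h0, fun t ht => ?_, hlim⟩
    · have := hside 0 le_rfl
      rw [h0, h, sub_self, inner_zero_right] at this
      exact lt_irrefl _ this
    · rw [hball _ (hin t ht)]
      exact hγ t
  have hphase := contDiff_phase hf (gradient f s)
  have meet : ∀ {w' : Plane} {z : Plane → Plane}, IsFrame H e w' → (∃ γ : ℝ → Plane, γ 0 = z s ∧
      (∀ t, HasDerivAt γ (Y (γ t) - Y s) t) ∧ Tendsto γ atTop (𝓝 s) ∧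
      (∀ t, 0 ≤ t → γ t ∈ Metric.closedBall s (ρ / 2)) ∧
      ∀ t, 0 ≤ t → inner ℝ (H w') (γ t - s) < 0) →
      ∀ {p : Plane} {δ : ℝ → Plane} {T : ℝ}, IsGradientLine (phase f (gradient f s)) δ p s →
      (∀ t, T ≤ t → HasDerivAt δ (Y (δ t) - Y s) t) →
      (∀ t, T ≤ t → inner ℝ (H w') (δ t - s) < 0) → ∃ t, δ t = z s := by
    rintro w' z hfr' ⟨γ, h0, hγ, hlim, hin, hside⟩ p δ T hδ hδY hδside
    obtain ⟨a, ha, b, hb, hab⟩ := hY.meet hfr' (T := max T 0) (fun t _ => hγ t)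
      (fun t ht => hδY t ((le_max_left _ _).trans ht)) hlim hδ.2.2
      (hside _ (le_max_right _ _)) (hδside _ (le_max_left _ _))
    have ha0 : 0 ≤ a := (le_max_right _ _).trans ha
    refine ⟨b - a, ?_⟩
    have := gradientCurve_eqOn hphase (a := 0) (b := a) (t₀ := a) ⟨ha0, le_rfl⟩ (γ := γ)
      (δ := fun u => δ (u + (b - a))) (fun u hu => by
        rw [hball _ (hin u hu.1)]
        exact hγ u) (fun u _ => (hδ.1 _).comp_add_const u (b - a)) (by simpa using hab)
      (show (0 : ℝ) ∈ Icc 0 a from ⟨le_rfl, ha0⟩)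
    simp only [zero_add] at this
    rw [← this, h0]
  refine ⟨fun σ => ?_, fun p γ hγ hp => ?_⟩
  · cases σ
    · exact forward (h₂ s)
    · exact forward (h₁ s)
  · obtain ⟨T, hT⟩ := eventually_atTop.1 (hγ.2.2.eventually
      (Metric.closedBall_mem_nhds s (half_pos hρ)))
    have hγY : ∀ t, T ≤ t → HasDerivAt γ (Y (γ t) - Y s) t := fun t ht => by
      rw [← hball _ (hT t ht)]
      exact hγ.1 t
    have hne : ∀ t, T ≤ t → γ t ≠ s := fun t _ h => by
      refine hγ.gradient_ne_zero hphase hp t ?_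
      rw [h, gradient_phase hf, sub_self]
    rcases hY.side hfr rfl hγY hγ.2.2 hne with h | h
    · obtain ⟨t, ht⟩ := meet hfr (h₁ s) hγ hγY h
      exact ⟨true, t, ht⟩
    · obtain ⟨t, ht⟩ := meet hfr.neg_right (h₂ s) hγ hγY fun t ht => by simpa using h t ht
      exact ⟨false, t, ht⟩

/-- The stable branch of a saddle on a given side. -/
theorem exists_stable_branch {F : Plane → ℝ} (hF : ContDiff ℝ ∞ F) {s e w : Plane}
    (hs : gradient F s = 0) (hfr : IsFrame (hessOp F s) e w) :
    ∃ γ : ℝ → Plane, (∀ t, 0 ≤ t → HasDerivAt γ (gradient F (γ t)) t) ∧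
      Tendsto γ atTop (𝓝 s) ∧ ∀ t, 0 ≤ t → inner ℝ (hessOp F s w) (γ t - s) < 0 := by
  obtain ⟨Y, K, c, ρ, hK, hY, hρ, hYeq⟩ := exists_isSaddleField_gradient hF hfr
  obtain ⟨z, -, h⟩ := hY.exists_stable_family hfr hK hρ s
  obtain ⟨γ, -, hγ, hlim, hin, hside⟩ := h s
  refine ⟨γ, fun t ht => ?_, hlim, hside⟩
  have := hγ t
  rwa [← hYeq (hin t ht), ← hYeq (Metric.mem_closedBall_self hρ.le), hs, sub_zero] at this

end StableBranch

/-! ### Backward limits at the node, and growth of the function near a fold -/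

section Fold

variable {F : Plane → ℝ}

theorem HasNodeAndThreeSaddles.finite {n : Plane} {s : Fin 3 → Plane}
    (h : HasNodeAndThreeSaddles F n s) : {y | gradient F y = 0}.Finite := by
  refine ((finite_range s).insert n).subset fun y hy => ?_
  rcases h.2.2.2 y hy with rfl | ⟨i, rfl⟩
  · exact mem_insert _ _
  · exact mem_insert_of_mem _ (mem_range_self i)

/-- In the absence of connections from the other saddles, a gradient curve that tends to a saddle
and remains bounded for negative times comes from the node. -/
theorem HasNodeAndThreeSaddles.tendsBackward_node (hF : ContDiff ℝ ∞ F) {n : Plane}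
    {s : Fin 3 → Plane} (h : HasNodeAndThreeSaddles F n s) {i : Fin 3}
    (hno : ∀ j, j ≠ i → ¬ Connects F (s j) (s i)) {z p : Plane} (hz : z ≠ s i)
    (hf : TendsForward F z (s i)) (hb : TendsBackward F z p) (hp : gradient F p = 0) :
    p = n := by
  obtain ⟨γ, hγ, h0⟩ := hb.exists_gradientLine hf
  have hgz : gradient F (γ 0) ≠ 0 := fun hg => by
    have : γ = fun _ => γ 0 := gradientCurve_eq hF (t₀ := 0) hγ.1
      (fun t => by rw [hg]; exact hasDerivAt_const t _) rfl
    have h2 := hγ.2.2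
    rw [this] at h2
    exact hz (h0.symm.trans (tendsto_nhds_unique tendsto_const_nhds h2))
  have hlt := hγ.strict hF hgz 0
  rcases h.2.2.2 p hp with hpn | ⟨j, rfl⟩
  · exact hpn
  · exfalso
    by_cases hji : j = i
    · subst hji
      exact lt_irrefl _ (hlt.1.trans hlt.2)
    · exact hno j hji ⟨γ, hγ⟩

/-- Equality at one time would make `F` constant afterwards, so the gradient would vanish and the
curve would rest at its limit. -/
theorem lt_of_tendsto_atTop (hF : ContDiff ℝ ∞ F) {γ : ℝ → Plane} {s : Plane}
    (hγ : ∀ t, 0 ≤ t → HasDerivAt γ (gradient F (γ t)) t) (hs : Tendsto γ atTop (𝓝 s))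
    (hne : ∀ t, 0 ≤ t → γ t ≠ s) {t : ℝ} (ht : 0 ≤ t) : F (γ t) < F s := by
  have hmono := monotoneOn_along hF (convex_Ici (0 : ℝ)) hγ
  have hlim : Tendsto (fun t => F (γ t)) atTop (𝓝 (F s)) := (hF.continuous.tendsto s).comp hs
  have hle : ∀ u, 0 ≤ u → F (γ u) ≤ F s := fun u hu =>
    ge_of_tendsto hlim ((eventually_ge_atTop u).mono fun a ha =>
      hmono (mem_Ici.2 hu) (mem_Ici.2 (hu.trans ha)) ha)
  by_contra hcon
  have hconst : ∀ u, t ≤ u → F (γ u) = F s := fun u hu =>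
    le_antisymm (hle u (ht.trans hu))
      ((not_lt.1 hcon).trans (hmono (mem_Ici.2 ht) (mem_Ici.2 (ht.trans hu)) hu))
  have hd := hasDerivAt_along hF (hγ (t + 1) (by linarith))
  have hd0 : HasDerivAt (fun t => F (γ t)) 0 (t + 1) := by
    refine (hasDerivAt_const (t + 1) (F s)).congr_of_eventuallyEq ?_
    filter_upwards [Ioi_mem_nhds (by linarith : t < t + 1)] with u hu
    exact hconst u (le_of_lt hu)
  have hg : gradient F (γ (t + 1)) = 0 := by simpa using hd.unique hd0
  have hstay : ∀ u, t + 1 ≤ u → γ u = γ (t + 1) := fun u hu =>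
    gradientCurve_eqOn hF (a := t + 1) (b := u) (t₀ := t + 1) ⟨le_rfl, hu⟩
      (δ := fun _ => γ (t + 1)) (fun v hv => hγ v (by linarith [hv.1]))
      (fun v _ => by rw [hg]; exact hasDerivAt_const v _) rfl ⟨hu, le_rfl⟩
  refine hne (t + 1) (by linarith) (tendsto_nhds_unique (Tendsto.congr' ?_
    (tendsto_const_nhds (x := γ (t + 1)) (f := (atTop : Filter ℝ)))) hs)
  filter_upwards [eventually_ge_atTop (t + 1)] with u hu
  exact (hstay u hu).symm

theorem taylor_lower_bound (hF : ContDiff ℝ ∞ F) {y d : Plane} {m : ℝ}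
    (h : ∀ t ∈ Icc (0 : ℝ) 1, m ≤ hessian F (y + t • d) d d) :
    F y + inner ℝ (gradient F y) d + m / 2 ≤ F (y + d) := by
  set g' : ℝ → ℝ := fun t => inner ℝ (gradient F (y + t • d)) d - inner ℝ (gradient F y) d - m * t
    with hg'
  have hd' : ∀ t, HasDerivAt g' (hessian F (y + t • d) d d - m) t := fun t => by
    have := ((hasDerivAt_gradient_line hF y d d t).sub_const (inner ℝ (gradient F y) d)).sub
      ((hasDerivAt_id t).const_mul m)
    rw [mul_one] at this
    exact this
  have hd : ∀ t, HasDerivAt (fun t => F (y + t • d) - inner ℝ (gradient F y) d * t -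
      m / 2 * t ^ 2) (g' t) t := fun t => by
    refine (((hasDerivAt_comp_line hF y d t).sub ((hasDerivAt_id t).const_mul _)).sub
      ((hasDerivAt_pow 2 t).const_mul (m / 2))).congr_deriv ?_
    simp only [hg']
    push_cast
    ring
  have hmono' : MonotoneOn g' (Icc 0 1) := monotoneOn_of_deriv_nonneg (convex_Icc 0 1)
    (fun t _ => (hd' t).continuousAt.continuousWithinAt)
    (fun t _ => (hd' t).differentiableAt.differentiableWithinAt) fun t ht => by
      rw [(hd' t).deriv]
      linarith [h t (interior_subset ht)]
  have hmono : MonotoneOn (fun t => F (y + t • d) - inner ℝ (gradient F y) d * t -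
      m / 2 * t ^ 2) (Icc 0 1) := monotoneOn_of_deriv_nonneg (convex_Icc 0 1)
    (fun t _ => (hd t).continuousAt.continuousWithinAt)
    (fun t _ => (hd t).differentiableAt.differentiableWithinAt) fun t ht => by
      rw [(hd t).deriv]
      have := hmono' (left_mem_Icc.2 zero_le_one) (interior_subset ht) (interior_subset ht).1
      simpa [hg'] using this
  have := hmono (left_mem_Icc.2 zero_le_one) (right_mem_Icc.2 zero_le_one) zero_le_one
  simp only [zero_smul, one_smul, add_zero, mul_zero, mul_one, one_pow] at this
  linarith

theorem contDiff_hessian (hF : ContDiff ℝ ∞ F) : ContDiff ℝ ∞ (hessian F) :=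
  (contDiff_fderiv_infty hF).fderiv_right (by simp)

theorem hasDerivAt_hessian_line (hF : ContDiff ℝ ∞ F) (q v u u' : Plane) :
    ∃ k, HasDerivAt (fun a : ℝ => hessian F (q + a • v) u u') k 0 := by
  have h1 : Differentiable ℝ (hessian F) := (contDiff_hessian hF).differentiable (by simp)
  have h2 : Differentiable ℝ fun a : ℝ => hessian F (q + a • v) u u' := by fun_prop
  exact ⟨_, (h2 0).hasDerivAt⟩

theorem hasDerivAt_hessian_line_self (hF : ContDiff ℝ ∞ F) (q v : Plane) :
    HasDerivAt (fun a : ℝ => hessian F (q + a • v) v v)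
      (iteratedFDeriv ℝ 3 F q fun _ => v) 0 := by
  have h1 : HasFDerivAt (iteratedFDeriv ℝ 2 F) (fderiv ℝ (iteratedFDeriv ℝ 2 F) (q + (0 : ℝ) • v))
      (q + (0 : ℝ) • v) :=
    (hF.differentiable_iteratedFDeriv (m := 2) (WithTop.coe_lt_coe.2 (ENat.natCast_lt_top 2))
      _).hasFDerivAt
  have h2 := (h1.comp_hasDerivAt (0 : ℝ) (hasDerivAt_line q v 0))
  have h3 := ((ContinuousMultilinearMap.apply ℝ (fun _ : Fin 2 => Plane) ℝ
    (fun _ => v)).hasFDerivAt.comp_hasDerivAt (0 : ℝ) h2)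
  have h4 : (fun a : ℝ => hessian F (q + a • v) v v) =
      (ContinuousMultilinearMap.apply ℝ (fun _ : Fin 2 => Plane) ℝ (fun _ => v)) ∘
        iteratedFDeriv ℝ 2 F ∘ fun a : ℝ => q + a • v := by
    funext a
    simp [iteratedFDeriv_two_apply, hessian]
  rw [h4]
  refine h3.congr_deriv ?_
  rw [zero_smul, add_zero, iteratedFDeriv_succ_apply_left]
  rfl

/-- The cubic growth along the kernel beats the mixed terms near a fold. -/
theorem eventually_fold_growth (hF : ContDiff ℝ ∞ F) {q v e : Plane} (hq : gradient F q = 0)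
    (hv : hessian F q v = 0) (hk : 0 < iteratedFDeriv ℝ 3 F q fun _ => v) {l : ℝ} (hl : 0 < l) :
    ∀ᶠ a in 𝓝[>] (0 : ℝ),
      inner ℝ (gradient F (q + a • v)) e ^ 2 < l * (F (q + a • v) - F q) := by
  set κ := iteratedFDeriv ℝ 3 F q fun _ => v
  obtain ⟨k, hk'⟩ := hasDerivAt_hessian_line hF q v v e
  have h1 : ∀ᶠ a in 𝓝[>] (0 : ℝ), κ / 2 * a ≤ hessian F (q + a • v) v v := by
    have := ((hasDerivAt_hessian_line_self hF q v).tendsto_slope.mono_left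
      (nhdsWithin_mono 0 fun t (ht : t ∈ Ioi (0 : ℝ)) => (ne_of_gt ht))).eventually
      (lt_mem_nhds (half_lt_self hk))
    filter_upwards [this, self_mem_nhdsWithin] with a ha ha0
    rw [slope_def_field, sub_zero, zero_smul, add_zero, hv] at ha
    have := (lt_div_iff₀ ha0).1 ha
    simpa using this.le
  have h2 : ∀ᶠ a in 𝓝[>] (0 : ℝ), |hessian F (q + a • v) v e| ≤ (|k| + 1) * a := by
    have := ((hk'.tendsto_slope.mono_left
      (nhdsWithin_mono 0 fun t (ht : t ∈ Ioi (0 : ℝ)) => (ne_of_gt ht))).abs).eventually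
      (gt_mem_nhds (lt_add_one |k|))
    filter_upwards [this, self_mem_nhdsWithin] with a ha ha0
    have ha0' : 0 < a := ha0
    rw [slope_def_field, sub_zero, zero_smul, add_zero, hv, abs_div, abs_of_pos ha0'] at ha
    have := (div_lt_iff₀ ha0').1 ha
    simpa using this.le
  obtain ⟨δ, hδ, hδ12⟩ := mem_nhdsGT_iff_exists_Ioo_subset.1 (h1.and h2)
  have hδ0 : 0 < δ := hδ
  set C := |k| + 1
  have hC : 0 < C := by positivity
  -- The squared mixed term is at most `C ^ 2 a ^ 4`, while `l` times the growth is at least `l κ a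
  -- ^ 3 / 12`; the threshold is where these balance.
  have hsmall : ∀ᶠ a in 𝓝[>] (0 : ℝ), a < l * κ / (12 * C ^ 2) :=
    nhdsWithin_le_nhds (gt_mem_nhds (by positivity))
  filter_upwards [hsmall, Ioo_mem_nhdsGT hδ0] with a ha haδ
  have ha0 : 0 < a := haδ.1
  have hmixed : |inner ℝ (gradient F (q + a • v)) e| ≤ C * a * a := by
    obtain ⟨t, ht, hte⟩ := exists_hasDerivAt_eq_slope
      (fun a => inner ℝ (gradient F (q + a • v)) e) (fun a => hessian F (q + a • v) v e) ha0
      (fun t _ => (hasDerivAt_gradient_line hF q v e t).continuousAt.continuousWithinAt)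
      (fun t _ => hasDerivAt_gradient_line hF q v e t)
    rw [zero_smul, add_zero, hq, inner_zero_left, sub_zero, sub_zero] at hte
    have h3 : inner ℝ (gradient F (q + a • v)) e = hessian F (q + t • v) v e * a := by
      rw [hte]
      field_simp
    rw [h3, abs_mul, abs_of_pos ha0]
    have h4 := (hδ12 ⟨ht.1, ht.2.trans haδ.2⟩).2
    have h5 : C * t ≤ C * a := mul_le_mul_of_nonneg_left ht.2.le hC.le
    exact mul_le_mul_of_nonneg_right (h4.trans h5) ha0.le
  have hgrad : ∀ t ∈ Icc 0 a, κ / 4 * t ^ 2 ≤ inner ℝ (gradient F (q + t • v)) v := by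
    have hd : ∀ t, HasDerivAt (fun t => inner ℝ (gradient F (q + t • v)) v - κ / 4 * t ^ 2)
        (hessian F (q + t • v) v v - κ / 2 * t) t := fun t => by
      refine ((hasDerivAt_gradient_line hF q v v t).sub
        ((hasDerivAt_pow 2 t).const_mul (κ / 4))).congr_deriv ?_
      push_cast
      ring
    have hmono : MonotoneOn (fun t => inner ℝ (gradient F (q + t • v)) v - κ / 4 * t ^ 2)
        (Icc 0 a) := monotoneOn_of_deriv_nonneg (convex_Icc 0 a)
      (fun t _ => (hd t).continuousAt.continuousWithinAt)
      (fun t _ => (hd t).differentiableAt.differentiableWithinAt) fun t ht => by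
        rw [interior_Icc] at ht
        rw [(hd t).deriv]
        linarith [(hδ12 ⟨ht.1, ht.2.trans haδ.2⟩).1]
    intro t ht
    have := hmono (left_mem_Icc.2 ha0.le) ht ht.1
    simp only [zero_smul, add_zero, hq, inner_zero_left] at this
    linarith
  have hcubic : κ / 12 * a ^ 3 ≤ F (q + a • v) - F q := by
    have hd : ∀ t, HasDerivAt (fun t => F (q + t • v) - κ / 12 * t ^ 3)
        (inner ℝ (gradient F (q + t • v)) v - κ / 4 * t ^ 2) t := fun t => by
      refine ((hasDerivAt_comp_line hF q v t).sub
        ((hasDerivAt_pow 3 t).const_mul (κ / 12))).congr_deriv ?_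
      push_cast
      ring
    have hmono : MonotoneOn (fun t => F (q + t • v) - κ / 12 * t ^ 3)
        (Icc 0 a) := monotoneOn_of_deriv_nonneg (convex_Icc 0 a)
      (fun t _ => (hd t).continuousAt.continuousWithinAt)
      (fun t _ => (hd t).differentiableAt.differentiableWithinAt) fun t ht => by
        rw [(hd t).deriv]
        linarith [hgrad t (interior_subset ht)]
    have := hmono (left_mem_Icc.2 ha0.le) (right_mem_Icc.2 ha0.le) ha0.le
    simp only [zero_smul, add_zero] at this
    linarith
  have h6 : inner ℝ (gradient F (q + a • v)) e ^ 2 ≤ (C * a * a) ^ 2 := by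
    rw [← sq_abs]
    exact pow_le_pow_left₀ (abs_nonneg _) hmixed 2
  have h7 : l * (κ / 12 * a ^ 3) ≤ l * (F (q + a • v) - F q) :=
    mul_le_mul_of_nonneg_left hcubic hl.le
  have h8 : a * (12 * C ^ 2) < l * κ := (lt_div_iff₀ (by positivity)).1 ha
  have h9 : (C * a * a) ^ 2 < l * (κ / 12 * a ^ 3) := by
    have : a ^ 3 * (a * (12 * C ^ 2)) < a ^ 3 * (l * κ) :=
      mul_lt_mul_of_pos_left h8 (by positivity)
    nlinarith
  linarith

end Fold

/-! ### The energy barrier around a fold and the birth of the connection -/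

section FoldBox

variable {f F : Plane → ℝ} {v e q : Plane}

/-- An orthonormal basis of the plane. -/
structure IsOrthoBasis (v e : Plane) : Prop where
  self_left : inner ℝ v v = 1
  self_right : inner ℝ e e = 1
  orth : inner ℝ v e = 0
  decomp : ∀ d, d = inner ℝ v d • v + inner ℝ e d • e

theorem exists_isOrthoBasis (hv : inner ℝ v v = 1) : ∃ e, IsOrthoBasis v e := by
  have hv' : v 0 * v 0 + v 1 * v 1 = 1 := by
    rw [PiLp.inner_apply, Fin.sum_univ_two] at hv
    simpa only [RCLike.inner_apply, conj_trivial] using hv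
  refine ⟨!₂[-v 1, v 0], hv, ?_, ?_, fun d => ?_⟩
  · rw [PiLp.inner_apply, Fin.sum_univ_two]
    simp only [RCLike.inner_apply, conj_trivial, Matrix.cons_val_zero, Matrix.cons_val_one]
    linarith
  · simp [PiLp.inner_apply, Fin.sum_univ_two]
    ring
  · ext i
    fin_cases i
    · simp [PiLp.inner_apply, Fin.sum_univ_two]
      linear_combination (-d 0) * hv'
    · simp [PiLp.inner_apply, Fin.sum_univ_two]
      linear_combination (-d 1) * hv'

/-- Replacing `v` by `-v` changes the sign of the cubic term, so it may be taken positive. If the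
Hessian also vanished on `e`, symmetry would make it zero. -/
theorem IsFold.exists_basis (hF : ContDiff ℝ ∞ F) (h : IsFold F q) :
    ∃ v e, IsOrthoBasis v e ∧ hessian F q v = 0 ∧ (0 < iteratedFDeriv ℝ 3 F q fun _ => v) ∧
      hessian F q e e ≠ 0 := by
  obtain ⟨-, hne, v, hv0, hv, hk⟩ := h
  have key : ∃ c : ℝ, ‖c • v‖ = 1 ∧ 0 < iteratedFDeriv ℝ 3 F q fun _ => c • v := by
    have h1 : ∀ c : ℝ, (iteratedFDeriv ℝ 3 F q fun _ => c • v) =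
        c ^ 3 * iteratedFDeriv ℝ 3 F q fun _ => v := fun c => by
      rw [ContinuousMultilinearMap.map_smul_univ]
      simp
    have h2 : 0 < ‖v‖⁻¹ := inv_pos.2 (norm_pos_iff.2 hv0)
    have h3 : ‖v‖⁻¹ * ‖v‖ = 1 := inv_mul_cancel₀ (norm_ne_zero_iff.2 hv0)
    rcases hk.lt_or_gt with hk | hk
    · refine ⟨-‖v‖⁻¹, by rw [norm_smul, norm_neg, Real.norm_of_nonneg h2.le, h3], ?_⟩
      rw [h1]
      have : 0 < ‖v‖⁻¹ ^ 3 := by positivity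
      nlinarith
    · refine ⟨‖v‖⁻¹, by rw [norm_smul, Real.norm_of_nonneg h2.le, h3], ?_⟩
      rw [h1]
      positivity
  obtain ⟨c, hc, hck⟩ := key
  obtain ⟨e, he⟩ := exists_isOrthoBasis (v := c • v) (by
    rw [real_inner_self_eq_norm_sq, hc, one_pow])
  have hcv : hessian F q (c • v) = 0 := by rw [map_smul, hv, smul_zero]
  refine ⟨c • v, e, he, hcv, hck, fun hee => hne ?_⟩
  generalize c • v = u at *
  have h1 : hessian F q e = 0 := by
    ext d
    rw [he.decomp d, map_add, map_smul, map_smul, hee, hessian_symm hF q e u, hcv]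
    simp
  ext d d'
  rw [he.decomp d, map_add, map_smul, map_smul, hcv, h1]
  simp

theorem IsOrthoBasis.coord (h : IsOrthoBasis v e) (q y : Plane) :
    y = q + inner ℝ v (y - q) • v + inner ℝ e (y - q) • e := by
  rw [add_assoc, ← h.decomp, add_sub_cancel]

theorem IsOrthoBasis.norm_le (h : IsOrthoBasis v e) (d : Plane) :
    ‖d‖ ≤ |inner ℝ v d| + |inner ℝ e d| := by
  have h1 : ‖v‖ = 1 := by
    have := h.self_left
    rwa [real_inner_self_eq_norm_sq, pow_eq_one_iff_of_nonneg (norm_nonneg _) two_ne_zero] at this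
  have h2 : ‖e‖ = 1 := by
    have := h.self_right
    rwa [real_inner_self_eq_norm_sq, pow_eq_one_iff_of_nonneg (norm_nonneg _) two_ne_zero] at this
  conv_lhs => rw [h.decomp d]
  refine (norm_add_le _ _).trans ?_
  rw [norm_smul, norm_smul, h1, h2, mul_one, mul_one, Real.norm_eq_abs, Real.norm_eq_abs]

/-- Near a fold with non-negative Hessian there is a box three sides of which lie above the level
of the critical point. -/
theorem exists_fold_box (hF : ContDiff ℝ ∞ F) (hq : gradient F q = 0) (hb : IsOrthoBasis v e)
    (hv : hessian F q v = 0) (hk : 0 < iteratedFDeriv ℝ 3 F q fun _ => v)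
    (he : 0 < hessian F q e e) :
    ∃ α > 0, ∃ β > 0, ∃ m > F q,
      (∀ y, |inner ℝ v (y - q)| ≤ α → |inner ℝ e (y - q)| ≤ β → 0 < hessian F y e e) ∧
      (∀ y, |inner ℝ v (y - q)| ≤ α → |inner ℝ e (y - q)| = β → m ≤ F y) ∧
      ∀ y, inner ℝ v (y - q) = α → |inner ℝ e (y - q)| ≤ β → m ≤ F y := by
  set l := hessian F q e e with hl
  have hFc := hF.continuous
  have hHc : Continuous fun y => hessian F y e e := by
    have := continuous_hessian hF
    fun_prop
  obtain ⟨r, hr, hball⟩ := Metric.nhds_basis_closedBall.mem_iff.1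
    ((hHc.tendsto q).eventually (lt_mem_nhds (half_lt_self he)))
  set β := r / 2 with hβ
  have hβ0 : 0 < β := half_pos hr
  have hH : ∀ y, |inner ℝ v (y - q)| ≤ β → |inner ℝ e (y - q)| ≤ β → l / 2 < hessian F y e e :=
    fun y h1 h2 => hball (by
      rw [mem_closedBall_iff_norm]
      linarith [hb.norm_le (y - q)])
  have hev : inner ℝ e v = 0 := by rw [real_inner_comm, hb.orth]
  have hca : ∀ a b : ℝ, inner ℝ v (q + a • v + b • e - q) = a := fun a b => by
    rw [add_assoc, add_sub_cancel_left, inner_add_right, inner_smul_right, inner_smul_right,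
      hb.self_left, hb.orth]
    ring
  have hcb : ∀ a b : ℝ, inner ℝ e (q + a • v + b • e - q) = b := fun a b => by
    rw [add_assoc, add_sub_cancel_left, inner_add_right, inner_smul_right, inner_smul_right,
      hb.self_right, hev]
    ring
  have hT : ∀ a b : ℝ, |a| ≤ β → |b| ≤ β → F (q + a • v) +
      b * inner ℝ (gradient F (q + a • v)) e + b ^ 2 * l / 4 ≤ F (q + a • v + b • e) := by
    intro a b ha hb'
    have := taylor_lower_bound hF (y := q + a • v) (d := b • e) (m := b ^ 2 * (l / 2))
      fun t ht => by
        have h1 := hH (q + a • v + (t * b) • e) (by rwa [hca]) (by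
          rw [hcb, abs_mul, abs_of_nonneg ht.1]
          nlinarith [ht.2, abs_nonneg b])
        rw [smul_smul]
        simp only [map_smul, _root_.smul_apply, smul_eq_mul]
        nlinarith [sq_nonneg b]
    rw [inner_smul_right] at this
    linarith
  have hend : ∀ b : ℝ, |b| = β → F q < F (q + (0 : ℝ) • v + b • e) := by
    intro b hb'
    have := hT 0 b (by simpa using hβ0.le) hb'.le
    rw [zero_smul, add_zero, hq, inner_zero_left, mul_zero, add_zero] at this
    rw [zero_smul, add_zero]
    have h1 : 0 < b ^ 2 * l / 4 := by
      have : 0 < b ^ 2 := by rw [← sq_abs, hb']; positivity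
      positivity
    linarith
  have hside : ∃ α₁ > 0, ∃ m₁ > F q, ∀ a b : ℝ, |a| ≤ α₁ → |b| = β →
      m₁ ≤ F (q + a • v + b • e) := by
    have hφ : ∀ b : ℝ, |b| = β → ∃ m₁ > F q, ∃ δ > 0, ∀ a : ℝ, |a| ≤ δ →
        m₁ ≤ F (q + a • v + b • e) := by
      intro b hb'
      obtain ⟨m₁, hm₁, hm₁'⟩ := exists_between (hend b hb')
      have hc : Continuous fun a : ℝ => F (q + a • v + b • e) := by fun_prop
      obtain ⟨δ, hδ, hsub⟩ := Metric.nhds_basis_closedBall.mem_iff.1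
        ((hc.tendsto 0).eventually (lt_mem_nhds hm₁'))
      refine ⟨m₁, hm₁, δ, hδ, fun a ha => le_of_lt (hsub ?_)⟩
      rwa [mem_closedBall_iff_norm, sub_zero]
    obtain ⟨m₁, hm₁, δ₁, hδ₁, h1⟩ := hφ β (abs_of_pos hβ0)
    obtain ⟨m₂, hm₂, δ₂, hδ₂, h2⟩ := hφ (-β) (by rw [abs_neg, abs_of_pos hβ0])
    refine ⟨min δ₁ δ₂, lt_min hδ₁ hδ₂, min m₁ m₂, lt_min hm₁ hm₂, fun a b ha hb' => ?_⟩
    rcases eq_or_eq_neg_of_abs_eq hb' with rfl | rfl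
    · exact (min_le_left _ _).trans (h1 a (ha.trans (min_le_left _ _)))
    · exact (min_le_right _ _).trans (h2 a (ha.trans (min_le_right _ _)))
  obtain ⟨α₁, hα₁, m₁, hm₁, hm₁'⟩ := hside
  obtain ⟨α, hαg, hα0, hα⟩ := ((eventually_fold_growth hF (e := e) hq hv hk he).and
    (Ioo_mem_nhdsGT (lt_min hα₁ hβ0))).exists
  have hαβ : α ≤ β := (hα.trans_le (min_le_right _ _)).le
  -- Completing the square: by `hαg`, `l` times the lower bound for `F - F q` from `hT` exceeds `(G
  -- + b l / 2) ^ 2`.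
  have hpos : ∀ b ∈ Icc (-β) β, F q < F (q + α • v + b • e) := by
    intro b hb'
    have h1 := hT α b (by rwa [abs_of_pos hα0]) (abs_le.2 hb')
    set G := inner ℝ (gradient F (q + α • v)) e
    have h2 : 0 < l * (F (q + α • v) + b * G + b ^ 2 * l / 4 - F q) := by
      nlinarith [sq_nonneg (G + b * l / 2)]
    have h3 := pos_of_mul_pos_right h2 he.le
    linarith
  obtain ⟨m₂, hm₂, hm₂'⟩ := isCompact_Icc.exists_forall_le'
    (f := fun b : ℝ => F (q + α • v + b • e)) (by fun_prop) hpos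
  refine ⟨α, hα0, β, hβ0, min m₁ m₂, lt_min hm₁ hm₂,
    fun y h1 h2 => (half_pos he).trans (hH y (h1.trans hαβ) h2), fun y h1 h2 => ?_,
    fun y h1 h2 => ?_⟩
  · rw [hb.coord q y]
    exact (min_le_left _ _).trans
      (hm₁' _ _ (h1.trans (hα.le.trans (min_le_left _ _))) h2)
  · rw [hb.coord q y, h1]
    exact (min_le_right _ _).trans (hm₂' _ (abs_le.1 h2))

/-- If a saddle lies at the edge of a box whose other three sides lie above it, then its stable
branch that enters the box comes from a critical point in the box. -/
theorem HasNodeAndThreeSaddles.connects_of_box (hF : ContDiff ℝ ∞ F) {n : Plane}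
    {s : Fin 3 → Plane} (h : HasNodeAndThreeSaddles F n s) {i : Fin 3}
    (hno : ∀ j, j ≠ i → ¬ Connects F (s j) (s i)) (hb : IsOrthoBasis v e) {α β : ℝ}
    (hsα : |inner ℝ v (s i - q)| < α) (hsβ : |inner ℝ e (s i - q)| < β)
    (hH : ∀ y, |inner ℝ v (y - q)| ≤ α → |inner ℝ e (y - q)| ≤ β → 0 < hessian F y e e)
    (h1 : ∀ y, |inner ℝ v (y - q)| ≤ α → |inner ℝ e (y - q)| = β → F (s i) ≤ F y)
    (h2 : ∀ y, inner ℝ v (y - q) = α → |inner ℝ e (y - q)| ≤ β → F (s i) ≤ F y) :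
    Connects F n (s i) := by
  obtain ⟨hs0, -, w₀, hw₀⟩ := h.2.1 i
  have hop : ∀ v v', inner ℝ (hessOp F (s i) v) v' = hessian F (s i) v v' := fun v v' =>
    inner_fderiv_gradient hF _ _ _
  have hee : 0 < inner ℝ (hessOp F (s i) e) e := by
    rw [hop]
    exact hH _ hsα.le hsβ.le
  obtain ⟨a, ha, w, hfr⟩ := exists_isFrame (hessOp_symm hF (s i)) hee
    (by rw [hop]; exact hw₀)
  have hvw : inner ℝ v w ≠ 0 := fun h0 => by
    have h3 := hb.decomp w
    rw [h0, zero_smul, zero_add] at h3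
    have h4 := hfr.neg
    rw [h3, map_smul, inner_smul_left, inner_smul_right] at h4
    simp only [conj_trivial] at h4
    nlinarith [mul_self_nonneg (inner ℝ e w)]
  -- The sign of `w` is chosen so that the stable branch leaves the saddle towards increasing
  -- `v`-coordinate, into the part of the box with high walls.
  obtain ⟨w', hfr', hvw'⟩ : ∃ w', IsFrame (hessOp F (s i)) (a • e) w' ∧ 0 < inner ℝ v w' := by
    rcases hvw.lt_or_gt with h3 | h3
    · exact ⟨-w, hfr.neg_right, by rw [inner_neg_right]; linarith⟩
    · exact ⟨w, hfr, h3⟩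
  obtain ⟨γ, hγ, hlim, hγs⟩ := exists_stable_branch hF hs0 hfr'
  have hne : ∀ t, 0 ≤ t → γ t ≠ s i := fun t ht h3 => by
    have := hγs t ht
    rw [h3, sub_self, inner_zero_right] at this
    exact lt_irrefl _ this
  have hside : ∀ t, 0 ≤ t → inner ℝ v (s i - q) < inner ℝ v (γ t - q) := fun t ht => by
    have h3 := hfr'.decomp (γ t - s i)
    have h4 : inner ℝ v (γ t - s i) =
        - inner ℝ (hessOp F (s i) w') (γ t - s i) * inner ℝ v w' := by
      conv_lhs => rw [h3]
      rw [inner_sub_right, inner_smul_right, inner_smul_right, inner_smul_right, hb.orth]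
      ring
    have h5 : inner ℝ v (γ t - q) = inner ℝ v (γ t - s i) + inner ℝ v (s i - q) := by
      rw [← inner_add_right, sub_add_sub_cancel]
    have h6 := hγs t ht
    rw [h5, h4]
    nlinarith
  set c := inner ℝ v (s i - q) with hc
  -- The box is cut at the `v`-coordinate of the saddle. On this fourth side `F` is convex in the
  -- direction `e` and critical at the saddle, so it too lies at or above the saddle's level.
  set O : Set Plane := {y | c < inner ℝ v (y - q)} ∩ {y | inner ℝ v (y - q) < α} ∩
    {y | |inner ℝ e (y - q)| < β} with hO
  have hOo : IsOpen O := ((isOpen_lt (by fun_prop) (by fun_prop)).inter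
    (isOpen_lt (by fun_prop) (by fun_prop))).inter (isOpen_lt (by fun_prop) (by fun_prop))
  have hclO : closure O ⊆ {y | c ≤ inner ℝ v (y - q)} ∩ {y | inner ℝ v (y - q) ≤ α} ∩
      {y | |inner ℝ e (y - q)| ≤ β} := by
    refine closure_minimal (fun y ⟨⟨(h3 : c < _), (h4 : _ < α)⟩, (h5 : _ < β)⟩ =>
      ⟨⟨h3.le, h4.le⟩, h5.le⟩) ?_
    exact ((isClosed_le (by fun_prop) (by fun_prop)).inter
      (isClosed_le (by fun_prop) (by fun_prop))).inter (isClosed_le (by fun_prop) (by fun_prop))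
  have hOb : Bornology.IsBounded O := by
    refine (Metric.isBounded_closedBall (x := q) (r := α + β)).subset fun y hy => ?_
    obtain ⟨⟨h3, h4⟩, h5⟩ := hy
    rw [mem_closedBall_iff_norm]
    have h6 : |inner ℝ v (y - q)| ≤ α :=
      abs_le.2 ⟨by linarith [(abs_lt.1 hsα).1, mem_ofPred_eq ▸ h3], le_of_lt h4⟩
    linarith [hb.norm_le (y - q), mem_ofPred_eq ▸ h5]
  have hfr : ∀ y ∈ frontier O, F (s i) ≤ F y := by
    intro y hy
    rw [hOo.frontier_eq] at hy
    obtain ⟨⟨h3, h4⟩, h5⟩ := hclO hy.1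
    change c ≤ inner ℝ v (y - q) at h3
    change inner ℝ v (y - q) ≤ α at h4
    change |inner ℝ e (y - q)| ≤ β at h5
    rcases h5.eq_or_lt with h5' | h5'
    · exact h1 y (abs_le.2 ⟨by linarith [(abs_lt.1 hsα).1], h4⟩) h5'
    rcases h4.eq_or_lt with h4' | h4'
    · exact h2 y h4' h5
    rcases h3.eq_or_lt with h3' | h3'
    · set b := inner ℝ e (y - q) - inner ℝ e (s i - q) with hbdef
      have h6 : y = s i + b • e := by
        conv_lhs => rw [hb.coord (s i) y]
        have h7 : y - s i = (y - q) - (s i - q) := by abel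
        rw [h7, inner_sub_right v, inner_sub_right e, ← h3', ← hc, sub_self, zero_smul, add_zero]
      have h8 := taylor_lower_bound hF (y := s i) (d := b • e) (m := 0) fun t ht => by
        have h9 : s i + t • b • e - q = (s i - q) + (t * b) • e := by
          rw [smul_smul]
          abel
        have h10 : 0 < hessian F (s i + t • b • e) e e := by
          refine hH _ ?_ ?_
          · rw [h9, inner_add_right, inner_smul_right, hb.orth, mul_zero, add_zero]
            exact hsα.le
          · rw [h9, inner_add_right, inner_smul_right, hb.self_right, mul_one]
            have h11 := abs_lt.1 hsβ
            have h12 := abs_lt.1 h5'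
            rw [abs_le]
            constructor <;> nlinarith [ht.1, ht.2]
        simp only [map_smul, _root_.smul_apply, smul_eq_mul]
        nlinarith [mul_self_nonneg b]
      rw [hs0, inner_zero_left, zero_div, add_zero, add_zero, ← h6] at h8
      exact h8
    · exact absurd ⟨⟨h3', h4'⟩, h5'⟩ hy.2
  have hev : ∀ᶠ y in 𝓝 (s i), inner ℝ v (y - q) < α ∧ |inner ℝ e (y - q)| < β := by
    have hc1 : Continuous fun y : Plane => inner ℝ v (y - q) := by fun_prop
    have hc2 : Continuous fun y : Plane => |inner ℝ e (y - q)| := by fun_prop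
    exact ((hc1.tendsto _).eventually (gt_mem_nhds (lt_of_abs_lt hsα))).and
      ((hc2.tendsto _).eventually (gt_mem_nhds hsβ))
  obtain ⟨T, ⟨hTα, hTβ⟩, hT0⟩ := ((hlim.eventually hev).and (eventually_ge_atTop 0)).exists
  obtain ⟨p, -, hp0, hback⟩ := exists_tendsBackward_of_barrier hF h.finite hOo hOb hfr
    (z := γ T) ⟨⟨hside T hT0, hTα⟩, hTβ⟩ (lt_of_tendsto_atTop hF hγ hlim hne hT0)
  have hforw : TendsForward F (γ T) (s i) := ⟨fun t => γ (t + T), by simp,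
    fun t ht => (hγ (t + T) (by linarith)).comp_add_const t T,
    hlim.comp (tendsto_atTop_add_const_right atTop T tendsto_id)⟩
  have hpn := h.tendsBackward_node hF hno (hne T hT0) hforw hback hp0
  obtain ⟨δ, hδ, -⟩ := hback.exists_gradientLine hforw
  exact ⟨δ, hpn ▸ hδ⟩

/-- Near the side of the caustic where a saddle is born together with the node, they are connected,
unless there is a connection from another saddle. -/
theorem eventually_connects_of_fold (hf : ContDiff ℝ ∞ f) {Ω : Set Plane} {n : Plane → Plane}
    {s : Fin 3 → Plane → Plane}
    (hc : ∀ x ∈ Ω, HasNodeAndThreeSaddles (phase f x) (n x) fun i => s i x) {p : Plane}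
    [(𝓝[Ω] p).NeBot] {i : Fin 3} (hq : IsFold (phase f p) q) (hn : Tendsto n (𝓝[Ω] p) (𝓝 q))
    (hs : Tendsto (s i) (𝓝[Ω] p) (𝓝 q)) :
    ∀ᶠ x in 𝓝[Ω] p, (∀ j, j ≠ i → ¬ Connects (phase f x) (s j x) (s i x)) →
      Connects (phase f x) (n x) (s i x) := by
  obtain ⟨v, e, hb, hv, hk, hee⟩ := hq.exists_basis (contDiff_phase hf p)
  -- The Hessian at the fold is a limit of positive definite Hessians at the node, hence nonnegative
  -- on `e`.
  have he : 0 < hessian (phase f p) q e e := by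
    refine lt_of_le_of_ne ?_ hee.symm
    have hcont : Continuous fun y => hessian (phase f p) y e e := by
      have := continuous_hessian (contDiff_phase hf p)
      fun_prop
    refine ge_of_tendsto ((hcont.tendsto q).comp hn) ?_
    filter_upwards [self_mem_nhdsWithin] with x hx
    have := (hc x hx).1.2 e (by
      rintro rfl
      simpa using hb.self_right)
    rw [hessian_phase hf] at this
    simp only [Function.comp, hessian_phase hf]
    exact this.le
  obtain ⟨α, hα, β, hβ, m, hm, hH, h1, h2⟩ :=
    exists_fold_box (contDiff_phase hf p) hq.1 hb hv hk he
  set C := ‖q‖ + α + β with hC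
  -- On the box the change of parameter costs at most `‖x - p‖ C`, so the walls stay above the
  -- saddle for `x` near `p`.
  have hlow : ∀ x y : Plane, |inner ℝ v (y - q)| ≤ α → |inner ℝ e (y - q)| ≤ β →
      phase f p y ≤ phase f x y + ‖x - p‖ * C := by
    intro x y hy1 hy2
    have h3 : ‖y‖ ≤ C := by
      have h4 : ‖y‖ ≤ ‖q‖ + ‖y - q‖ := norm_le_norm_add_norm_sub' _ _
      linarith [hb.norm_le (y - q)]
    have h5 : phase f p y = phase f x y + inner ℝ (x - p) y := by
      simp only [phase, inner_sub_left]
      ring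
    rw [h5]
    have h6 := real_inner_le_norm (x - p) y
    have h7 := mul_le_mul_of_nonneg_left h3 (norm_nonneg (x - p))
    linarith
  have hx : Tendsto (fun x : Plane => x) (𝓝[Ω] p) (𝓝 p) := nhdsWithin_le_nhds
  have hev1 : ∀ᶠ x in 𝓝[Ω] p, phase f x (s i x) + ‖x - p‖ * C < m := by
    have hlim : Tendsto (fun x => phase f x (s i x) + ‖x - p‖ * C) (𝓝[Ω] p)
        (𝓝 (phase f p q + ‖p - p‖ * C)) :=
      (((hf.continuous.tendsto q).comp hs).sub (hx.inner hs)).add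
        (((hx.sub_const p).norm).mul_const C)
    refine hlim.eventually (gt_mem_nhds ?_)
    simpa using hm
  have hev2 : ∀ᶠ x in 𝓝[Ω] p, |inner ℝ v (s i x - q)| < α ∧ |inner ℝ e (s i x - q)| < β := by
    have hc1 : Continuous fun y : Plane => |inner ℝ v (y - q)| := by fun_prop
    have hc2 : Continuous fun y : Plane => |inner ℝ e (y - q)| := by fun_prop
    exact (((hc1.tendsto q).comp hs).eventually (gt_mem_nhds (by simpa using hα))).and
      (((hc2.tendsto q).comp hs).eventually (gt_mem_nhds (by simpa using hβ)))
  filter_upwards [hev1, hev2, self_mem_nhdsWithin] with x hx1 hx2 hxΩ hno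
  refine (hc x hxΩ).connects_of_box (contDiff_phase hf x) hno hb hx2.1 hx2.2 (fun y hy1 hy2 => ?_)
    (fun y hy1 hy2 => ?_) fun y hy1 hy2 => ?_
  · rw [hessian_phase hf, ← hessian_phase hf p]
    exact hH y hy1 hy2
  · linarith [h1 y hy1 hy2, hlow x y hy1 hy2.le]
  · linarith [h2 y hy1 hy2, hlow x y (by rw [hy1, abs_of_pos hα]) hy2]

end FoldBox

/-! ### Openness and closedness of the connection between node and saddle -/

section Persistence

variable {f F : Plane → ℝ}

/-- By compactness the Hessian is uniformly positive definite near `n`, so `F` grows quadratically;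
the sphere serves as an energy barrier stable under perturbation. -/
theorem IsUnstableNode.exists_sphere (hF : ContDiff ℝ ∞ F) {n : Plane} (h : IsUnstableNode F n)
    {ε : ℝ} (hε : 0 < ε) :
    ∃ r > 0, r ≤ ε ∧ ∃ m > F n, ∀ y ∈ Metric.sphere n r, m ≤ F y := by
  have hHc := continuous_hessian hF
  obtain ⟨l, hl, hle⟩ := (isCompact_sphere (0 : Plane) 1).exists_forall_le' (a := 0)
    (f := fun d => hessian F n d d) (by fun_prop) (fun d hd => h.2 d (by
      rintro rfl
      simp at hd))
  have hcont : Continuous fun z : Plane × Plane => hessian F z.1 z.2 z.2 := by fun_prop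
  obtain ⟨r, hr, hball⟩ := Metric.nhds_basis_closedBall.mem_iff.1
    ((isCompact_sphere (0 : Plane) 1).eventually_forall_of_forall_eventually (x₀ := n)
      (P := fun y d => l / 2 < hessian F y d d) fun d hd =>
        (hcont.tendsto (n, d)).eventually (lt_mem_nhds (lt_of_lt_of_le (half_lt_self hl)
          (hle d hd))))
  have hquad : ∀ y ∈ Metric.closedBall n r, ∀ d, l / 2 * ‖d‖ ^ 2 ≤ hessian F y d d :=
    fun y hy d => by
      rcases eq_or_ne d 0 with rfl | hd
      · simp
      have hd' : ‖d‖ ≠ 0 := norm_ne_zero_iff.2 hd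
      have h1 : l / 2 < hessian F y (‖d‖⁻¹ • d) (‖d‖⁻¹ • d) := hball hy _ (by
        rw [mem_sphere_zero_iff_norm, norm_smul, norm_inv, norm_norm, inv_mul_cancel₀ hd'])
      simp only [map_smul, _root_.smul_apply, smul_eq_mul] at h1
      have h2 : ‖d‖⁻¹ * (‖d‖⁻¹ * hessian F y d d) * ‖d‖ ^ 2 = hessian F y d d := by
        field_simp
      rw [← h2]
      exact mul_le_mul_of_nonneg_right h1.le (sq_nonneg _)
  set ρ := min r ε with hρ
  have hρ0 : 0 < ρ := lt_min hr hε
  refine ⟨ρ, hρ0, min_le_right _ _, F n + l / 4 * ρ ^ 2, lt_add_of_pos_right _ (by positivity),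
    fun y hy => ?_⟩
  set d := y - n with hd
  have hdn : ‖d‖ = ρ := mem_sphere_iff_norm.1 hy
  have := taylor_lower_bound hF (y := n) (d := d) (m := l / 2 * ρ ^ 2) fun t ht => by
    have h1 : n + t • d ∈ Metric.closedBall n r := by
      rw [mem_closedBall_iff_norm, add_sub_cancel_left, norm_smul, Real.norm_of_nonneg ht.1, hdn]
      have h2 : ρ ≤ r := min_le_left _ _
      nlinarith [ht.2]
    have h3 := hquad _ h1 d
    rwa [hdn] at h3
  rw [h.1, inner_zero_left, add_zero, hd, add_sub_cancel] at this
  linarith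

theorem HasNodeAndThreeSaddles.node_ne {n : Plane} {s : Fin 3 → Plane}
    (h : HasNodeAndThreeSaddles F n s) (i : Fin 3) : n ≠ s i := by
  intro he
  obtain ⟨-, -, w, hw⟩ := h.2.1 i
  rw [← he] at hw
  have hw0 : w ≠ 0 := by
    rintro rfl
    simp at hw
  exact lt_asymm hw (h.1.2 w hw0)

variable {n : Plane → Plane} {s : Fin 3 → Plane → Plane} {x₀ : Plane}

theorem phase_eq_add (f : Plane → ℝ) (x x' y : Plane) :
    phase f x' y = phase f x y + inner ℝ (x - x') y := by
  simp only [phase, inner_sub_left]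
  ring

/-- The basin of the node is open in the parameter and the point. -/
theorem eventually_tendsBackward (hf : ContDiff ℝ ∞ f) (hs : ∀ i, ContinuousAt (s i) x₀)
    (hc : ∀ᶠ x in 𝓝 x₀, HasNodeAndThreeSaddles (phase f x) (n x) fun i => s i x) {z₀ : Plane}
    (h : TendsBackward (phase f x₀) z₀ (n x₀)) :
    ∀ᶠ p : Plane × Plane in 𝓝 (x₀, z₀), TendsBackward (phase f p.1) p.2 (n p.1) := by
  have hc₀ := hc.self_of_nhds
  have hF := contDiff_phase hf x₀
  obtain ⟨ε, hε, hεs⟩ : ∃ ε > 0, ∀ i, s i x₀ ∉ Metric.closedBall (n x₀) ε := by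
    have h1 : (range fun i => s i x₀)ᶜ ∈ 𝓝 (n x₀) :=
      (finite_range _).isClosed.isOpen_compl.mem_nhds (by
        rintro ⟨i, hi⟩
        exact hc₀.node_ne i hi.symm)
    obtain ⟨ε, hε, hsub⟩ := Metric.nhds_basis_closedBall.mem_iff.1 h1
    exact ⟨ε, hε, fun i hi => hsub hi ⟨i, rfl⟩⟩
  obtain ⟨r, hr, hrε, m, hm, hsphere⟩ := hc₀.1.exists_sphere hF hε
  obtain ⟨γ, hγ0, hγ, hγn⟩ := h
  -- At time `T` the orbit is in the ball and below its barrier. Nearby orbits and parameters share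
  -- this, and the ball contains no saddle, so they are trapped backwards to the node.
  obtain ⟨T, ⟨hTball, hTm⟩, hT⟩ := ((hγn.eventually
    ((Metric.isOpen_ball.eventually_mem (Metric.mem_ball_self hr)).and
    ((hF.continuous.tendsto (n x₀)).eventually (gt_mem_nhds hm)))).and
    (eventually_le_atBot 0)).exists
  have hγc : ContinuousOn γ (Icc T 0) := fun t ht => (hγ t ht.2).continuousAt.continuousWithinAt
  obtain ⟨R, hR⟩ := (isCompact_Icc.image_of_continuousOn hγc).isBounded.subset_closedBall 0
  -- The margin `1` leaves room for perturbed orbits, which stay within distance `1` of the given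
  -- one on `[T, 0]`.
  obtain ⟨Y, K, hY, hYeq⟩ := exists_lipschitz_extension_gradient hf 0 (R + 1)
  obtain ⟨Ψ, hΨ0, hΨ, C, hC, hΨd⟩ := exists_parametric_flow hY
  have hYx : LipschitzOnWith K (fun y => Y y - x₀) univ := by
    refine (LipschitzWith.of_dist_le_mul fun y y' => ?_).lipschitzOnWith
    rw [dist_sub_right]
    exact hY.dist_le_mul y y'
  have hΨγ : EqOn (fun t => Ψ x₀ t z₀) γ (Icc T 0) :=
    integralCurve_eqOn_Icc hYx (t₀ := 0) ⟨hT, le_rfl⟩ (fun t _ => hΨ x₀ z₀ t)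
      (fun _ _ => mem_univ _) (fun t ht => by
        have h1 : γ t ∈ Metric.closedBall 0 (R + 1) :=
          Metric.closedBall_subset_closedBall (by linarith) (hR (mem_image_of_mem _ ht))
        have h2 := hγ t ht.2
        rwa [gradient_phase hf, hYeq h1] at h2) (fun _ _ => mem_univ _) (by rw [hΨ0, hγ0])
  have hΨT : ContinuousAt (fun p : Plane × Plane => Ψ p.1 T p.2) (x₀, z₀) := by
    have : LipschitzWith ⟨Real.exp (C * |T|), (Real.exp_pos _).le⟩
        fun p : Plane × Plane => Ψ p.1 T p.2 := LipschitzWith.of_dist_le_mul fun p q => by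
      rw [mul_comm]
      exact hΨd p.1 q.1 p.2 q.2 T
    exact this.continuous.continuousAt
  have hΨT₀ : Ψ x₀ T z₀ = γ T := hΨγ ⟨le_rfl, hT⟩
  have hclose : ∀ᶠ p : Plane × Plane in 𝓝 (x₀, z₀), dist p (x₀, z₀) * Real.exp (C * |T|) < 1 := by
    have hcont : Continuous fun p : Plane × Plane => dist p (x₀, z₀) * Real.exp (C * |T|) := by
      fun_prop
    exact (hcont.tendsto _).eventually (gt_mem_nhds (by simp))
  have hfst : Tendsto (fun p : Plane × Plane => p.1) (𝓝 (x₀, z₀)) (𝓝 x₀) := continuous_fst.tendsto _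
  have hball : ∀ᶠ p : Plane × Plane in 𝓝 (x₀, z₀), Ψ p.1 T p.2 ∈ Metric.ball (n x₀) r :=
    hΨT.eventually_mem (Metric.isOpen_ball.mem_nhds (by rwa [hΨT₀]))
  have hlow : ∀ᶠ p : Plane × Plane in 𝓝 (x₀, z₀),
      phase f p.1 (Ψ p.1 T p.2) + ‖p.1 - x₀‖ * (‖n x₀‖ + r) < m := by
    have hcont : ContinuousAt (fun p : Plane × Plane => phase f p.1 (Ψ p.1 T p.2) +
        ‖p.1 - x₀‖ * (‖n x₀‖ + r)) (x₀, z₀) := by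
      simp only [phase]
      exact ((hf.continuous.continuousAt.comp hΨT).sub (continuousAt_fst.inner hΨT)).add
        (((continuousAt_fst.sub continuousAt_const).norm).mul continuousAt_const)
    refine hcont.eventually (gt_mem_nhds ?_)
    simpa [hΨT₀] using hTm
  have hsaddle : ∀ᶠ p : Plane × Plane in 𝓝 (x₀, z₀),
      ∀ i, s i p.1 ∉ Metric.closedBall (n x₀) r := by
    rw [eventually_all]
    intro i
    refine hfst.eventually ((hs i).eventually (Metric.isClosed_closedBall.isOpen_compl.mem_nhds ?_))
    exact fun hi => hεs i (Metric.closedBall_subset_closedBall hrε hi)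
  filter_upwards [hclose, hball, hlow, hsaddle, hfst.eventually hc] with p h1 h2 h3 h4 h5
  have hFp := contDiff_phase hf p.1
  obtain ⟨c, hcl, hc0, hback⟩ := exists_tendsBackward_of_barrier hFp h5.finite
    (O := Metric.ball (n x₀) r) Metric.isOpen_ball Metric.isBounded_ball
    (c := m - ‖p.1 - x₀‖ * (‖n x₀‖ + r)) (fun y hy => by
      rw [frontier_ball _ hr.ne'] at hy
      have h6 := hsphere y hy
      rw [phase_eq_add f p.1 x₀] at h6
      have h7 : ‖y‖ ≤ ‖n x₀‖ + r := by
        have := norm_le_norm_add_norm_sub' y (n x₀)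
        rwa [mem_sphere_iff_norm.1 hy] at this
      have h8 := real_inner_le_norm (p.1 - x₀) y
      have h9 := mul_le_mul_of_nonneg_left h7 (norm_nonneg (p.1 - x₀))
      linarith) h2 (by linarith)
  have hcn : c = n p.1 := by
    rcases h5.2.2.2 c hc0 with h6 | ⟨i, h6⟩
    · exact h6
    · rw [h6] at hcl
      exact absurd (Metric.closure_ball_subset_closedBall hcl) (h4 i)
  have := TendsBackward.along (F := phase f p.1) hT (δ := fun t => Ψ p.1 t p.2) (fun t ht => by
    have h6 : dist (Ψ p.1 t p.2) (Ψ x₀ t z₀) ≤ 1 := by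
      refine ((hΨd p.1 x₀ p.2 z₀ t).trans ?_).trans h1.le
      have h7 : |t| ≤ |T| := by
        rw [abs_of_nonpos ht.2, abs_of_nonpos hT]
        linarith [ht.1]
      exact mul_le_mul_of_nonneg_left (Real.exp_le_exp.2 (mul_le_mul_of_nonneg_left h7 hC))
        (le_max_of_le_left dist_nonneg)
    have h8 : Ψ p.1 t p.2 ∈ Metric.closedBall 0 (R + 1) := by
      have h9 : Ψ x₀ t z₀ ∈ Metric.closedBall 0 R := by
        rw [show Ψ x₀ t z₀ = γ t from hΨγ ht]
        exact hR (mem_image_of_mem _ ht)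
      rw [Metric.mem_closedBall] at h9 ⊢
      linarith [dist_triangle (Ψ p.1 t p.2) (Ψ x₀ t z₀) 0]
    rw [gradient_phase hf, hYeq h8]
    exact hΨ p.1 p.2 t) hback
  rw [hΨ0, hcn] at this
  exact this

/-- Near a given parameter, the gradient lines from the node to a saddle are uniformly bounded. -/
theorem exists_uniform_bound (hf : ContDiff ℝ ∞ f)
    (hcoer : Tendsto (fun y => ‖gradient f y‖) (cocompact Plane) atTop) (hn : ContinuousAt n x₀)
    {σ : Plane → Plane} (hσ : ContinuousAt σ x₀) :
    ∃ R : ℝ, ∀ᶠ x in 𝓝 x₀, n x ≠ σ x → ∀ γ, IsGradientLine (phase f x) γ (n x) (σ x) →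
      ∀ t, γ t ∈ Metric.closedBall 0 R := by
  obtain ⟨R₁, hR₁⟩ : ∃ R₁ : ℝ, ∀ y : Plane, R₁ ≤ ‖y‖ → ‖x₀‖ + 2 ≤ ‖gradient f y‖ := by
    have h1 := hcoer.eventually (eventually_ge_atTop (‖x₀‖ + 2))
    rw [← Metric.cobounded_eq_cocompact, ← comap_norm_atTop, eventually_comap] at h1
    -- The margin `2` makes the gradient of the phase at least `1` beyond this radius for all `x`
    -- within `1` of `x₀`.
    obtain ⟨R₁, h2⟩ := eventually_atTop.1 h1
    exact ⟨R₁, fun y hy => h2 _ hy y rfl⟩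
  set R₀ := max R₁ (‖σ x₀‖ + 1)
  set E := phase f x₀ (σ x₀) - phase f x₀ (n x₀) + 1
  have hE : ∀ᶠ x in 𝓝 x₀, phase f x (σ x) - phase f x (n x) < E := by
    have hp : ∀ {τ : Plane → Plane}, ContinuousAt τ x₀ →
        ContinuousAt (fun x => phase f x (τ x)) x₀ := fun hτ => by
      simp only [phase]
      exact (hf.continuous.continuousAt.comp hτ).sub (continuousAt_id.inner hτ)
    exact ((hp hσ).sub (hp hn)).eventually (gt_mem_nhds (lt_add_one _))
  have hσ' : ∀ᶠ x in 𝓝 x₀, ‖σ x‖ < R₀ :=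
    hσ.norm.eventually (gt_mem_nhds ((lt_add_one _).trans_le (le_max_right _ _)))
  have hx : ∀ᶠ x in 𝓝 x₀, ‖x‖ < ‖x₀‖ + 1 :=
    continuousAt_id.norm.eventually (gt_mem_nhds (lt_add_one _))
  -- Returning from farther out to the saddle crosses an annulus thicker than `E`, which would cost
  -- more energy than the node and the saddle differ by.
  refine ⟨R₀ + (max E 0 + 1), ?_⟩
  filter_upwards [hE, hσ', hx] with x hxE hxσ hxx hne γ hγ t
  by_contra hfar
  rw [mem_closedBall_zero_iff, not_le] at hfar
  have hF := contDiff_phase hf x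
  obtain ⟨b, hb, htb⟩ := ((hγ.2.2.norm.eventually (gt_mem_nhds hxσ)).and
    (eventually_ge_atTop t)).exists
  have hE0 := le_max_right E 0
  have h1 := annulus_crossing hF htb (fun u _ => hγ.1 u) (p := 0) (r₁ := R₀)
    (r₂ := R₀ + (max E 0 + 1)) (m := 1) (by linarith) one_pos (by simpa using hb.le)
    (by simpa using hfar.le) fun y hy _ => by
      rw [sub_zero] at hy
      have h2 := hR₁ y ((le_max_left _ _).trans hy)
      rw [gradient_phase hf]
      have h3 := norm_sub_norm_le (gradient f y) x
      linarith
  have h2 := hγ.strict hF (hγ.gradient_ne_zero hF hne 0)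
  linarith [(h2 t).1, (h2 b).2, le_max_left E 0]

theorem IsSaddle.exists_isFrame (hf : ContDiff ℝ ∞ f) {x y : Plane} (h : IsSaddle (phase f x) y) :
    gradient f y = x ∧ ∃ e w, IsFrame (hessOp f y) e w := by
  obtain ⟨h0, ⟨v, hv⟩, w, hw⟩ := h
  rw [gradient_phase hf, sub_eq_zero] at h0
  rw [hessian_phase hf, ← inner_fderiv_gradient hf] at hv hw
  obtain ⟨a, -, w', hw'⟩ := GradientLines.exists_isFrame (hessOp_symm hf y) hv hw
  exact ⟨h0, _, _, hw'⟩

/-- Connections from the node to a saddle persist under perturbation of the parameter. -/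
theorem eventually_connects (hf : ContDiff ℝ ∞ f) (hs : ∀ i, ContinuousAt (s i) x₀)
    (hc : ∀ᶠ x in 𝓝 x₀, HasNodeAndThreeSaddles (phase f x) (n x) fun i => s i x) {i : Fin 3}
    (h : Connects (phase f x₀) (n x₀) (s i x₀)) :
    ∀ᶠ x in 𝓝 x₀, Connects (phase f x) (n x) (s i x) := by
  have hc₀ := hc.self_of_nhds
  obtain ⟨hg, e, w, hfr⟩ := (hc₀.2.1 i).exists_isFrame hf
  obtain ⟨r, hr, z, hz, hbr⟩ := exists_stable_branches hf hfr
  obtain ⟨γ, hγ⟩ := h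
  obtain ⟨-, hthrough⟩ := hbr (s i x₀) (Metric.mem_ball_self hr)
  rw [hg] at hthrough
  obtain ⟨σ, t, ht⟩ := hthrough _ γ hγ (hc₀.node_ne i)
  have hback := hγ.tendsBackward t
  rw [ht] at hback
  have hz' : ContinuousAt (fun x => (x, z σ (s i x))) x₀ :=
    continuousAt_id.prodMk (ContinuousAt.comp (hz σ) (hs i))
  filter_upwards [hz'.eventually (eventually_tendsBackward hf hs hc hback), hc,
    (hs i).eventually (Metric.ball_mem_nhds _ hr)] with x h1 h2 h3
  have h4 := ((hbr (s i x) h3).1 σ).2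
  rw [((h2.2.1 i).exists_isFrame hf).1] at h4
  obtain ⟨δ, hδ, -⟩ := h1.exists_gradientLine h4
  exact ⟨δ, hδ⟩

/-- Limits of connections from the node to a saddle are such connections, unless there is a
connection from another saddle. -/
theorem connects_of_frequently (hf : ContDiff ℝ ∞ f)
    (hcoer : Tendsto (fun y => ‖gradient f y‖) (cocompact Plane) atTop) (hn : ContinuousAt n x₀)
    {i : Fin 3} (hs : ContinuousAt (s i) x₀)
    (hc : ∀ᶠ x in 𝓝 x₀, HasNodeAndThreeSaddles (phase f x) (n x) fun i => s i x)
    (hno : ∀ j, j ≠ i → ¬ Connects (phase f x₀) (s j x₀) (s i x₀))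
    (h : ∃ᶠ x in 𝓝 x₀, Connects (phase f x) (n x) (s i x)) :
    Connects (phase f x₀) (n x₀) (s i x₀) := by
  have hc₀ := hc.self_of_nhds
  have hF := contDiff_phase hf x₀
  obtain ⟨hg, e, w, hfr⟩ := (hc₀.2.1 i).exists_isFrame hf
  obtain ⟨r, hr, z, hz, hbr⟩ := exists_stable_branches hf hfr
  obtain ⟨R, hR⟩ := exists_uniform_bound hf hcoer hn hs
  obtain ⟨Y, K, hY, hYeq⟩ := exists_lipschitz_extension_gradient hf 0 R
  obtain ⟨Ψ, hΨ0, hΨ, C, hC, hΨd⟩ := exists_parametric_flow hY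
  -- In terms of the marker, being connected entails a backward orbit in a fixed ball. This is
  -- closed in `x`; with two sides, one of them occurs frequently.
  have hfreq : ∃ᶠ x in 𝓝 x₀, ∃ σ, ∀ t ≤ 0, Ψ x t (z σ (s i x)) ∈ Metric.closedBall 0 R := by
    refine (h.and_eventually ((hc.and hR).and
      (hs.eventually (Metric.ball_mem_nhds _ hr)))).mono ?_
    rintro x ⟨⟨γ, hγ⟩, ⟨hcx, hRx⟩, hsx⟩
    have hin := hRx (hcx.node_ne i) γ hγ
    have h1 := (hbr (s i x) hsx).2
    rw [((hcx.2.1 i).exists_isFrame hf).1] at h1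
    obtain ⟨σ, a, ha⟩ := h1 _ γ hγ (hcx.node_ne i)
    refine ⟨σ, fun t ht => ?_⟩
    have hYx : LipschitzOnWith K (fun y => Y y - x) univ := by
      refine (LipschitzWith.of_dist_le_mul fun y y' => ?_).lipschitzOnWith
      rw [dist_sub_right]
      exact hY.dist_le_mul y y'
    have h2 := integralCurve_eqOn_Icc hYx (a := t) (b := 0) (t₀ := 0) ⟨ht, le_rfl⟩
      (γ := fun u => Ψ x u (z σ (s i x))) (δ := fun u => γ (u + a))
      (fun u _ => hΨ x _ u) (fun _ _ => mem_univ _) (fun u _ => by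
        have h3 := (hγ.1 (u + a)).comp_add_const u a
        rwa [gradient_phase hf, hYeq (hin _)] at h3) (fun _ _ => mem_univ _)
      (by simp [hΨ0, ha]) ⟨le_rfl, ht⟩
    simp only at h2
    rw [h2]
    exact hin _
  obtain ⟨σ, hσ⟩ : ∃ σ, ∃ᶠ x in 𝓝 x₀, ∀ t ≤ 0, Ψ x t (z σ (s i x)) ∈ Metric.closedBall 0 R := by
    simp only [Bool.exists_bool, frequently_or_distrib] at hfreq
    rcases hfreq with h1 | h1
    exacts [⟨_, h1⟩, ⟨_, h1⟩]
  have hlim : ∀ t ≤ 0, Ψ x₀ t (z σ (s i x₀)) ∈ Metric.closedBall 0 R := by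
    intro t ht
    have hcont : Continuous fun p : Plane × Plane => Ψ p.1 t p.2 := by
      have : LipschitzWith ⟨Real.exp (C * |t|), (Real.exp_pos _).le⟩
          fun p : Plane × Plane => Ψ p.1 t p.2 := LipschitzWith.of_dist_le_mul fun p q => by
        rw [mul_comm]
        exact hΨd p.1 q.1 p.2 q.2 t
      exact this.continuous
    have hz' : Tendsto (fun x => Ψ x t (z σ (s i x))) (𝓝 x₀) (𝓝 (Ψ x₀ t (z σ (s i x₀)))) :=
      (hcont.tendsto (x₀, z σ (s i x₀))).comp
        (continuousAt_id.prodMk (ContinuousAt.comp (hz σ) hs))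
    exact Metric.isClosed_closedBall.mem_of_frequently_of_tendsto (hσ.mono fun x hx => hx t ht) hz'
  have hder : ∀ t ≤ 0, HasDerivAt (fun t => Ψ x₀ t (z σ (s i x₀)))
      (gradient (phase f x₀) (Ψ x₀ t (z σ (s i x₀)))) t := fun t ht => by
    rw [gradient_phase hf, hYeq (hlim t ht)]
    exact hΨ _ _ t
  obtain ⟨p, -, hp0, hp⟩ := exists_tendsto_atBot hF hc₀.finite hder
    (isCompact_closedBall 0 R) hlim
  obtain ⟨hne, hforw⟩ := (hbr (s i x₀) (Metric.mem_ball_self hr)).1 σ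
  rw [hg] at hforw
  have hback : TendsBackward (phase f x₀) (z σ (s i x₀)) p := ⟨_, hΨ0 _ _, hder, hp⟩
  have hpn := hc₀.tendsBackward_node hF hno hne hforw hback hp0
  obtain ⟨δ, hδ, -⟩ := hback.exists_gradientLine hforw
  exact ⟨δ, hpn ▸ hδ⟩

end Persistence

/-! ### The umbilic's gradient growth and continuation along bifurcation lines -/

section BifurcationLines

variable {f : Plane → ℝ}

theorem hasGradientAt_ellipticUmbilic (y : Plane) :
    HasGradientAt ellipticUmbilic !₂[y 0 ^ 2 - y 1 ^ 2, -2 * y 0 * y 1] y := by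
  rw [hasGradientAt_iff_hasFDerivAt]
  have h0 : HasFDerivAt (fun y : Plane => y 0) (EuclideanSpace.proj (𝕜 := ℝ) 0) y :=
    (EuclideanSpace.proj (𝕜 := ℝ) (0 : Fin 2)).hasFDerivAt
  have h1 : HasFDerivAt (fun y : Plane => y 1) (EuclideanSpace.proj (𝕜 := ℝ) 1) y :=
    (EuclideanSpace.proj (𝕜 := ℝ) (1 : Fin 2)).hasFDerivAt
  refine (((h0.pow 3).mul_const (3⁻¹ : ℝ)).sub
    (h0.mul (h1.pow 2))).congr_fderiv ?_ |>.congr_of_eventuallyEq (Eventually.of_forall fun z => ?_)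
  · ext d
    simp [PiLp.inner_apply, Fin.sum_univ_two]
    ring
  · simp [ellipticUmbilic, div_eq_mul_inv]

/-- In complex notation the gradient is the conjugate of the square of `y`. This exact growth
dominates the gradient of `g`. -/
theorem norm_gradient_ellipticUmbilic (y : Plane) : ‖gradient ellipticUmbilic y‖ = ‖y‖ ^ 2 := by
  rw [(hasGradientAt_ellipticUmbilic y).gradient, ← sq_eq_sq₀ (norm_nonneg _) (by positivity),
    EuclideanSpace.norm_sq_eq, EuclideanSpace.norm_sq_eq]
  simp [Fin.sum_univ_two]
  ring

theorem contDiff_ellipticUmbilic : ContDiff ℝ ∞ ellipticUmbilic := by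
  unfold ellipticUmbilic
  fun_prop

theorem tendsto_norm_gradient {g : Plane → ℝ} (hg : ContDiff ℝ ∞ g)
    (ho : (fun y => gradient g y) =o[cocompact Plane] fun y => ‖y‖ ^ 2) :
    Tendsto (fun y => ‖gradient (fun y => ellipticUmbilic y + g y) y‖) (cocompact Plane) atTop := by
  have hsum : ∀ y, gradient (fun y => ellipticUmbilic y + g y) y =
      gradient ellipticUmbilic y + gradient g y := fun y => by
    refine HasGradientAt.gradient ?_
    rw [hasGradientAt_iff_hasFDerivAt, map_add]
    exact ((contDiff_ellipticUmbilic.differentiable (by simp) y).hasGradientAt.hasFDerivAt).add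
      (hg.differentiable (by simp) y).hasGradientAt.hasFDerivAt
  have h1 : Tendsto (fun y : Plane => 2⁻¹ * ‖y‖ ^ 2) (cocompact Plane) atTop :=
    ((tendsto_pow_atTop two_ne_zero).comp (tendsto_norm_cocompact_atTop (E := Plane))).const_mul_atTop
      (by norm_num)
  refine tendsto_atTop_mono' _ ?_ h1
  filter_upwards [ho.bound (by norm_num : (0 : ℝ) < 2⁻¹)] with y hy
  rw [hsum]
  have h2 := norm_sub_le_norm_add (gradient ellipticUmbilic y) (gradient g y)
  rw [norm_gradient_ellipticUmbilic] at h2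
  rw [Real.norm_of_nonneg (by positivity)] at hy
  linarith

/-- Along a curve inside the caustic that starts at the side where the node glues together with a
saddle, the node remains connected with this saddle as long as no other saddle gets connected
with it. -/
theorem connects_along (hf : ContDiff ℝ ∞ f)
    (hcoer : Tendsto (fun y => ‖gradient f y‖) (cocompact Plane) atTop) {Ω : Set Plane}
    {n : Plane → Plane} {s : Fin 3 → Plane → Plane} (hΩ : IsInsideCaustic f Ω n s)
    {L : ℝ → Plane} (hL : ContinuousOn L (Icc 0 1)) {i : Fin 3} (h0 : L 0 ∈ side f Ω n s i)
    (hLΩ : ∀ u ∈ Ioo (0 : ℝ) 1, L u ∈ Ω)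
    (hno : ∀ u ∈ Ioo (0 : ℝ) 1, ∀ j, j ≠ i → ¬ Connects (phase f (L u)) (s j (L u)) (s i (L u)))
    {u : ℝ} (hu : u ∈ Ioo (0 : ℝ) 1) : Connects (phase f (L u)) (n (L u)) (s i (L u)) := by
  set A := {u | u ∈ Ioo (0 : ℝ) 1 ∧ Connects (phase f (L u)) (n (L u)) (s i (L u))} with hA
  have hLc : ∀ u ∈ Ioo (0 : ℝ) 1, ContinuousAt L u := fun u hu =>
    hL.continuousAt (Icc_mem_nhds hu.1 hu.2)
  have hnhds : ∀ u ∈ Ioo (0 : ℝ) 1, Ω ∈ 𝓝 (L u) := fun u hu => hΩ.isOpen.mem_nhds (hLΩ u hu)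
  have hcrit : ∀ u ∈ Ioo (0 : ℝ) 1,
      ∀ᶠ x in 𝓝 (L u), HasNodeAndThreeSaddles (phase f x) (n x) fun i => s i x := fun u hu =>
    Eventually.mono (hnhds u hu) hΩ.critical
  have hn : ∀ u ∈ Ioo (0 : ℝ) 1, ContinuousAt n (L u) := fun u hu =>
    hΩ.continuousOn_node.continuousAt (hnhds u hu)
  have hs : ∀ u ∈ Ioo (0 : ℝ) 1, ∀ i, ContinuousAt (s i) (L u) := fun u hu i =>
    (hΩ.continuousOn_saddle i).continuousAt (hnhds u hu)
  have hopen : IsOpen A := isOpen_iff_mem_nhds.2 fun u ⟨hu, hc⟩ => by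
    filter_upwards [Ioo_mem_nhds hu.1 hu.2, (hLc u hu).eventually
      (eventually_connects hf (hs u hu) (hcrit u hu) hc)] with u' h1 h2
    exact ⟨h1, h2⟩
  have hclosed : closure A ∩ Ioo 0 1 ⊆ A := fun u ⟨hu, hu1⟩ => ⟨hu1,
    connects_of_frequently hf hcoer (hn u hu1) (hs u hu1 i) (hcrit u hu1) (hno u hu1)
      (Tendsto.frequently (hLc u hu1) ((mem_closure_iff_frequently.1 hu).mono fun _ h => h.2))⟩
  have hstart : (Ioo 0 1 ∩ A).Nonempty := by
    obtain ⟨-, q, hq, hnq, hsq⟩ := h0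
    have hL0 : Tendsto L (𝓝[>] 0) (𝓝[Ω] (L 0)) := by
      refine tendsto_nhdsWithin_iff.2 ⟨?_, ?_⟩
      · exact ((hL 0 ⟨le_rfl, zero_le_one⟩).mono Ioo_subset_Icc_self).mono_left
          (nhdsWithin_Ioo_eq_nhdsGT (zero_lt_one' ℝ)).ge
      · filter_upwards [Ioo_mem_nhdsGT (zero_lt_one' ℝ)] with u hu using hLΩ u hu
    have : (𝓝[Ω] (L 0)).NeBot := hL0.neBot
    obtain ⟨u, h1, h2⟩ := ((hL0.eventually
      (eventually_connects_of_fold hf hΩ.critical hq hnq hsq)).and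
      (Ioo_mem_nhdsGT (zero_lt_one' ℝ))).exists
    exact ⟨u, h2, h2, h1 (hno u h2)⟩
  -- The connected parameters form a nonempty, open and relatively closed subset of the interval.
  exact (isPreconnected_Ioo.subset_of_closure_inter_subset hopen hstart hclosed hu).2

end BifurcationLines

end GradientLines

theorem mainTheorem11 :
    -- no planar gradient field with exactly these critical points has the four gradient lines
    (∀ (F : Plane → ℝ) (n : Plane) (s : Fin 3 → Plane), ContDiff ℝ ∞ F →
      HasNodeAndThreeSaddles F n s →
      ¬ (Connects F n (s 1) ∧ Connects F n (s 2) ∧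
          Connects F (s 1) (s 0) ∧ Connects F (s 2) (s 0))) ∧
    -- the bifurcation lines of configuration (d) do not intersect inside the caustic
    (∀ (g : Plane → ℝ) (Ω : Set Plane) (n : Plane → Plane) (s : Fin 3 → Plane → Plane)
      (L₁ L₂ : ℝ → Plane),
      ContDiff ℝ ∞ g →
      (fun y => gradient g y) =o[cocompact Plane] (fun y => ‖y‖ ^ 2) →
      IsInsideCaustic (fun y => ellipticUmbilic y + g y) Ω n s →
      IsBifurcationLine (fun y => ellipticUmbilic y + g y) Ω n s L₁ 1 2 0 →
      IsBifurcationLine (fun y => ellipticUmbilic y + g y) Ω n s L₂ 2 1 0 →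
      (∀ x ∈ L₁ '' Ioo 0 1 ∪ L₂ '' Ioo 0 1, ∀ i j : Fin 3, i ≠ j →
        x ∈ bifurcationSet (fun y => ellipticUmbilic y + g y) Ω s i j → j = 0) →
      L₁ '' Ioo 0 1 ∩ L₂ '' Ioo 0 1 = ∅) := by
  refine ⟨fun F n s hF hs ⟨h1, h2, h3, h4⟩ => not_four_gradientLines hF hs h1 h2 h3 h4, ?_⟩
  intro g Ω n s L₁ L₂ hg ho hΩ hL₁ hL₂ hno
  set f : Plane → ℝ := fun y => ellipticUmbilic y + g y with hf_def
  have hf : ContDiff ℝ ∞ f := contDiff_ellipticUmbilic.add hg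
  have hcoer := tendsto_norm_gradient hg ho
  -- Only connections ending at `s 0` occur on the two lines, so with `i ≠ 0` no other saddle is
  -- ever joined to `s i`.
  have along : ∀ {L : ℝ → Plane} {i k : Fin 3}, IsBifurcationLine f Ω n s L i k 0 → i ≠ 0 →
      L '' Ioo 0 1 ⊆ L₁ '' Ioo 0 1 ∪ L₂ '' Ioo 0 1 → ∀ u ∈ Ioo (0 : ℝ) 1,
      Connects (phase f (L u)) (n (L u)) (s i (L u)) := fun hL hi hsub u hu =>
    connects_along hf hcoer hΩ hL.continuousOn hL.extreme
      (fun v hv => (hL.mem_bifurcationSet v hv).1)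
      (fun v hv j hj hc => hi (hno _ (hsub (mem_image_of_mem _ hv)) j _ hj
        ⟨(hL.mem_bifurcationSet v hv).1, hc⟩)) hu
  refine eq_empty_of_forall_notMem ?_
  rintro _ ⟨⟨u, hu, rfl⟩, u', hu', he⟩
  have h1 := along hL₁ (by decide) subset_union_left u hu
  have h2 := along hL₂ (by decide) subset_union_right u' hu'
  have h3 := (hL₁.mem_bifurcationSet u hu).2
  have h4 := (hL₂.mem_bifurcationSet u' hu').2
  rw [he] at h2 h4
  exact not_four_gradientLines (contDiff_phase hf _)
    (hΩ.critical _ (hL₁.mem_bifurcationSet u hu).1) h1 h2 h3 h4
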